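/- **Setting.** Let $X_1,X_2,\dots$ be i.i.d. random variables with law $\mathbf P$ (with values in $\mathbb R$, or more generally in any measurable space). Let $d(n)\to\infty$ be integers, $\Theta\subset\mathbb R^q$ compact, $\theta_0\in\operatorname{Int}(\Theta)$, and let $g=g_n:\mathcal X\times\mathbb R^q\to\mathbb R^{d(n)}$ be measurable in $x$ with $E_{\mathbf P}[g(X,\theta_0)]=0$. For a positive definite, possibly random, matrix $\hat W_n$ and a function $s:\mathcal V\to\mathbb R$, $\mathcal V\subseteq\mathbb R$, put $$\hat Q_{GMM,n}(\theta)=\Big(\tfrac1n\sum_{i\le n} g(X_i,\theta)\Big)^T\hat W_n\Big(\tfrac1n\sum_{i\le n} g(X_i,\theta)\Big),\qquad \hat Q_{GEL,n}(\theta)=\sup_{\lambda\in\Lambda_n(\theta)}\sum_{i\le n} s(\lambda^Tg(X_i,\theta))\in(-\infty,+\infty],$$ $$\Lambda_n(\theta)=\{\lambda\in\mathbb R^{d(n)}:\lambda^Tg(X_i,\theta)\in\mathcal V\ \text{for all } i\le n\}.$$ Let $\hat\theta_{j,n}\in\arg\min_{\theta\in\Theta}\hat Q_{j,n}(\theta)$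 for $j\in\{GMM,GEL\}$, $\hat T_{GMM,n}=n\hat Q_{GMM,n}(\hat\theta_{GMM,n})$ and $\hat T_{GEL,n}=2\{\hat Q_{GEL,n}(\hat\theta_{GEL,n})-ns(0)\}$. The bootstrap objects $\hat Q^*_{j,n},\Lambda^*_n,\hat\theta^*_{j,n},\hat T^*_{j,n}$ are defined in the same way with $\omega_{i,n}g(X_i,\theta)$ in place of $g(X_i,\theta)$ (and the same $\hat W_n$). Conditionally on the data $Z^n$, the weights $(\omega_{1,n},\dots,\omega_{n,n})$ have law $\mathbf P^*_n(\cdot\mid Z^n)$, under which they are independent with mean $0$ and variance $1$; they are bounded by a constant that does not depend on $n$. For data-and-weight dependent $V_n$ and $c_n\ge0$, "$V_n=O_{\mathbf P^*_n(\cdot|Z^n)}(c_n)$ wpa1-$\mathbf P$" means: for every $\varepsilon>0$ there are $M,N$ with $\mathbf P\big(\mathbf P^*_n(|V_n|\ge Mc_n\mid Z^n)\le\varepsilon\big)\ge1-\varepsilon$ for all $n\ge N$; for "$o$" replace $M$ by $\varepsilon$. Norms $\|\cdot\|_2$ of matrices are operator norms; $\nabla_\theta g$ is the derivative of $g$ in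 $\theta$. **Assumptions.** There are constants $C\ge 1$, $\gamma>0$, $\beta\ge1$, independent of $n$, and an open neighbourhood $\mathcal N$ of $\theta_0$ such that for all $n$: 1. the eigenvalues of $\Omega=\Omega_n=E_{\mathbf P}[g(X,\theta_0)g(X,\theta_0)^T]$ lie in $[C^{-1},C]$; 2. (i) $E_{\mathbf P}[\sup_{\theta\in\mathcal N}\|g(X,\theta)\|_2^{2(2+\gamma)}]\le C\,d(n)^{2+\gamma}$; (ii) $\theta\mapsto g(X,\theta)$ is continuously differentiable a.s.; (iii) $E_{\mathbf P}[\sup_{\theta\in\mathcal N}\|\nabla_\theta g(X,\theta)\|_2^{2\beta}]\le C\,d(n)^{\beta}$; (iv) there is a measurable $\delta_n$ with $\|\nabla_\theta g(X,\theta)-\nabla_\theta g(X,\theta_0)\|_2\le C\,\delta_n(X)\|\theta-\theta_0\|_2$ for all $\theta\in\mathcal N$ a.s. and $E_{\mathbf P}[\delta_n(X)^2]\le C\,d(n)$; 3. there are positive definite $W=W_n\in\mathbb R^{d(n)\times d(n)}$ with eigenvalues in $[C^{-1},C]$ and $\|\hat W_n-W\|_2=o_{\mathbf P}(d(n)^{-1/2})$;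 4. $\mathcal V$ contains a neighbourhood of $0$; $s$ is concave and twice continuously differentiable on $\mathcal V$, $s''$ is Lipschitz near $0$, and $s'(0)=s''(0)=-1$; 5. (i) there is $\hat\lambda^*_n$ which, with $\mathbf P^*_n(\cdot|Z^n)$-probability approaching one wpa1-$\mathbf P$, maximizes $\sum_{i\le n} s(\lambda^T\omega_{i,n}g(X_i,\hat\theta^*_{GEL,n}))$ over $\lambda\in\Lambda^*_n(\hat\theta^*_{GEL,n})$, and $\|\hat\lambda^*_n\|_2=O_{\mathbf P^*_n(\cdot|Z^n)}(\sqrt{d(n)/n})$ wpa1-$\mathbf P$; (ii) for $j\in\{GMM,GEL\}$, $\hat\theta_{j,n}-\theta_0=O_{\mathbf P}(n^{-1/2})$ and $\hat\theta^*_{j,n}-\theta_0=O_{\mathbf P^*_n(\cdot|Z^n)}(n^{-1/2})$ wpa1-$\mathbf P$; 6. $d(n)^{\max\{2+4/\gamma,\,4\}}/n\to0$. **Conclusion.** Put $S_n=n^{-1/2}\sum_{i\le n} g(X_i,\theta_0)$ and $S^*_n=n^{-1/2}\sum_{i\le n}\omega_{i,n}g(X_i,\theta_0)$. Then $$\hat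 T_{GMM,n}=S_n^TWS_n+o_{\mathbf P}(\sqrt{d(n)}),\qquad \hat T_{GEL,n}=S_n^T\Omega^{-1}S_n+o_{\mathbf P}(\sqrt{d(n)}),$$ and, wpa1-$\mathbf P$, $$\hat T^*_{GMM,n}=(S^*_n)^TWS^*_n+o_{\mathbf P^*_n(\cdot|Z^n)}(\sqrt{d(n)}),\qquad \hat T^*_{GEL,n}=(S^*_n)^T\Omega^{-1}S^*_n+o_{\mathbf P^*_n(\cdot|Z^n)}(\sqrt{d(n)}).$$ -/

import Mathlib

open MeasureTheory ProbabilityTheory Filter Topology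
open scoped ENNReal Matrix

noncomputable section

/-! ### Stochastic orders of magnitude -/

/-- `f n = O_μ(c n)`: the sequence `f n / c n` is stochastically bounded under `μ`.
The quantities are magnitudes with values in `[0, ∞]`. -/
def IsBigOInProb {S : Type*} [MeasurableSpace S] (μ : Measure S)
    (f : ℕ → S → ℝ≥0∞) (c : ℕ → ℝ) : Prop :=
  ∀ ε : ℝ, 0 < ε → ∃ M : ℝ, 0 < M ∧ ∃ N : ℕ, ∀ n ≥ N,
    μ {x | ENNReal.ofReal (M * c n) ≤ f n x} ≤ ENNReal.ofReal ε

/-- `f n = o_μ(c n)`. -/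
def IsLittleOInProb {S : Type*} [MeasurableSpace S] (μ : Measure S)
    (f : ℕ → S → ℝ≥0∞) (c : ℕ → ℝ) : Prop :=
  ∀ ε : ℝ, 0 < ε → ∃ N : ℕ, ∀ n ≥ N,
    μ {x | ENNReal.ofReal (ε * c n) ≤ f n x} ≤ ENNReal.ofReal ε

/-- The event `p n` (depending on the data `x` and on the weights `w`) has conditional probability
approaching one under `κ n x`, with `μ`-probability approaching one. -/
def BootEventually {S : Type*} [MeasurableSpace S] (μ : Measure S)
    (κ : ∀ n : ℕ, Kernel S (Fin n → ℝ)) (p : ∀ n : ℕ, S → (Fin n → ℝ) → Prop) : Prop :=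
  ∀ ε : ℝ, 0 < ε → ∃ N : ℕ, ∀ n ≥ N,
    μ {x | ENNReal.ofReal ε < κ n x {w | ¬ p n x w}} ≤ ENNReal.ofReal ε

/-- `f n = O_{κ n x}(c n)` with `μ`-probability approaching one, i.e. for every `ε > 0` there are
`M` and `N` with `μ (κ n (f n ≥ M c n) ≤ ε) ≥ 1 - ε` for all `n ≥ N`. -/
def IsBigOInBootProb {S : Type*} [MeasurableSpace S] (μ : Measure S)
    (κ : ∀ n : ℕ, Kernel S (Fin n → ℝ)) (f : ∀ n : ℕ, S → (Fin n → ℝ) → ℝ≥0∞)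
    (c : ℕ → ℝ) : Prop :=
  ∀ ε : ℝ, 0 < ε → ∃ M : ℝ, 0 < M ∧ ∃ N : ℕ, ∀ n ≥ N,
    μ {x | ENNReal.ofReal ε < κ n x {w | ENNReal.ofReal (M * c n) ≤ f n x w}}
      ≤ ENNReal.ofReal ε

/-- `f n = o_{κ n x}(c n)` with `μ`-probability approaching one. -/
def IsLittleOInBootProb {S : Type*} [MeasurableSpace S] (μ : Measure S)
    (κ : ∀ n : ℕ, Kernel S (Fin n → ℝ)) (f : ∀ n : ℕ, S → (Fin n → ℝ) → ℝ≥0∞)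
    (c : ℕ → ℝ) : Prop :=
  ∀ ε : ℝ, 0 < ε → ∃ N : ℕ, ∀ n ≥ N,
    μ {x | ENNReal.ofReal ε < κ n x {w | ENNReal.ofReal (ε * c n) ≤ f n x w}}
      ≤ ENNReal.ofReal ε

/-! ### Minimizers, maximizers, matrices -/

/-- `a` is a point of `A` at which `f` attains its minimum over `A`. -/
def IsArgminOn {α β : Type*} [Preorder β] (f : α → β) (A : Set α) (a : α) : Prop :=
  a ∈ A ∧ IsMinOn f A a

/-- `a` is a point of `A` at which `f` attains its maximum over `A`. -/
def IsArgmaxOn {α β : Type*} [Preorder β] (f : α → β) (A : Set α) (a : α) : Prop :=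
  a ∈ A ∧ IsMaxOn f A a

/-- The quadratic form `vᵀ A v`. -/
def quadForm {d : ℕ} (A : Matrix (Fin d) (Fin d) ℝ) (v : EuclideanSpace ℝ (Fin d)) : ℝ :=
  v.ofLp ⬝ᵥ (A *ᵥ v.ofLp)

/-- The operator norm of a matrix with respect to Euclidean norms, as an element of `[0, ∞]`. -/
def matrixOpNorm {d : ℕ} (A : Matrix (Fin d) (Fin d) ℝ) : ℝ≥0∞ :=
  ‖Matrix.toEuclideanCLM (n := Fin d) (𝕜 := ℝ) A‖ₑ

/-- The matrix `E[h(X) h(X)ᵀ]` for `X ∼ P`. -/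
def secondMomentMatrix {𝒳 : Type*} [MeasurableSpace 𝒳] (P : Measure 𝒳) {d : ℕ}
    (h : 𝒳 → EuclideanSpace ℝ (Fin d)) : Matrix (Fin d) (Fin d) ℝ :=
  Matrix.of fun i j => ∫ x, h x i * h x j ∂P

/-! ### GMM and GEL criteria

They are written for an array `v 0, …, v (n - 1)` of moment vectors. The original criteria have
`v i = g (X i, θ)` and the bootstrap criteria have `v i = ω i • g (X i, θ)`. -/

/-- `n^{-1/2} ∑ v i`. -/
def scaledSum {n d : ℕ} (v : Fin n → EuclideanSpace ℝ (Fin d)) : EuclideanSpace ℝ (Fin d) :=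
  (Real.sqrt n)⁻¹ • ∑ i, v i

/-- The GMM criterion `(n⁻¹ ∑ v i)ᵀ A (n⁻¹ ∑ v i)`. -/
def gmmCriterion {n d : ℕ} (A : Matrix (Fin d) (Fin d) ℝ)
    (v : Fin n → EuclideanSpace ℝ (Fin d)) : ℝ :=
  quadForm A ((n : ℝ)⁻¹ • ∑ i, v i)

/-- The admissible multipliers: those `l` with `lᵀ v i ∈ 𝒱` for every observation `i`. -/
def gelMultipliers {n d : ℕ} (𝒱 : Set ℝ) (v : Fin n → EuclideanSpace ℝ (Fin d)) :
    Set (EuclideanSpace ℝ (Fin d)) :=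
  {l | ∀ i, inner ℝ l (v i) ∈ 𝒱}

/-- `∑ s (lᵀ v i)`. -/
def gelObjective {n d : ℕ} (s : ℝ → ℝ) (v : Fin n → EuclideanSpace ℝ (Fin d))
    (l : EuclideanSpace ℝ (Fin d)) : ℝ :=
  ∑ i, s (inner ℝ l (v i))

/-- The GEL criterion `sup_l ∑ s (lᵀ v i)` over the admissible multipliers. The supremum is taken
in the extended reals, since it may be `+∞`. -/
def gelCriterion {n d : ℕ} (s : ℝ → ℝ) (𝒱 : Set ℝ)
    (v : Fin n → EuclideanSpace ℝ (Fin d)) : EReal :=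
  ⨆ l ∈ gelMultipliers 𝒱 v, (gelObjective s v l : EReal)

/-- The GMM specification statistic: `n` times the GMM criterion. -/
def gmmStatistic {n d : ℕ} (A : Matrix (Fin d) (Fin d) ℝ)
    (v : Fin n → EuclideanSpace ℝ (Fin d)) : ℝ :=
  n * gmmCriterion A v

/-- The GEL specification statistic: `2 (criterion - n s(0))`. -/
def gelStatistic {n d : ℕ} (s : ℝ → ℝ) (𝒱 : Set ℝ)
    (v : Fin n → EuclideanSpace ℝ (Fin d)) : EReal :=
  2 * (gelCriterion s 𝒱 v - ((n * s 0 : ℝ) : EReal))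

/-- The moment vectors `g (X i, θ)`, `i < n`, of a sample. -/
def momentArray {𝒳 E : Type*} {d : ℕ} (g : 𝒳 → E → EuclideanSpace ℝ (Fin d)) {n : ℕ}
    (x : Fin n → 𝒳) (θ : E) : Fin n → EuclideanSpace ℝ (Fin d) :=
  fun i => g (x i) θ

/-- The weighted moment vectors `w i • g (X i, θ)`, `i < n`. -/
def bootMomentArray {𝒳 E : Type*} {d : ℕ} (g : 𝒳 → E → EuclideanSpace ℝ (Fin d)) {n : ℕ}
    (x : Fin n → 𝒳) (w : Fin n → ℝ) (θ : E) : Fin n → EuclideanSpace ℝ (Fin d) :=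
  fun i => w i • g (x i) θ

/-- The first `n` observations. -/
def firstObs {S 𝒳 : Type*} (X : ℕ → S → 𝒳) (n : ℕ) (ω : S) : Fin n → 𝒳 := fun i => X i ω

end

/-! Let `S` and `m` be the scaled moment sums at the true parameter and at the estimator. Since the
true parameter lies in the parameter set, minimality bounds the criterion at the estimator by its
value at the true parameter. What must be shown is that the estimator cannot gain more than o(√d).

A Taylor expansion gives m = S + r + e, where u is the estimation error, r = √n ∑ u_j G_j lies in
the span of the mean derivatives G_j, and ‖e‖ = O(√(d/n)). Both S and r may have norm of order √d,
but the span has dimension at most q, so the projection of A S onto it is only O(1): each direction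
contributes at most C³ to its second moment. Hence |⟨r, A S⟩| ≤ b ‖r‖ with b = O(1), and completing
the square shows that the drift r lowers the quadratic form by at most b²C, however large r is
(`IsElliptic.quadForm_shift_ge`). This O(1) is o(√d) because d diverges, and e costs only O(d/√n).
For GMM the exchange of the two weighting matrices costs o(d^{-1/2}) · O(d), which settles the claim
(`ShiftControl.abs_gmm_sub_le`).

For GEL, uniformly over ‖l‖ ≤ L √(d/n), the objective equals n s(0) − √n ⟨l, S⟩ − (n/2) lᵀΩl +
o(√d); the cubic Taylor remainder is controlled by second and fourth empirical moments together with
d⁴/n → 0 (`gelObjective_expansion`). At the true parameter, concavity turns this into a global upper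
bound by the vertex value n s(0) + SᵀΩ⁻¹S/2 (`gelObjective_le`). At the estimator, inserting the
vertex multiplier gives a lower bound with m in place of S (`exists_le_gelObjective`). The
comparison of quadratic forms, now with A = Ω⁻¹, closes the sandwich.

All of this is deterministic once finitely many normalised moments are bounded (`exists_control`).
Those bounds (`TightArrays`) come from Markov's inequality and second moments of sums of independent
vectors, applied to the data and then to the weights given the data. The original statistics are
handled as bootstrap statistics whose weights are almost surely one. For genuine bootstrap weights
the mean is zero, so the weighted derivatives are already centred and one may take G = 0. -/

/-! ### Second moments of sums of independent random vectors -/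

/-- For pairwise independent real random variables, the second moment of the centred sum is at most
the sum of the second moments. -/
theorem lintegral_enorm_sum_sub_integral_sq_le {Ω' : Type*} [MeasurableSpace Ω'] {ν : Measure Ω'}
    [IsProbabilityMeasure ν] {n : ℕ} {Y : Fin n → Ω' → ℝ}
    (hm : ∀ i, AEStronglyMeasurable (Y i) ν) (hind : Pairwise fun i j => IndepFun (Y i) (Y j) ν) :
    ∫⁻ ω, ‖∑ i, (Y i ω - ∫ ω', Y i ω' ∂ν)‖ₑ ^ 2 ∂ν ≤ ∑ i, ∫⁻ ω, ‖Y i ω‖ₑ ^ 2 ∂ν := by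
  by_cases htop : ∀ i, ∫⁻ ω, ‖Y i ω‖ₑ ^ 2 ∂ν < ∞
  · have hL : ∀ i, MemLp (Y i) 2 ν := fun i => by
      refine ⟨hm i, ?_⟩
      rw [eLpNorm_lt_top_iff_lintegral_rpow_enorm_lt_top two_ne_zero ENNReal.ofNat_ne_top]
      simpa using htop i
    have hint : ∀ i, Integrable (Y i) ν := fun i => (hL i).integrable one_le_two
    have hsum : MemLp (∑ i, Y i) 2 ν := memLp_finsetSum' _ fun i _ => hL i
    have h1 : ∫⁻ ω, ‖∑ i, (Y i ω - ∫ ω', Y i ω' ∂ν)‖ₑ ^ 2 ∂ν = evariance (∑ i, Y i) ν := by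
      unfold evariance
      refine lintegral_congr fun ω => ?_
      congr 2
      simp only [Finset.sum_apply]
      rw [integral_finsetSum _ fun i _ => hint i, Finset.sum_sub_distrib]
    rw [h1, ← ofReal_variance hsum,
      IndepFun.variance_sum (fun i _ => hL i) fun i _ j _ hij => hind hij,
      ENNReal.ofReal_sum_of_nonneg fun i _ => variance_nonneg _ _]
    refine Finset.sum_le_sum fun i _ => ?_
    refine (ENNReal.ofReal_le_ofReal (variance_le_expectation_sq (hm i))).trans ?_
    simp only [Pi.pow_apply]
    rw [ofReal_integral_eq_lintegral_ofReal ((hL i).integrable_sq)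
      (Eventually.of_forall fun ω => sq_nonneg _)]
    refine (lintegral_congr fun ω => ?_).le
    rw [← Real.enorm_eq_ofReal (sq_nonneg _), enorm_pow]
  -- If one second moment is infinite, so is the right-hand side.
  · push Not at htop
    obtain ⟨i, hi⟩ := htop
    refine le_trans (le_top.trans hi) ?_
    exact Finset.single_le_sum (f := fun i => ∫⁻ ω, ‖Y i ω‖ₑ ^ 2 ∂ν) (fun _ _ => zero_le)
      (Finset.mem_univ i)

theorem EuclideanSpace.enorm_sq_eq_sum {ι : Type*} [Fintype ι] (v : EuclideanSpace ℝ ι) :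
    ‖v‖ₑ ^ 2 = ∑ k, ‖v k‖ₑ ^ 2 := by
  simp only [← ofReal_norm]
  rw [← ENNReal.ofReal_pow (norm_nonneg _), EuclideanSpace.norm_sq_eq,
    ENNReal.ofReal_sum_of_nonneg fun i _ => by positivity]
  exact Finset.sum_congr rfl fun i _ => ENNReal.ofReal_pow (norm_nonneg _) _

/-- The vector version of `lintegral_enorm_sum_sub_integral_sq_le`. -/
theorem lintegral_enorm_sum_sub_integral_sq_le_euclidean {Ω' ι : Type*} [Fintype ι]
    [MeasurableSpace Ω'] {ν : Measure Ω'} [IsProbabilityMeasure ν] {n : ℕ}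
    {Y : Fin n → Ω' → EuclideanSpace ℝ ι} (hm : ∀ i, AEMeasurable (Y i) ν)
    (hind : Pairwise fun i j => IndepFun (Y i) (Y j) ν) (m : Fin n → EuclideanSpace ℝ ι)
    (hmean : ∀ i k, ∫ ω, Y i ω k ∂ν = m i k) :
    ∫⁻ ω, ‖∑ i, (Y i ω - m i)‖ₑ ^ 2 ∂ν ≤ ∑ i, ∫⁻ ω, ‖Y i ω‖ₑ ^ 2 ∂ν := by
  have hmk : ∀ i k, AEMeasurable (fun ω => Y i ω k) ν := fun i k =>
    (by fun_prop : Measurable fun v : EuclideanSpace ℝ ι => v k).comp_aemeasurable (hm i)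
  simp only [EuclideanSpace.enorm_sq_eq_sum]
  rw [lintegral_finsetSum' _ fun k _ => ?_]
  · simp_rw [lintegral_finsetSum' _ fun k _ => ((hmk _ k).enorm.pow_const 2)]
    rw [Finset.sum_comm]
    refine Finset.sum_le_sum fun k _ => ?_
    have := lintegral_enorm_sum_sub_integral_sq_le (ν := ν) (Y := fun i ω => Y i ω k)
      (fun i => (hmk i k).aestronglyMeasurable)
      (fun i j hij => (hind hij).comp
        (by fun_prop : Measurable fun v : EuclideanSpace ℝ ι => v k)
        (by fun_prop : Measurable fun v : EuclideanSpace ℝ ι => v k))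
    refine le_trans (lintegral_congr fun ω => ?_).le this
    simp [hmean, WithLp.ofLp_sum, Finset.sum_apply]
  · have : ∀ i, AEMeasurable (fun ω => Y i ω k - m i k) ν := fun i => (hmk i k).sub_const _
    simp only [WithLp.ofLp_sum, Finset.sum_apply, WithLp.ofLp_sub, Pi.sub_apply]
    exact (Finset.aemeasurable_fun_sum _ fun i _ => this i).enorm.pow_const 2

/-! ### Tightness under the data and under the weights -/

/-- `f n` is bounded in `μ`-probability. -/
def DataTight {S : Type*} [MeasurableSpace S] (μ : Measure S) (f : ℕ → S → ℝ≥0∞) : Prop :=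
  ∀ ε : ℝ, 0 < ε → ∃ M : ℝ, 0 < M ∧ ∀ᶠ n in atTop,
    μ {x | ENNReal.ofReal M < f n x} ≤ ENNReal.ofReal ε

/-- `f n` is bounded in conditional probability, with `μ`-probability approaching one. -/
def BootTight {S : Type*} [MeasurableSpace S] (μ : Measure S)
    (κ : ∀ n : ℕ, Kernel S (Fin n → ℝ)) (f : ∀ n : ℕ, S → (Fin n → ℝ) → ℝ≥0∞) : Prop :=
  ∀ ε : ℝ, 0 < ε → ∃ M : ℝ, 0 < M ∧ ∀ᶠ n in atTop,
    μ {x | ENNReal.ofReal ε < κ n x {w | ENNReal.ofReal M < f n x w}} ≤ ENNReal.ofReal ε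

section tight
variable {S : Type*} [MeasurableSpace S] {μ : Measure S} {κ : ∀ n : ℕ, Kernel S (Fin n → ℝ)}

theorem DataTight.of_lintegral_le {f : ℕ → S → ℝ≥0∞} {C : ℝ}
    (hf : ∀ᶠ n in atTop, AEMeasurable (f n) μ ∧ ∫⁻ x, f n x ∂μ ≤ ENNReal.ofReal C) :
    DataTight μ f := by
  intro ε hε
  -- The form |C| + 1 keeps the Markov threshold positive for every real C.
  have hM : (0 : ℝ) < (|C| + 1) / ε := by positivity
  refine ⟨(|C| + 1) / ε, hM, ?_⟩
  filter_upwards [hf] with n hn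
  calc μ {x | ENNReal.ofReal ((|C| + 1) / ε) < f n x}
      ≤ μ {x | ENNReal.ofReal ((|C| + 1) / ε) ≤ f n x} := measure_mono (Set.ofPred_subset_ofPred.2 fun x hx => hx.le)
    _ ≤ (∫⁻ x, f n x ∂μ) / ENNReal.ofReal ((|C| + 1) / ε) :=
        meas_ge_le_lintegral_div hn.1 (by simpa using hM) ENNReal.ofReal_ne_top
    _ ≤ ENNReal.ofReal C / ENNReal.ofReal ((|C| + 1) / ε) := by gcongr; exact hn.2
    _ = ENNReal.ofReal (C / ((|C| + 1) / ε)) := (ENNReal.ofReal_div_of_pos hM).symm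
    _ ≤ ENNReal.ofReal ε := by
        apply ENNReal.ofReal_le_ofReal
        rw [div_le_iff₀ hM, mul_div_cancel₀ _ hε.ne']
        linarith [le_abs_self C]

theorem DataTight.mono {f g : ℕ → S → ℝ≥0∞} (hf : DataTight μ f)
    (h : ∀ᶠ n in atTop, ∀ᵐ x ∂μ, g n x ≤ f n x) : DataTight μ g := by
  intro ε hε
  obtain ⟨M, hM, hMn⟩ := hf ε hε
  refine ⟨M, hM, ?_⟩
  filter_upwards [hMn, h] with n hn hgf
  refine le_trans (measure_mono_ae ?_) hn
  filter_upwards [hgf] with x hx hx'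
  exact lt_of_lt_of_le hx' hx

theorem BootTight.mono {f g : ∀ n : ℕ, S → (Fin n → ℝ) → ℝ≥0∞} (hf : BootTight μ κ f)
    (h : ∀ᶠ n in atTop, ∀ᵐ x ∂μ, ∀ᵐ w ∂(κ n x), g n x w ≤ f n x w) : BootTight μ κ g := by
  intro ε hε
  obtain ⟨M, hM, hMn⟩ := hf ε hε
  refine ⟨M, hM, ?_⟩
  filter_upwards [hMn, h] with n hn hgf
  refine le_trans (measure_mono_ae ?_) hn
  filter_upwards [hgf] with x hx hx'
  refine lt_of_lt_of_le hx' (measure_mono_ae ?_)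
  filter_upwards [hx] with w hw hw'
  exact lt_of_lt_of_le hw' hw

theorem DataTight.boot {f : ℕ → S → ℝ≥0∞} (hf : DataTight μ f) :
    BootTight μ κ fun n x _ => f n x := by
  intro ε hε
  obtain ⟨M, hM, hMn⟩ := hf ε hε
  refine ⟨M, hM, ?_⟩
  filter_upwards [hMn] with n hn
  refine le_trans (measure_mono fun x hx => ?_) hn
  by_contra hx'
  have hx'' : ¬ ENNReal.ofReal M < f n x := hx'
  simp [hx''] at hx

theorem DataTight.const_mul {f : ℕ → S → ℝ≥0∞} (hf : DataTight μ f) {c : ℝ} (hc : 0 ≤ c) :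
    DataTight μ fun n x => ENNReal.ofReal c * f n x := by
  intro ε hε
  obtain ⟨M, hM, hMn⟩ := hf ε hε
  refine ⟨c * M + 1, by positivity, ?_⟩
  filter_upwards [hMn] with n hn
  refine le_trans (measure_mono fun x hx => ?_) hn
  by_contra hx'
  have hx' : f n x ≤ ENNReal.ofReal M := not_lt.1 hx'
  have h1 : ENNReal.ofReal c * f n x ≤ ENNReal.ofReal (c * M + 1) := by
    calc ENNReal.ofReal c * f n x ≤ ENNReal.ofReal c * ENNReal.ofReal M := by gcongr
      _ = ENNReal.ofReal (c * M) := (ENNReal.ofReal_mul hc).symm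
      _ ≤ _ := ENNReal.ofReal_le_ofReal (by linarith)
  exact absurd hx (not_lt.2 h1)

theorem DataTight.const (c : ℝ) : DataTight μ fun _ _ => ENNReal.ofReal c := by
  intro ε hε
  refine ⟨|c| + 1, by positivity, Eventually.of_forall fun n => ?_⟩
  have : ¬ ENNReal.ofReal (|c| + 1) < ENNReal.ofReal c :=
    not_lt.2 (ENNReal.ofReal_le_ofReal (by linarith [le_abs_self c]))
  simp [this]

/-- The event `p n` has conditional probability at least `1 - ε` on a data event of probability at
least `1 - ε`. -/
def BootLikely (μ : Measure S) {n : ℕ} (κ : Kernel S (Fin n → ℝ)) (ε : ℝ)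
    (p : S → (Fin n → ℝ) → Prop) : Prop :=
  μ {x | ENNReal.ofReal ε < κ x {w | ¬ p x w}} ≤ ENNReal.ofReal ε

/-- A union bound at two levels: over the bad data events, and, at a data point outside both, over
the weights. Subadditivity of outer measure suffices, so no measurability of the events is needed.
-/
theorem BootLikely.and {n : ℕ} {κ : Kernel S (Fin n → ℝ)} {ε₁ ε₂ : ℝ} (h₁ : 0 ≤ ε₁) (h₂ : 0 ≤ ε₂)
    {p₁ p₂ : S → (Fin n → ℝ) → Prop} (hp₁ : BootLikely μ κ ε₁ p₁) (hp₂ : BootLikely μ κ ε₂ p₂) :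
    BootLikely μ κ (ε₁ + ε₂) fun x w => p₁ x w ∧ p₂ x w := by
  unfold BootLikely at *
  rw [ENNReal.ofReal_add h₁ h₂]
  refine le_trans (measure_mono fun x hx => ?_) ((measure_union_le _ _).trans (add_le_add hp₁ hp₂))
  by_contra hcon
  simp only [Set.mem_union, Set.mem_ofPred_eq, not_or, not_lt] at hcon
  rw [Set.mem_ofPred_eq] at hx
  refine absurd hx (not_lt.2 ?_)
  refine le_trans (measure_mono fun w hw => ?_)
    ((measure_union_le {w | ¬ p₁ x w} {w | ¬ p₂ x w}).trans (add_le_add hcon.1 hcon.2))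
  exact not_and_or.1 hw

theorem BootLikely.mono {n : ℕ} {κ : Kernel S (Fin n → ℝ)} {ε ε' : ℝ} (hε : ε ≤ ε')
    {p p' : S → (Fin n → ℝ) → Prop} (hp : BootLikely μ κ ε p)
    (h : ∀ᵐ x ∂μ, ∀ᵐ w ∂(κ x), p x w → p' x w) : BootLikely μ κ ε' p' := by
  refine le_trans (measure_mono_ae ?_) (le_trans hp (ENNReal.ofReal_le_ofReal hε))
  filter_upwards [h] with x hx hx'
  refine lt_of_le_of_lt (ENNReal.ofReal_le_ofReal hε) (lt_of_lt_of_le hx' (measure_mono_ae ?_))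
  filter_upwards [hx] with w hw hw'
  exact fun h => hw' (hw h)

theorem BootTight.likely {f : ∀ n : ℕ, S → (Fin n → ℝ) → ℝ≥0∞} (hf : BootTight μ κ f) {ε : ℝ}
    (hε : 0 < ε) : ∃ M : ℝ, 0 < M ∧ ∀ᶠ n in atTop,
      BootLikely μ (κ n) ε fun x w => f n x w ≤ ENNReal.ofReal M := by
  obtain ⟨M, hM, h⟩ := hf ε hε
  refine ⟨M, hM, ?_⟩
  simpa [BootLikely] using h

theorem BootTight.add {f g : ∀ n : ℕ, S → (Fin n → ℝ) → ℝ≥0∞} (hf : BootTight μ κ f)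
    (hg : BootTight μ κ g) : BootTight μ κ fun n x w => f n x w + g n x w := by
  intro ε hε
  obtain ⟨M₁, hM₁, h₁⟩ := hf.likely (half_pos hε)
  obtain ⟨M₂, hM₂, h₂⟩ := hg.likely (half_pos hε)
  refine ⟨M₁ + M₂, by positivity, ?_⟩
  filter_upwards [h₁, h₂] with n hn₁ hn₂
  have := ((hn₁.and (half_pos hε).le (half_pos hε).le hn₂).mono (add_halves ε).le
    (p' := fun x w => f n x w + g n x w ≤ ENNReal.ofReal (M₁ + M₂)) (by
      refine Eventually.of_forall fun x => Eventually.of_forall fun w h => ?_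
      rw [ENNReal.ofReal_add hM₁.le hM₂.le]
      exact add_le_add h.1 h.2))
  simpa [BootLikely] using this

theorem BootTight.sum {ι : Type*} (s : Finset ι) {f : ι → ∀ n : ℕ, S → (Fin n → ℝ) → ℝ≥0∞}
    (hf : ∀ i ∈ s, BootTight μ κ (f i)) : BootTight μ κ fun n x w => ∑ i ∈ s, f i n x w := by
  classical
  induction s using Finset.induction_on with
  | empty => simpa using (DataTight.const (μ := μ) 0).boot (κ := κ)
  | insert a s ha ih =>
    simp only [Finset.sum_insert ha]
    exact (hf a (Finset.mem_insert_self _ _)).add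
      (ih fun i hi => hf i (Finset.mem_insert_of_mem hi))

/-- Conditional Markov inequality. -/
theorem BootTight.of_lintegral_le {f : ∀ n : ℕ, S → (Fin n → ℝ) → ℝ≥0∞} {h : ℕ → S → ℝ≥0∞}
    (hh : DataTight μ h)
    (hf : ∀ᶠ n in atTop, ∀ᵐ x ∂μ, AEMeasurable (f n x) (κ n x) ∧ ∫⁻ w, f n x w ∂(κ n x) ≤ h n x) :
    BootTight μ κ f := by
  intro ε hε
  obtain ⟨M, hM, hMn⟩ := hh ε hε
  have hM' : 0 < M / ε := by positivity
  refine ⟨M / ε, hM', ?_⟩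
  filter_upwards [hMn, hf] with n hn hfn
  refine le_trans (measure_mono_ae ?_) hn
  filter_upwards [hfn] with x hx hx'
  by_contra hcon
  have hcon : h n x ≤ ENNReal.ofReal M := not_lt.1 hcon
  refine absurd hx' (not_lt.2 ?_)
  calc κ n x {w | ENNReal.ofReal (M / ε) < f n x w}
      ≤ κ n x {w | ENNReal.ofReal (M / ε) ≤ f n x w} := measure_mono (Set.ofPred_subset_ofPred.2 fun w hw => hw.le)
    _ ≤ (∫⁻ w, f n x w ∂(κ n x)) / ENNReal.ofReal (M / ε) :=
        meas_ge_le_lintegral_div hx.1 (by simpa using hM') ENNReal.ofReal_ne_top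
    _ ≤ ENNReal.ofReal M / ENNReal.ofReal (M / ε) := by gcongr; exact hx.2.trans hcon
    _ = ENNReal.ofReal (M / (M / ε)) := (ENNReal.ofReal_div_of_pos hM').symm
    _ = ENNReal.ofReal ε := by rw [div_div_cancel₀ hM.ne']

theorem IsBigOInBootProb.likely {f : ∀ n : ℕ, S → (Fin n → ℝ) → ℝ≥0∞} {c : ℕ → ℝ}
    (hf : IsBigOInBootProb μ κ f c) {ε : ℝ} (hε : 0 < ε) : ∃ M : ℝ, 0 < M ∧ ∀ᶠ n in atTop,
      BootLikely μ (κ n) ε fun x w => f n x w < ENNReal.ofReal (M * c n) := by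
  obtain ⟨M, hM, N, h⟩ := hf ε hε
  refine ⟨M, hM, ?_⟩
  filter_upwards [eventually_ge_atTop N] with n hn
  simpa [BootLikely] using h n hn

theorem IsLittleOInProb.likely {f : ℕ → S → ℝ≥0∞} {c : ℕ → ℝ} (hc : ∀ n, 0 ≤ c n)
    (hf : IsLittleOInProb μ f c) {ε η : ℝ} (hε : 0 < ε) (hη : 0 < η) : ∀ᶠ n in atTop,
      BootLikely μ (κ n) ε fun x _ => f n x < ENNReal.ofReal (η * c n) := by
  -- The definition uses one number both as threshold and as probability; the minimum decouples the
  -- two.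
  obtain ⟨N, h⟩ := hf (min ε η) (lt_min hε hη)
  filter_upwards [eventually_ge_atTop N] with n hn
  refine le_trans (measure_mono fun x hx => ?_)
    ((h n hn).trans (ENNReal.ofReal_le_ofReal (min_le_left _ _)))
  by_contra hcon
  have h1 : f n x < ENNReal.ofReal (η * c n) := by
    refine lt_of_lt_of_le (not_le.1 hcon) (ENNReal.ofReal_le_ofReal ?_)
    exact mul_le_mul_of_nonneg_right (min_le_right _ _) (hc n)
  simp [not_le.2 h1] at hx

theorem IsLittleOInBootProb.of_likely {f : ∀ n : ℕ, S → (Fin n → ℝ) → ℝ≥0∞} {c : ℕ → ℝ}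
    (h : ∀ ε : ℝ, 0 < ε → ∀ᶠ n in atTop,
      BootLikely μ (κ n) ε fun x w => f n x w < ENNReal.ofReal (ε * c n)) :
    IsLittleOInBootProb μ κ f c := by
  intro ε hε
  obtain ⟨N, hN⟩ := eventually_atTop.1 (h ε hε)
  refine ⟨N, fun n hn => ?_⟩
  simpa [BootLikely] using hN n hn

/-- Unweighted quantities are the case of weights that are almost surely one. -/
theorem isLittleOInProb_of_boot_dirac {f : ∀ n : ℕ, S → (Fin n → ℝ) → ℝ≥0∞} {c : ℕ → ℝ}
    (hc : ∀ n, 0 ≤ c n)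
    (h : IsLittleOInBootProb μ (fun n => Kernel.const S (Measure.dirac (1 : Fin n → ℝ))) f c) :
    IsLittleOInProb μ (fun n x => f n x 1) c := by
  intro ε hε
  -- Under a point mass the conditional probability is 0 or 1, so with a level below 1 it exceeds
  -- that level exactly when the bad event occurs at the weight vector 1.
  obtain ⟨N, hN⟩ := h (min ε (1 / 2)) (by positivity)
  refine ⟨N, fun n hn => ?_⟩
  refine le_trans (measure_mono fun x hx => ?_)
    ((hN n hn).trans (ENNReal.ofReal_le_ofReal (min_le_left _ _)))
  have h1 : ENNReal.ofReal (min ε (1 / 2) * c n) ≤ f n x 1 :=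
    (ENNReal.ofReal_le_ofReal (mul_le_mul_of_nonneg_right (min_le_left _ _) (hc n))).trans hx
  have h2 : ENNReal.ofReal (min ε (1 / 2)) < 1 := by
    rw [← ENNReal.ofReal_one]
    exact (ENNReal.ofReal_lt_ofReal_iff one_pos).2 (lt_of_le_of_lt (min_le_right _ _) (by norm_num))
  change ENNReal.ofReal (min ε (1 / 2)) < Measure.dirac _ _
  rwa [Measure.dirac_apply, Set.indicator_of_mem (by exact h1)]

theorem IsBigOInProb.boot {f : ℕ → S → ℝ≥0∞} {c : ℕ → ℝ}
    (h : IsBigOInProb μ f c) : IsBigOInBootProb μ κ (fun n x _ => f n x) c := by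
  intro ε hε
  obtain ⟨M, hM, N, hN⟩ := h ε hε
  refine ⟨M, hM, N, fun n hn => le_trans (measure_mono fun x hx => ?_) (hN n hn)⟩
  by_contra hcon
  have h1 : ¬ ENNReal.ofReal (M * c n) ≤ f n x := hcon
  simp [h1] at hx

end tight

/-! ### Quadratic forms with eigenvalues bounded away from zero and infinity -/

/-- The operator on Euclidean space given by a matrix. -/
noncomputable abbrev matOp {d : ℕ} (A : Matrix (Fin d) (Fin d) ℝ) :
    EuclideanSpace ℝ (Fin d) →L[ℝ] EuclideanSpace ℝ (Fin d) :=
  Matrix.toEuclideanCLM (n := Fin d) (𝕜 := ℝ) A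

theorem quadForm_eq_inner {d : ℕ} (A : Matrix (Fin d) (Fin d) ℝ) (v : EuclideanSpace ℝ (Fin d)) :
    quadForm A v = inner ℝ v (matOp A v) :=
  (Matrix.inner_toEuclideanCLM A v v).symm

/-- `A` is symmetric with eigenvalues in `[C⁻¹, C]`, expressed by inequalities. -/
structure IsElliptic {d : ℕ} (A : Matrix (Fin d) (Fin d) ℝ) (C : ℝ) : Prop where
  symm : ∀ v w : EuclideanSpace ℝ (Fin d), inner ℝ v (matOp A w) = inner ℝ w (matOp A v)
  lower : ∀ v : EuclideanSpace ℝ (Fin d), C⁻¹ * ‖v‖ ^ 2 ≤ quadForm A v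
  upper : ∀ v : EuclideanSpace ℝ (Fin d), ‖matOp A v‖ ≤ C * ‖v‖

/-- In an orthonormal eigenbasis the coordinates are multiplied by the eigenvalues, so both
inequalities hold coordinatewise and sum up by Parseval. -/
theorem IsElliptic.of_spectrum {d : ℕ} {A : Matrix (Fin d) (Fin d) ℝ} {C : ℝ} (hC : 1 ≤ C)
    (hA : A.IsHermitian) (hspec : spectrum ℝ A ⊆ Set.Icc C⁻¹ C) : IsElliptic A C := by
  have hsymm : ∀ v w : EuclideanSpace ℝ (Fin d),
      inner ℝ v (matOp A w) = inner ℝ w (matOp A v) := by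
    intro v w
    rw [Matrix.inner_toEuclideanCLM, Matrix.inner_toEuclideanCLM, Matrix.dotProduct_mulVec,
      ← Matrix.mulVec_transpose, dotProduct_comm]
    have : Aᵀ = A := by simpa using hA.eq
    rw [this]
  set b := hA.eigenvectorBasis
  have heig : ∀ i, matOp A (b i) = hA.eigenvalues i • b i := by
    intro i
    apply WithLp.ofLp_injective
    simpa using hA.mulVec_eigenvectorBasis i
  have hmem : ∀ i, hA.eigenvalues i ∈ Set.Icc C⁻¹ C := fun i =>
    hspec (hA.eigenvalues_mem_spectrum_real i)
  have hcoef : ∀ v i, inner ℝ (b i) (matOp A v) = hA.eigenvalues i * inner ℝ (b i) v := by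
    intro v i
    rw [hsymm, heig, inner_smul_right, real_inner_comm]
  have hC0 : 0 < C := by linarith
  refine ⟨hsymm, fun v => ?_, fun v => ?_⟩
  · rw [quadForm_eq_inner, ← b.sum_inner_mul_inner v (matOp A v), ← b.sum_sq_norm_inner_right v,
      Finset.mul_sum]
    refine Finset.sum_le_sum fun i _ => ?_
    rw [hcoef, Real.norm_eq_abs, sq_abs, real_inner_comm v (b i)]
    nlinarith [mul_le_mul_of_nonneg_right (hmem i).1 (sq_nonneg (inner ℝ v (b i)))]
  · refine abs_le_of_sq_le_sq' ?_ (by positivity) |>.2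
    rw [mul_pow, ← b.sum_sq_norm_inner_right v, ← b.sum_sq_norm_inner_right (matOp A v),
      Finset.mul_sum]
    refine Finset.sum_le_sum fun i _ => ?_
    rw [hcoef, norm_mul, mul_pow]
    have h0 : 0 ≤ hA.eigenvalues i := le_trans (by positivity) (hmem i).1
    have : ‖hA.eigenvalues i‖ ^ 2 ≤ C ^ 2 := by
      rw [Real.norm_of_nonneg h0]
      exact pow_le_pow_left₀ h0 (hmem i).2 2
    gcongr

section invertible
variable {d : ℕ} {A : Matrix (Fin d) (Fin d) ℝ} {C : ℝ}

theorem isUnit_of_spectrum (hC : 1 ≤ C) (hspec : spectrum ℝ A ⊆ Set.Icc C⁻¹ C) : IsUnit A := by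
  rw [← spectrum.zero_notMem_iff ℝ]
  intro h
  have h1 := (hspec h).1
  have : 0 < C⁻¹ := by positivity
  linarith

/-- The interval [C⁻¹, C] is invariant under inversion, so the same constant serves a matrix and its
inverse. -/
theorem IsElliptic.inv_of_spectrum (hC : 1 ≤ C) (hA : A.IsHermitian)
    (hspec : spectrum ℝ A ⊆ Set.Icc C⁻¹ C) : IsElliptic A⁻¹ C := by
  refine IsElliptic.of_spectrum hC hA.inv fun r hr => ?_
  obtain ⟨u, hu⟩ := isUnit_of_spectrum hC hspec
  have hinv : A⁻¹ = ((u⁻¹ : (Matrix (Fin d) (Fin d) ℝ)ˣ) : Matrix (Fin d) (Fin d) ℝ) := by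
    rw [← hu, Matrix.coe_units_inv]
  rw [hinv, ← spectrum.map_inv, Set.mem_inv, hu] at hr
  have h := hspec hr
  have hC0 : 0 < C := by linarith
  have hr0 : 0 < r⁻¹ := lt_of_lt_of_le (by positivity) h.1
  have hr1 : 0 < r := inv_pos.1 hr0
  exact ⟨by simpa using inv_anti₀ hr0 h.2, by simpa using inv_anti₀ (by positivity) h.1⟩

theorem matOp_matOp_inv (hA : IsUnit A) (v : EuclideanSpace ℝ (Fin d)) :
    matOp A (matOp A⁻¹ v) = v := by
  have hdet : IsUnit A.det := (Matrix.isUnit_iff_isUnit_det _).1 hA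
  apply WithLp.ofLp_injective
  simp [Matrix.mulVec_mulVec, Matrix.mul_nonsing_inv _ hdet]

theorem IsElliptic.quadForm_nonneg (h : IsElliptic A C) (hC : 1 ≤ C)
    (v : EuclideanSpace ℝ (Fin d)) : 0 ≤ quadForm A v :=
  le_trans (by positivity) (h.lower v)

theorem IsElliptic.quadForm_le (h : IsElliptic A C)
    (v : EuclideanSpace ℝ (Fin d)) : quadForm A v ≤ C * ‖v‖ ^ 2 := by
  rw [quadForm_eq_inner]
  calc inner ℝ v (matOp A v) ≤ ‖v‖ * ‖matOp A v‖ := real_inner_le_norm _ _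
    _ ≤ ‖v‖ * (C * ‖v‖) := by gcongr; exact h.upper v
    _ = C * ‖v‖ ^ 2 := by ring

theorem IsElliptic.quadForm_add (h : IsElliptic A C) (v w : EuclideanSpace ℝ (Fin d)) :
    quadForm A (v + w) = quadForm A v + 2 * inner ℝ w (matOp A v) + quadForm A w := by
  simp only [quadForm_eq_inner, map_add, inner_add_left, inner_add_right, h.symm v w]
  ring

/-- A shift `r` that is almost orthogonal to `A S` and a small shift `e` cannot decrease the
quadratic form much. -/
theorem IsElliptic.quadForm_shift_ge (h : IsElliptic A C) (hC : 1 ≤ C) {b : ℝ}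
    {S r e : EuclideanSpace ℝ (Fin d)} (hr : |inner ℝ r (matOp A S)| ≤ b * ‖r‖) :
    quadForm A S - b ^ 2 * C - 2 * C * ‖e‖ * ‖S + r‖ ≤ quadForm A (S + r + e) := by
  have hC0 : 0 < C := by linarith
  rw [h.quadForm_add (S + r) e, h.quadForm_add S r]
  have h1 : -(‖e‖ * (C * ‖S + r‖)) ≤ inner ℝ e (matOp A (S + r)) := by
    refine (abs_le.1 ((abs_real_inner_le_norm _ _).trans ?_)).1
    gcongr
    exact h.upper _
  have h2 := h.quadForm_nonneg hC e
  have h3 := (abs_le.1 hr).1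
  have h4 := h.lower r
  have h5 : -(b ^ 2 * C) ≤ -2 * (b * ‖r‖) + C⁻¹ * ‖r‖ ^ 2 := by
    -- The quadratic gain C⁻¹‖r‖² absorbs the linear loss 2b‖r‖ up to b²C, a bound free of ‖r‖.
    have : 0 ≤ C * (b - C⁻¹ * ‖r‖) ^ 2 := by positivity
    have h6 : C * (b - C⁻¹ * ‖r‖) ^ 2 = b ^ 2 * C - 2 * (b * ‖r‖) + C⁻¹ * ‖r‖ ^ 2 := by
      field_simp
      ring
    linarith
  linarith

end invertible

theorem abs_quadForm_sub_le {d : ℕ} {A A' : Matrix (Fin d) (Fin d) ℝ} {η : ℝ} (hη : 0 ≤ η)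
    (h : matrixOpNorm (A - A') ≤ ENNReal.ofReal η) (v : EuclideanSpace ℝ (Fin d)) :
    |quadForm A v - quadForm A' v| ≤ η * ‖v‖ ^ 2 := by
  have hn : ‖matOp (A - A')‖ ≤ η := by
    rw [matrixOpNorm, ← ofReal_norm] at h
    exact (ENNReal.ofReal_le_ofReal_iff hη).1 h
  have : quadForm A v - quadForm A' v = inner ℝ v (matOp (A - A') v) := by
    rw [quadForm_eq_inner, quadForm_eq_inner, ← inner_sub_right]
    simp [matOp]
  rw [this]
  calc |inner ℝ v (matOp (A - A') v)| ≤ ‖v‖ * ‖matOp (A - A') v‖ := abs_real_inner_le_norm _ _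
    _ ≤ ‖v‖ * (η * ‖v‖) := by
        gcongr
        exact (ContinuousLinearMap.le_opNorm _ _).trans (by gcongr)
    _ = η * ‖v‖ ^ 2 := by ring

theorem quadForm_smul {d : ℕ} (A : Matrix (Fin d) (Fin d) ℝ) (c : ℝ)
    (v : EuclideanSpace ℝ (Fin d)) : quadForm A (c • v) = c ^ 2 * quadForm A v := by
  simp only [quadForm_eq_inner, map_smul, inner_smul_left, inner_smul_right]
  simp; ring

theorem gmmStatistic_eq {n d : ℕ} (hn : 0 < n) (A : Matrix (Fin d) (Fin d) ℝ)
    (v : Fin n → EuclideanSpace ℝ (Fin d)) : gmmStatistic A v = quadForm A (scaledSum v) := by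
  have hn' : (0 : ℝ) < n := by exact_mod_cast hn
  rw [gmmStatistic, gmmCriterion, scaledSum, quadForm_smul, quadForm_smul, inv_pow, inv_pow,
    Real.sq_sqrt hn'.le]
  field_simp

/-! ### Taylor expansion of the criterion function -/

/-- The Lipschitz bound on the second derivative is integrated twice by the mean value inequality on
the closed ball of radius |t|; each integration contributes one factor |t|, which keeps the
Lipschitz constant unchanged. -/
theorem exists_taylor_bound {s : ℝ → ℝ} {𝒱 : Set ℝ} (h𝒱 : 𝒱 ∈ 𝓝 (0 : ℝ))
    (hs_smooth : ContDiffOn ℝ 2 s 𝒱)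
    (hs_lip : ∃ K : NNReal, ∃ U ∈ 𝓝 (0 : ℝ), LipschitzOnWith K (deriv (deriv s)) U)
    (hs_one : deriv s 0 = -1) (hs_two : deriv (deriv s) 0 = -1) :
    ∃ K ρ : ℝ, 0 ≤ K ∧ 0 < ρ ∧ ∀ t : ℝ, |t| ≤ ρ →
      t ∈ 𝒱 ∧ |s t - s 0 + t + t ^ 2 / 2| ≤ K * |t| ^ 3 := by
  obtain ⟨K, U, hU, hK⟩ := hs_lip
  obtain ⟨ρ, hρ, hball⟩ := Metric.mem_nhds_iff.1 (inter_mem (interior_mem_nhds.2 h𝒱) hU)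
  have hopen : IsOpen (interior 𝒱) := isOpen_interior
  have hs' : ContDiffOn ℝ 2 s (interior 𝒱) := hs_smooth.mono interior_subset
  have hin : ∀ t : ℝ, |t| < ρ → t ∈ interior 𝒱 ∧ t ∈ U := fun t ht =>
    hball (by simpa [Metric.mem_ball, Real.dist_eq] using ht)
  have hd1 : ∀ t : ℝ, |t| < ρ → HasDerivAt s (deriv s t) t := fun t ht =>
    ((hs'.differentiableOn two_ne_zero).differentiableAt (hopen.mem_nhds (hin t ht).1)).hasDerivAt
  have hs'' : ContDiffOn ℝ 1 (deriv s) (interior 𝒱) := by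
    have := hs'
    rw [show (2 : WithTop ℕ∞) = 1 + 1 by norm_num, contDiffOn_succ_iff_deriv_of_isOpen hopen] at this
    exact this.2.2
  have hd2 : ∀ t : ℝ, |t| < ρ → HasDerivAt (deriv s) (deriv (deriv s) t) t := fun t ht =>
    ((hs''.differentiableOn one_ne_zero).differentiableAt
      (hopen.mem_nhds (hin t ht).1)).hasDerivAt
  have hU0 : (0 : ℝ) ∈ U := (hin 0 (by simpa using hρ)).2
  have hb2 : ∀ t : ℝ, |t| < ρ → |deriv (deriv s) t + 1| ≤ K * |t| := by
    intro t ht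
    have := hK.dist_le_mul t (hin t ht).2 0 hU0
    simpa [Real.dist_eq, hs_two] using this
  have hb1 : ∀ t : ℝ, |t| < ρ → |deriv s t + 1 + t| ≤ K * |t| * |t| := by
    intro t ht
    have hsub : ∀ x ∈ Metric.closedBall (0 : ℝ) |t|, |x| ≤ |t| := fun x hx => by
      simpa [Real.dist_eq] using hx
    have := (convex_closedBall (0 : ℝ) |t|).norm_image_sub_le_of_norm_hasDerivWithin_le
      (f := fun x => deriv s x + 1 + x) (f' := fun x => deriv (deriv s) x + 1) (C := K * |t|)
      (x := 0) (y := t)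
      (fun x hx => (((hd2 x ((hsub x hx).trans_lt ht)).add_const 1).add (hasDerivAt_id x)).hasDerivWithinAt)
      (fun x hx => (hb2 x ((hsub x hx).trans_lt ht)).trans (mul_le_mul_of_nonneg_left (hsub x hx) K.2))
      (by simp) (by simp)
    simpa [hs_one] using this
  -- Halving the radius places the closed interval inside the open one where the derivatives are
  -- controlled.
  refine ⟨K, ρ / 2, K.2, by positivity, fun t ht => ?_⟩
  have ht : |t| < ρ := by linarith
  refine ⟨interior_subset (hin t ht).1, ?_⟩
  have hsub : ∀ x ∈ Metric.closedBall (0 : ℝ) |t|, |x| ≤ |t| := fun x hx => by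
    simpa [Real.dist_eq] using hx
  have := (convex_closedBall (0 : ℝ) |t|).norm_image_sub_le_of_norm_hasDerivWithin_le
    (f := fun x => s x - s 0 + x + x ^ 2 / 2) (f' := fun x => deriv s x + 1 + x)
    (C := K * |t| * |t|) (x := 0) (y := t)
    (fun x hx => by
      have h2 : HasDerivAt (fun x : ℝ => x ^ 2 / 2) x x := by
        simpa using (hasDerivAt_pow 2 x).div_const 2
      exact ((((hd1 x ((hsub x hx).trans_lt ht)).sub_const (s 0)).add (hasDerivAt_id x)).add
        h2).hasDerivWithinAt)
    (fun x hx => (hb1 x ((hsub x hx).trans_lt ht)).trans (mul_le_mul (mul_le_mul_of_nonneg_left (hsub x hx) K.2) (hsub x hx) (abs_nonneg x)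
      (mul_nonneg K.2 (abs_nonneg t))))
    (by simp) (by simp)
  simpa [pow_succ, mul_assoc] using this

/-! ### Expansion of the GEL objective -/

/-- AM–GM in the form |t| ≤ α + t²/α. It is used with α = τ/√d: the squares sum to O(d) and the
fourth powers to O(τ²), so both terms become O(τ√d). -/
theorem abs_pow_three_le {α : ℝ} (hα : 0 < α) (t : ℝ) :
    |t| ^ 3 ≤ α * t ^ 2 + α⁻¹ * t ^ 4 := by
  have h : |t| ≤ α + α⁻¹ * t ^ 2 := by
    have h1 : 0 ≤ α⁻¹ * (α - |t|) ^ 2 := by positivity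
    have h2 : α⁻¹ * (α - |t|) ^ 2 = α - 2 * |t| + α⁻¹ * t ^ 2 := by
      rw [← sq_abs t]; field_simp; ring
    linarith [abs_nonneg t]
  calc |t| ^ 3 = t ^ 2 * |t| := by rw [← sq_abs t]; ring
    _ ≤ t ^ 2 * (α + α⁻¹ * t ^ 2) := by gcongr
    _ = _ := by ring

theorem sum_inner_eq_sqrt_mul {n d : ℕ} (hn : 0 < n) (v : Fin n → EuclideanSpace ℝ (Fin d))
    (l : EuclideanSpace ℝ (Fin d)) :
    ∑ i, inner ℝ l (v i) = Real.sqrt n * inner ℝ l (scaledSum v) := by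
  have hn' : (0 : ℝ) < Real.sqrt n := Real.sqrt_pos.2 (by exact_mod_cast hn)
  rw [scaledSum, inner_smul_right, inner_sum]
  field_simp

/-- Quadratic expansion of the GEL objective in a neighbourhood of zero of radius of order
`√(d / n)`; `D` and `N` are the square roots of `d` and `n`. -/
theorem gelObjective_expansion {s : ℝ → ℝ} {𝒱 : Set ℝ} {K ρ : ℝ} (hK : 0 ≤ K) (hρ : 0 < ρ)
    (hT : ∀ t : ℝ, |t| ≤ ρ → t ∈ 𝒱 ∧ |s t - s 0 + t + t ^ 2 / 2| ≤ K * |t| ^ 3)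
    {n d : ℕ} (hn : 0 < n) {D N τ B L C : ℝ} (hD : 1 ≤ D) (hN : N = Real.sqrt n) (hτ : 0 < τ)
    (hτ1 : τ ≤ 1) (hB : 0 ≤ B) (hC : 0 ≤ C) (hDN : D ^ 4 ≤ τ * N)
    {Ω : Matrix (Fin d) (Fin d) ℝ} (hΩ : ∀ l, quadForm Ω l ≤ C * ‖l‖ ^ 2)
    {v : Fin n → EuclideanSpace ℝ (Fin d)} (h4 : ∑ i, ‖v i‖ ^ 4 ≤ B * N ^ 2 * D ^ 4)
    (h2 : ∀ l, |∑ i, inner ℝ l (v i) ^ 2 - n * quadForm Ω l| ≤ B * N * D ^ 2 * ‖l‖ ^ 2)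
    (hρ4 : L ^ 4 * B * τ ^ 2 ≤ ρ ^ 4) {l : EuclideanSpace ℝ (Fin d)} (hl : ‖l‖ ≤ L * (D / N)) :
    l ∈ gelMultipliers 𝒱 v ∧
      |gelObjective s v l -
        (n * s 0 - N * inner ℝ l (scaledSum v) - n / 2 * quadForm Ω l)| ≤
        τ * (K * (C * L ^ 2 + B * L ^ 2) + K * (L ^ 4 * B) + B * L ^ 2 / 2) * D := by
  have hn' : (0 : ℝ) < n := by exact_mod_cast hn
  have hN0 : 0 < N := hN ▸ Real.sqrt_pos.2 hn'
  have hNn : N ^ 2 = n := by rw [hN, Real.sq_sqrt hn'.le]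
  have hD0 : 0 < D := by linarith
  have hl2 : ‖l‖ ^ 2 ≤ L ^ 2 * D ^ 2 / N ^ 2 := by
    calc ‖l‖ ^ 2 ≤ (L * (D / N)) ^ 2 := by gcongr
      _ = _ := by ring
  have hl4 : ‖l‖ ^ 4 ≤ L ^ 4 * D ^ 4 / N ^ 4 := by
    calc ‖l‖ ^ 4 ≤ (L * (D / N)) ^ 4 := by gcongr
      _ = _ := by ring
  set t : Fin n → ℝ := fun i => inner ℝ l (v i) with ht
  have ht4 : ∀ i, t i ^ 4 ≤ ‖l‖ ^ 4 * ‖v i‖ ^ 4 := by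
    intro i
    have : |t i| ≤ ‖l‖ * ‖v i‖ := abs_real_inner_le_norm _ _
    calc t i ^ 4 = |t i| ^ 4 := by rw [← abs_pow, abs_of_nonneg (by positivity)]
      _ ≤ (‖l‖ * ‖v i‖) ^ 4 := by gcongr
      _ = _ := by ring
  -- This is d⁴/n ≤ τ², the growth condition with exponent 4.
  have hD8 : D ^ 8 / N ^ 2 ≤ τ ^ 2 := by
    rw [div_le_iff₀ (by positivity)]
    calc D ^ 8 = (D ^ 4) ^ 2 := by ring
      _ ≤ (τ * N) ^ 2 := by gcongr
      _ = _ := by ring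
  have hsum4 : ∑ i, t i ^ 4 ≤ L ^ 4 * B * (D ^ 8 / N ^ 2) := by
    calc ∑ i, t i ^ 4 ≤ ∑ i, ‖l‖ ^ 4 * ‖v i‖ ^ 4 := Finset.sum_le_sum fun i _ => ht4 i
      _ = ‖l‖ ^ 4 * ∑ i, ‖v i‖ ^ 4 := by rw [Finset.mul_sum]
      _ ≤ (L ^ 4 * D ^ 4 / N ^ 4) * (B * N ^ 2 * D ^ 4) := by gcongr
      _ = L ^ 4 * B * (D ^ 8 / N ^ 2) := by field_simp
  have hsum4' : ∑ i, t i ^ 4 ≤ L ^ 4 * B * τ ^ 2 := hsum4.trans (by gcongr)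
  -- The sum of fourth powers dominates the largest one, so all arguments lie in the Taylor range at
  -- once.
  have htρ : ∀ i, |t i| ≤ ρ := by
    intro i
    have h1 : |t i| ^ 4 ≤ ρ ^ 4 := by
      calc |t i| ^ 4 = t i ^ 4 := by rw [← abs_pow, abs_of_nonneg (by positivity)]
        _ ≤ ∑ i, t i ^ 4 := Finset.single_le_sum (f := fun i => t i ^ 4)
            (fun i _ => by positivity) (Finset.mem_univ i)
        _ ≤ ρ ^ 4 := hsum4'.trans hρ4
    exact le_of_pow_le_pow_left₀ (by norm_num) hρ.le h1
  refine ⟨fun i => (hT _ (htρ i)).1, ?_⟩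
  have hDN2 : D ^ 2 ≤ N := by
    calc D ^ 2 ≤ D ^ 4 := pow_le_pow_right₀ hD (by norm_num)
      _ ≤ τ * N := hDN
      _ ≤ N := by nlinarith
  have hquad : |∑ i, t i ^ 2 - n * quadForm Ω l| ≤ B * L ^ 2 * (D ^ 4 / N) := by
    calc _ ≤ B * N * D ^ 2 * ‖l‖ ^ 2 := h2 l
      _ ≤ B * N * D ^ 2 * (L ^ 2 * D ^ 2 / N ^ 2) := by gcongr
      _ = _ := by field_simp
  have hDN' : D ^ 4 / N ≤ τ := (div_le_iff₀ hN0).2 hDN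
  have hsum2 : ∑ i, t i ^ 2 ≤ (C * L ^ 2 + B * L ^ 2) * D ^ 2 := by
    have h1 := (abs_le.1 hquad).2
    have h3 : n * quadForm Ω l ≤ C * L ^ 2 * D ^ 2 := by
      calc n * quadForm Ω l ≤ n * (C * (L ^ 2 * D ^ 2 / N ^ 2)) := by
            gcongr; exact (hΩ l).trans (by gcongr)
        _ = _ := by rw [← hNn]; field_simp
    have h5 : B * L ^ 2 * (D ^ 4 / N) ≤ B * L ^ 2 * D ^ 2 := by
      gcongr
      exact hDN'.trans (hτ1.trans (one_le_pow₀ hD))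
    linarith
  have hrem : |∑ i, (s (t i) - s 0 + t i + t i ^ 2 / 2)| ≤
      τ * (K * (C * L ^ 2 + B * L ^ 2) + K * (L ^ 4 * B)) * D := by
    have hα : 0 < τ / D := by positivity
    calc |∑ i, (s (t i) - s 0 + t i + t i ^ 2 / 2)|
        ≤ ∑ i, |s (t i) - s 0 + t i + t i ^ 2 / 2| := Finset.abs_sum_le_sum_abs _ _
      _ ≤ ∑ i, K * ((τ / D) * t i ^ 2 + (τ / D)⁻¹ * t i ^ 4) := Finset.sum_le_sum fun i _ =>
          (hT _ (htρ i)).2.trans (by gcongr; exact abs_pow_three_le hα _)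
      _ = K * ((τ / D) * ∑ i, t i ^ 2 + (τ / D)⁻¹ * ∑ i, t i ^ 4) := by
          rw [← Finset.mul_sum, Finset.sum_add_distrib, Finset.mul_sum, Finset.mul_sum]
      _ ≤ K * ((τ / D) * ((C * L ^ 2 + B * L ^ 2) * D ^ 2) +
            (τ / D)⁻¹ * (L ^ 4 * B * τ ^ 2)) := by gcongr
      _ = _ := by field_simp
  -- An exact identity: the error is the Taylor remainder minus half the deviation of the empirical
  -- second moment from Ω.
  have hid : gelObjective s v l - (n * s 0 - N * inner ℝ l (scaledSum v) - n / 2 * quadForm Ω l)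
      = ∑ i, (s (t i) - s 0 + t i + t i ^ 2 / 2) - (∑ i, t i ^ 2 - n * quadForm Ω l) / 2 := by
    rw [hN, ← sum_inner_eq_sqrt_mul hn]
    simp only [gelObjective, Finset.sum_add_distrib, Finset.sum_sub_distrib, ← Finset.sum_div,
      Finset.sum_const, Finset.card_univ, Fintype.card_fin, nsmul_eq_mul, ht]
    ring
  rw [hid]
  have h6 : |(∑ i, t i ^ 2 - n * quadForm Ω l) / 2| ≤ τ * (B * L ^ 2 / 2) * D := by
    rw [abs_div, abs_two]
    have : B * L ^ 2 * (D ^ 4 / N) ≤ B * L ^ 2 * (τ * D) := by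
      gcongr
      exact hDN'.trans (by nlinarith)
    linarith
  calc _ ≤ _ := abs_sub _ _
    _ ≤ _ := add_le_add hrem h6
    _ = _ := by ring

/-! ### Upper and lower bounds for the GEL criterion by its quadratic approximation -/

section gel
variable {s : ℝ → ℝ} {𝒱 : Set ℝ} {n d : ℕ} {v : Fin n → EuclideanSpace ℝ (Fin d)}
  {Ω : Matrix (Fin d) (Fin d) ℝ} {C L e : ℝ}

/-- Completing the square: the gap is half the value of the form Ω at N l + Ω⁻¹S. The vertex is
therefore l = −N⁻¹Ω⁻¹S. -/
theorem neg_inner_sub_quadForm_le (hC : 1 ≤ C) (hΩ : IsElliptic Ω C) (hu : IsUnit Ω) (N : ℝ)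
    (l S : EuclideanSpace ℝ (Fin d)) :
    -(N * inner ℝ l S) - N ^ 2 / 2 * quadForm Ω l ≤ quadForm Ω⁻¹ S / 2 := by
  have h := hΩ.quadForm_nonneg hC (N • l + matOp Ω⁻¹ S)
  rw [hΩ.quadForm_add, quadForm_smul, quadForm_eq_inner Ω (matOp Ω⁻¹ S), hΩ.symm _ (N • l),
    matOp_matOp_inv hu, inner_smul_left, real_inner_comm S (matOp Ω⁻¹ S), ← quadForm_eq_inner] at h
  simp only [conj_trivial] at h
  linarith

theorem convex_gelMultipliers (h𝒱 : Convex ℝ 𝒱) : Convex ℝ (gelMultipliers 𝒱 v) := by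
  intro x hx y hy a b ha hb hab i
  rw [inner_add_left, inner_smul_left, inner_smul_left]
  exact h𝒱 (hx i) (hy i) ha hb hab

theorem concaveOn_gelObjective (hs : ConcaveOn ℝ 𝒱 s) :
    ConcaveOn ℝ (gelMultipliers 𝒱 v) (gelObjective s v) := by
  refine ⟨convex_gelMultipliers hs.1, fun x hx y hy a b ha hb hab => ?_⟩
  simp only [gelObjective, smul_eq_mul, Finset.mul_sum, ← Finset.sum_add_distrib]
  refine Finset.sum_le_sum fun i _ => ?_
  rw [inner_add_left, inner_smul_left, inner_smul_left]
  exact hs.2 (hx i) (hy i) ha hb hab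

/-- If the GEL objective has a quadratic expansion on a large enough ball, then the expansion
bounds it globally, by concavity. -/
theorem gelObjective_le (hs : ConcaveOn ℝ 𝒱 s) (h0 : (0 : ℝ) ∈ 𝒱) (hn : 0 < n) (hC : 1 ≤ C)
    (hΩ : IsElliptic Ω C) (hu : IsUnit Ω) {D N B : ℝ} (hN : N = Real.sqrt n) (hD : 1 ≤ D)
    (hB : 0 ≤ B) (hS : ‖scaledSum v‖ ≤ B * D) (hL : L = 2 * C * (B + 1)) (he : e ≤ L * D ^ 2)
    (he0 : 0 ≤ e)
    (hexp : ∀ l : EuclideanSpace ℝ (Fin d), ‖l‖ ≤ L * (D / N) → l ∈ gelMultipliers 𝒱 v ∧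
      |gelObjective s v l -
        (n * s 0 - N * inner ℝ l (scaledSum v) - n / 2 * quadForm Ω l)| ≤ e)
    {l : EuclideanSpace ℝ (Fin d)} (hl : l ∈ gelMultipliers 𝒱 v) :
    gelObjective s v l ≤ n * s 0 + quadForm Ω⁻¹ (scaledSum v) / 2 + e := by
  have hn' : (0 : ℝ) < n := by exact_mod_cast hn
  have hN0 : 0 < N := hN ▸ Real.sqrt_pos.2 hn'
  have hNn : N ^ 2 = n := by rw [hN, Real.sq_sqrt hn'.le]
  have hL0 : 0 < L := by rw [hL]; positivity
  have hr : 0 < L * (D / N) := by positivity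
  rcases le_or_gt ‖l‖ (L * (D / N)) with hle | hgt
  · have h1 := (abs_le.1 (hexp l hle).2).2
    have h2 := neg_inner_sub_quadForm_le hC hΩ hu N l (scaledSum v)
    rw [hNn] at h2
    linarith
  · set r := L * (D / N) with hrdef
    have hl0 : 0 < ‖l‖ := hr.trans hgt
    -- Outside the ball, l is pulled back along its ray to the sphere of radius r. If the objective
    -- there is at most its value at 0, concavity along the ray gives the same at l.
    set a := r / ‖l‖ with ha
    have ha0 : 0 < a := by positivity
    have ha1 : a < 1 := (div_lt_one hl0).2 hgt
    have hal : ‖a • l‖ = r := by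
      rw [norm_smul, Real.norm_of_nonneg ha0.le, ha, div_mul_cancel₀ _ hl0.ne']
    have h0mem : (0 : EuclideanSpace ℝ (Fin d)) ∈ gelMultipliers 𝒱 v := fun i => by simpa using h0
    have hobj0 : gelObjective s v 0 = n * s 0 := by simp [gelObjective]
    have hconc := (concaveOn_gelObjective (v := v) hs).2 hl h0mem ha0.le (sub_pos.2 ha1).le
      (by ring)
    rw [smul_zero, add_zero, hobj0, smul_eq_mul, smul_eq_mul] at hconc
    have h1 := (abs_le.1 (hexp (a • l) hal.le).2).2
    have h2 : -(N * inner ℝ (a • l) (scaledSum v)) ≤ L * B * D ^ 2 := by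
      have := (abs_le.1 (abs_real_inner_le_norm (a • l) (scaledSum v))).1
      rw [hal] at this
      have h3 : r * ‖scaledSum v‖ ≤ r * (B * D) := by gcongr
      have h4 : N * (r * (B * D)) = L * B * D ^ 2 := by rw [hrdef]; field_simp
      nlinarith
    -- L = 2C(B + 1) is chosen so that on the sphere the quadratic term beats the linear term, at
    -- most LBD², together with the expansion error, at most LD².
    have h3 : L * (B + 1) * D ^ 2 ≤ n / 2 * quadForm Ω (a • l) := by
      have := hΩ.lower (a • l)
      rw [hal] at this
      calc L * (B + 1) * D ^ 2 = n / 2 * (C⁻¹ * r ^ 2) := by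
            rw [hrdef, ← hNn]
            have : C ≠ 0 := by positivity
            field_simp
            rw [hL]
            ring
        _ ≤ _ := by gcongr
    have h4 : gelObjective s v (a • l) ≤ n * s 0 := by linarith
    have h5 : gelObjective s v l ≤ n * s 0 := by
      have : a * gelObjective s v l ≤ a * (n * s 0) := by linarith
      exact le_of_mul_le_mul_left this ha0
    have h6 : 0 ≤ quadForm Ω⁻¹ (scaledSum v) := by
      have := hΩ.quadForm_nonneg hC (matOp Ω⁻¹ (scaledSum v))
      rwa [quadForm_eq_inner, matOp_matOp_inv hu, real_inner_comm, ← quadForm_eq_inner] at this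
    linarith

/-- The multiplier is the vertex −N⁻¹Ω⁻¹S of the quadratic approximation, which the bound on C‖S‖
places in the ball of validity. -/
theorem exists_le_gelObjective (hn : 0 < n) (hu : IsUnit Ω) (hinv : IsElliptic Ω⁻¹ C) {D N : ℝ}
    (hN : N = Real.sqrt n) (hS : C * ‖scaledSum v‖ ≤ L * D)
    (hexp : ∀ l : EuclideanSpace ℝ (Fin d), ‖l‖ ≤ L * (D / N) → l ∈ gelMultipliers 𝒱 v ∧
      |gelObjective s v l -
        (n * s 0 - N * inner ℝ l (scaledSum v) - n / 2 * quadForm Ω l)| ≤ e) :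
    ∃ l ∈ gelMultipliers 𝒱 v,
      n * s 0 + quadForm Ω⁻¹ (scaledSum v) / 2 - e ≤ gelObjective s v l := by
  have hn' : (0 : ℝ) < n := by exact_mod_cast hn
  have hN0 : 0 < N := hN ▸ Real.sqrt_pos.2 hn'
  have hNn : N ^ 2 = n := by rw [hN, Real.sq_sqrt hn'.le]
  set l := (-N⁻¹) • matOp Ω⁻¹ (scaledSum v) with hl
  have hln : ‖l‖ ≤ L * (D / N) := by
    rw [hl, norm_smul, norm_neg, norm_inv, Real.norm_of_nonneg hN0.le]
    calc N⁻¹ * ‖matOp Ω⁻¹ (scaledSum v)‖ ≤ N⁻¹ * (L * D) := by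
          gcongr; exact (hinv.upper _).trans hS
      _ = _ := by ring
  obtain ⟨hmem, h⟩ := hexp l hln
  refine ⟨l, hmem, ?_⟩
  have h1 := (abs_le.1 h).1
  have h2 : inner ℝ l (scaledSum v) = -N⁻¹ * quadForm Ω⁻¹ (scaledSum v) := by
    rw [hl, inner_smul_left, real_inner_comm, ← quadForm_eq_inner]; simp
  have h3 : quadForm Ω l = N⁻¹ ^ 2 * quadForm Ω⁻¹ (scaledSum v) := by
    rw [hl, quadForm_smul, quadForm_eq_inner Ω, matOp_matOp_inv hu, real_inner_comm,
      ← quadForm_eq_inner]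
    ring
  have h4 : n * s 0 - N * inner ℝ l (scaledSum v) - n / 2 * quadForm Ω l =
      n * s 0 + quadForm Ω⁻¹ (scaledSum v) / 2 := by
    rw [h2, h3, ← hNn]; field_simp; ring
  linarith

end gel

/-- Two real bounds exclude the values ±∞, after which the claim is real arithmetic. -/
theorem abs_gelStatistic_sub_lt {s : ℝ → ℝ} {𝒱 : Set ℝ} {n d : ℕ}
    {v : Fin n → EuclideanSpace ℝ (Fin d)} {a δ c : ℝ} (hδ : δ < c)
    (hup : gelCriterion s 𝒱 v ≤ ((n * s 0 + a / 2 + δ / 2 : ℝ) : EReal))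
    (hlow : ((n * s 0 + a / 2 - δ / 2 : ℝ) : EReal) ≤ gelCriterion s 𝒱 v) :
    (gelStatistic s 𝒱 v - (a : EReal)).abs < ENNReal.ofReal c := by
  have hne_top : gelCriterion s 𝒱 v ≠ ⊤ := ne_top_of_le_ne_top (EReal.coe_ne_top _) hup
  have hne_bot : gelCriterion s 𝒱 v ≠ ⊥ := ne_bot_of_le_ne_bot (EReal.coe_ne_bot _) hlow
  obtain ⟨r, hr⟩ : ∃ r : ℝ, gelCriterion s 𝒱 v = r :=
    ⟨_, (EReal.coe_toReal hne_top hne_bot).symm⟩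
  rw [hr, EReal.coe_le_coe_iff] at hup hlow
  have : gelStatistic s 𝒱 v - (a : EReal) = ((2 * (r - n * s 0) - a : ℝ) : EReal) := by
    rw [gelStatistic, hr]
    push_cast
    rfl
  rw [this, EReal.abs_def]
  have h : |2 * (r - n * s 0) - a| ≤ δ := abs_le.2 ⟨by linarith, by linarith⟩
  exact (ENNReal.ofReal_lt_ofReal_iff (((abs_nonneg _).trans h).trans_lt hδ)).2 (h.trans_lt hδ)

/-! ### Outer products as Euclidean vectors -/

/-- A square matrix as a Euclidean vector. -/
noncomputable def matVec {d : ℕ} (A : Matrix (Fin d) (Fin d) ℝ) :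
    EuclideanSpace ℝ (Fin d × Fin d) :=
  WithLp.toLp 2 fun p => A p.1 p.2

/-- The matrix `v vᵀ` as a Euclidean vector. -/
noncomputable def outerVec {d : ℕ} (v : EuclideanSpace ℝ (Fin d)) :
    EuclideanSpace ℝ (Fin d × Fin d) :=
  WithLp.toLp 2 fun p => v p.1 * v p.2

section outer
variable {n d q : ℕ}

theorem inner_outerVec (l v : EuclideanSpace ℝ (Fin d)) :
    inner ℝ (outerVec l) (outerVec v) = inner ℝ l v ^ 2 := by
  simp only [outerVec, PiLp.inner_apply, RCLike.inner_apply, conj_trivial,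
    Fintype.sum_prod_type, sq, Finset.sum_mul_sum]
  exact Finset.sum_congr rfl fun i _ => Finset.sum_congr rfl fun j _ => by ring

theorem inner_outerVec_matVec (l : EuclideanSpace ℝ (Fin d)) (A : Matrix (Fin d) (Fin d) ℝ) :
    inner ℝ (outerVec l) (matVec A) = quadForm A l := by
  simp only [outerVec, matVec, PiLp.inner_apply, RCLike.inner_apply, conj_trivial,
    Fintype.sum_prod_type, quadForm, dotProduct, Matrix.mulVec, Finset.mul_sum]
  exact Finset.sum_congr rfl fun i _ => Finset.sum_congr rfl fun j _ => by ring

theorem norm_outerVec (v : EuclideanSpace ℝ (Fin d)) : ‖outerVec v‖ = ‖v‖ ^ 2 := by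
  have h := inner_outerVec v v
  rw [real_inner_self_eq_norm_sq, real_inner_self_eq_norm_sq] at h
  exact (pow_left_inj₀ (norm_nonneg _) (by positivity) two_ne_zero).1 h

/-- A quadratic form in l is linear in the outer product of l with itself, whose Frobenius norm is
‖l‖². Cauchy–Schwarz therefore gives a bound uniform in l from the norm of a single random vector.
-/
theorem abs_sum_inner_sq_sub_le (Ω : Matrix (Fin d) (Fin d) ℝ) (w : Fin n → ℝ)
    (y : Fin n → EuclideanSpace ℝ (Fin d)) (l : EuclideanSpace ℝ (Fin d)) :
    |∑ i, inner ℝ l (w i • y i) ^ 2 - n * quadForm Ω l| ≤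
      ‖∑ i, (w i ^ 2 • outerVec (y i) - matVec Ω)‖ * ‖l‖ ^ 2 := by
  have h : ∑ i, inner ℝ l (w i • y i) ^ 2 - n * quadForm Ω l =
      inner ℝ (outerVec l) (∑ i, (w i ^ 2 • outerVec (y i) - matVec Ω)) := by
    simp only [inner_sum, inner_sub_right, inner_smul_right, inner_outerVec,
      inner_outerVec_matVec, Finset.sum_sub_distrib, Finset.sum_const, Finset.card_univ,
      Fintype.card_fin, mul_pow, ← Nat.cast_smul_eq_nsmul ℝ]
  rw [h, ← norm_outerVec l, mul_comm]
  exact abs_real_inner_le_norm _ _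

end outer

/-- Empirical fourth moments of order `d²`, and empirical second moments close to `Ω`. -/
structure MomentControl {n d : ℕ} (Ω : Matrix (Fin d) (Fin d) ℝ) (B : ℝ)
    (v : Fin n → EuclideanSpace ℝ (Fin d)) : Prop where
  fourth : ∑ i, ‖v i‖ ^ 4 ≤ B * n * (d : ℝ) ^ 2
  second : ∀ l, |∑ i, inner ℝ l (v i) ^ 2 - n * quadForm Ω l| ≤ B * Real.sqrt n * d * ‖l‖ ^ 2

/-! ### Stability of empirical moments and sums under a shift of the parameter -/

section perturb
variable {n d q : ℕ}

theorem norm_pow_four_add_le {E : Type*} [SeminormedAddCommGroup E] (x y : E) :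
    ‖x + y‖ ^ 4 ≤ 8 * (‖x‖ ^ 4 + ‖y‖ ^ 4) := by
  calc ‖x + y‖ ^ 4 ≤ (‖x‖ + ‖y‖) ^ 4 := by gcongr; exact norm_add_le _ _
    _ ≤ 2 ^ (4 - 1) * (‖x‖ ^ 4 + ‖y‖ ^ 4) := add_pow_le (norm_nonneg _) (norm_nonneg _) 4
    _ = _ := by norm_num

theorem sum_sq_le_of_sum_pow_four_le {B : ℝ} (hd : 1 ≤ d) {y : Fin n → EuclideanSpace ℝ (Fin d)}
    (h4 : ∑ i, ‖y i‖ ^ 4 ≤ B * n * (d : ℝ) ^ 2) : ∑ i, ‖y i‖ ^ 2 ≤ (1 + B) * n * d := by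
  have hd' : (0 : ℝ) < d := by exact_mod_cast hd
  have h : ∀ i, ‖y i‖ ^ 2 ≤ d + (d : ℝ)⁻¹ * ‖y i‖ ^ 4 := fun i => by
    have h1 : 0 ≤ (d : ℝ)⁻¹ * ((d - ‖y i‖ ^ 2) ^ 2 + d * ‖y i‖ ^ 2) := by positivity
    have h2 : (d : ℝ)⁻¹ * ((d - ‖y i‖ ^ 2) ^ 2 + d * ‖y i‖ ^ 2) =
        d + (d : ℝ)⁻¹ * ‖y i‖ ^ 4 - ‖y i‖ ^ 2 := by field_simp; ring
    linarith
  calc ∑ i, ‖y i‖ ^ 2 ≤ ∑ i, (d + (d : ℝ)⁻¹ * ‖y i‖ ^ 4) := Finset.sum_le_sum fun i _ => h i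
    _ = n * d + (d : ℝ)⁻¹ * ∑ i, ‖y i‖ ^ 4 := by
        rw [Finset.sum_add_distrib, Finset.mul_sum]; simp
    _ ≤ n * d + (d : ℝ)⁻¹ * (B * n * (d : ℝ) ^ 2) := by gcongr
    _ = _ := by field_simp

/-- The total squared displacement H d lacks the factor n present in the total of ‖y i‖². Cross
terms are therefore of order √n · d, the tolerance already allowed for second moments. -/
theorem MomentControl.perturb {Ω : Matrix (Fin d) (Fin d) ℝ} {B H K : ℝ} (hn : 0 < n) (hd : 1 ≤ d)
    (hB : 0 ≤ B) {w : Fin n → ℝ} (hw : ∀ i, |w i| ≤ K)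
    {y z : Fin n → EuclideanSpace ℝ (Fin d)}
    (h4 : ∑ i, ‖y i‖ ^ 4 ≤ B * n * (d : ℝ) ^ 2)
    (h2 : ∀ l, |∑ i, inner ℝ l (w i • y i) ^ 2 - n * quadForm Ω l| ≤
      B * Real.sqrt n * d * ‖l‖ ^ 2)
    (hz : ∑ i, ‖z i - y i‖ ^ 2 ≤ H * d) :
    MomentControl Ω (K ^ 4 * (8 * (B + H ^ 2)) + B + K ^ 2 * (1 + B + 2 * H))
      (fun i => w i • z i) := by
  have hn' : (0 : ℝ) < n := by exact_mod_cast hn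
  have hn1 : (1 : ℝ) ≤ n := by exact_mod_cast hn
  have hd' : (1 : ℝ) ≤ d := by exact_mod_cast hd
  have hN : 1 ≤ Real.sqrt n := Real.one_le_sqrt.2 hn1
  have hNn : Real.sqrt n ^ 2 = n := Real.sq_sqrt hn'.le
  set N := Real.sqrt n
  have hN0 : 0 < N := by linarith
  set h : Fin n → EuclideanSpace ℝ (Fin d) := fun i => z i - y i with hh
  have hzy : ∀ i, z i = y i + h i := fun i => by simp [hh]
  have hH : 0 ≤ H := by
    have : 0 ≤ H * d := le_trans (Finset.sum_nonneg fun i _ => by positivity) hz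
    exact nonneg_of_mul_nonneg_left this (by linarith)
  have hw2 : ∀ i, w i ^ 2 ≤ K ^ 2 := fun i => by
    rw [← sq_abs (w i)]; exact pow_le_pow_left₀ (abs_nonneg _) (hw i) 2
  -- A sum of squares of nonnegative numbers is at most the square of their sum.
  have hh4 : ∑ i, ‖h i‖ ^ 4 ≤ H ^ 2 * n * (d : ℝ) ^ 2 := by
    calc ∑ i, ‖h i‖ ^ 4 = ∑ i, ‖h i‖ ^ 2 * ‖h i‖ ^ 2 :=
          Finset.sum_congr rfl fun i _ => by ring
      _ ≤ ∑ i, ‖h i‖ ^ 2 * ∑ j, ‖h j‖ ^ 2 := Finset.sum_le_sum fun i _ => by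
          gcongr
          exact Finset.single_le_sum (f := fun i => ‖h i‖ ^ 2) (fun i _ => by positivity)
            (Finset.mem_univ i)
      _ = (∑ i, ‖h i‖ ^ 2) ^ 2 := by rw [← Finset.sum_mul, sq]
      _ ≤ (H * d) ^ 2 := by gcongr
      _ = H ^ 2 * 1 * (d : ℝ) ^ 2 := by ring
      _ ≤ _ := by gcongr
  constructor
  · calc ∑ i, ‖w i • z i‖ ^ 4 ≤ ∑ i, K ^ 4 * (8 * (‖y i‖ ^ 4 + ‖h i‖ ^ 4)) := by
          refine Finset.sum_le_sum fun i _ => ?_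
          rw [norm_smul, mul_pow, hzy]
          gcongr
          · exact hw i
          · exact norm_pow_four_add_le _ _
      _ = K ^ 4 * (8 * (∑ i, ‖y i‖ ^ 4 + ∑ i, ‖h i‖ ^ 4)) := by
          rw [← Finset.mul_sum, ← Finset.mul_sum, Finset.sum_add_distrib]
      _ ≤ K ^ 4 * (8 * (B * n * (d : ℝ) ^ 2 + H ^ 2 * n * (d : ℝ) ^ 2)) := by gcongr
      _ = K ^ 4 * (8 * (B + H ^ 2)) * n * (d : ℝ) ^ 2 := by ring
      _ ≤ _ := by
          gcongr
          have : 0 ≤ K ^ 2 * (1 + B + 2 * H) := by positivity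
          linarith
  · intro l
    have hterm : ∀ i, |inner ℝ l (w i • z i) ^ 2 - inner ℝ l (w i • y i) ^ 2| ≤
        K ^ 2 * ‖l‖ ^ 2 * (N⁻¹ * ‖y i‖ ^ 2 + (N + 1) * ‖h i‖ ^ 2) := by
      intro i
      have e1 : inner ℝ l (w i • z i) ^ 2 - inner ℝ l (w i • y i) ^ 2 =
          w i ^ 2 * (2 * (inner ℝ l (y i) * inner ℝ l (h i)) + inner ℝ l (h i) ^ 2) := by
        rw [hzy]
        simp only [inner_smul_right, inner_add_right]
        ring
      have a1 : |inner ℝ l (y i)| ≤ ‖l‖ * ‖y i‖ := abs_real_inner_le_norm _ _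
      have a2 : |inner ℝ l (h i)| ≤ ‖l‖ * ‖h i‖ := abs_real_inner_le_norm _ _
      -- The AM–GM weight √n balances totals of order n d and d, making both terms of order √n · d.
      have e2 : 2 * (‖y i‖ * ‖h i‖) ≤ N⁻¹ * ‖y i‖ ^ 2 + N * ‖h i‖ ^ 2 := by
        have h1 : 0 ≤ N⁻¹ * (‖y i‖ - N * ‖h i‖) ^ 2 := by positivity
        have h2 : N⁻¹ * (‖y i‖ - N * ‖h i‖) ^ 2 =
            N⁻¹ * ‖y i‖ ^ 2 - 2 * (‖y i‖ * ‖h i‖) + N * ‖h i‖ ^ 2 := by field_simp; ring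
        linarith
      rw [e1, abs_mul, abs_of_nonneg (sq_nonneg (w i)), mul_assoc (K ^ 2)]
      refine mul_le_mul (hw2 i) ?_ (abs_nonneg _) (sq_nonneg _)
      calc _ ≤ 2 * (|inner ℝ l (y i)| * |inner ℝ l (h i)|) + |inner ℝ l (h i)| ^ 2 := by
            refine (abs_add_le _ _).trans (le_of_eq ?_)
            rw [abs_mul, abs_mul, abs_pow, abs_two]
        _ ≤ 2 * ((‖l‖ * ‖y i‖) * (‖l‖ * ‖h i‖)) + (‖l‖ * ‖h i‖) ^ 2 := by gcongr
        _ = ‖l‖ ^ 2 * (2 * (‖y i‖ * ‖h i‖) + ‖h i‖ ^ 2) := by ring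
        _ ≤ ‖l‖ ^ 2 * (N⁻¹ * ‖y i‖ ^ 2 + (N + 1) * ‖h i‖ ^ 2) :=
            mul_le_mul_of_nonneg_left (by linarith) (sq_nonneg _)
    have hy2 := sum_sq_le_of_sum_pow_four_le hd h4
    have hdiff : |∑ i, inner ℝ l (w i • z i) ^ 2 - ∑ i, inner ℝ l (w i • y i) ^ 2| ≤
        K ^ 2 * (1 + B + 2 * H) * N * d * ‖l‖ ^ 2 := by
      rw [← Finset.sum_sub_distrib]
      calc _ ≤ ∑ i, |inner ℝ l (w i • z i) ^ 2 - inner ℝ l (w i • y i) ^ 2| :=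
            Finset.abs_sum_le_sum_abs _ _
        _ ≤ ∑ i, K ^ 2 * ‖l‖ ^ 2 * (N⁻¹ * ‖y i‖ ^ 2 + (N + 1) * ‖h i‖ ^ 2) :=
            Finset.sum_le_sum fun i _ => hterm i
        _ = K ^ 2 * ‖l‖ ^ 2 * (N⁻¹ * ∑ i, ‖y i‖ ^ 2 + (N + 1) * ∑ i, ‖h i‖ ^ 2) := by
            rw [← Finset.mul_sum, Finset.sum_add_distrib, Finset.mul_sum, Finset.mul_sum]
        _ ≤ K ^ 2 * ‖l‖ ^ 2 * (N⁻¹ * ((1 + B) * n * d) + (N + N) * (H * d)) := by gcongr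
        _ = _ := by rw [← hNn]; field_simp; ring
    have := abs_add_le (∑ i, inner ℝ l (w i • z i) ^ 2 - ∑ i, inner ℝ l (w i • y i) ^ 2)
      (∑ i, inner ℝ l (w i • y i) ^ 2 - n * quadForm Ω l)
    rw [sub_add_sub_cancel] at this
    refine this.trans ((add_le_add hdiff (h2 l)).trans ?_)
    have h5 : 0 ≤ K ^ 4 * (8 * (B + H ^ 2)) * N * d * ‖l‖ ^ 2 := by positivity
    linarith

/-- Second-order control of the moment vectors at an estimator. -/
theorem sum_norm_sub_sq_le {B R : ℝ} (hn : 0 < n) (hB : 0 ≤ B)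
    {y z : Fin n → EuclideanSpace ℝ (Fin d)} {D : Fin n → Fin q → EuclideanSpace ℝ (Fin d)}
    {δ : Fin n → ℝ} {u : EuclideanSpace ℝ (Fin q)} (hu : ‖u‖ ≤ R / Real.sqrt n)
    (hrem : ∀ i, ‖z i - y i - ∑ j, u j • D i j‖ ≤ δ i * ‖u‖ ^ 2)
    (hD : ∑ i, ∑ j, ‖D i j‖ ^ 2 ≤ B * n * d) (hδ : ∑ i, δ i ^ 2 ≤ B * n * d) :
    ∑ i, ‖z i - y i‖ ^ 2 ≤ (2 * R ^ 2 * (q * B) + 2 * R ^ 4 * B) * d := by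
  have hn' : (0 : ℝ) < n := by exact_mod_cast hn
  have hn1 : (1 : ℝ) ≤ n := by exact_mod_cast hn
  have hu2 : ‖u‖ ^ 2 ≤ R ^ 2 / n := by
    calc ‖u‖ ^ 2 ≤ (R / Real.sqrt n) ^ 2 := by gcongr
      _ = _ := by rw [div_pow, Real.sq_sqrt hn'.le]
  have hlin : ∀ i, ‖∑ j, u j • D i j‖ ^ 2 ≤ ‖u‖ ^ 2 * (q * ∑ j, ‖D i j‖ ^ 2) := by
    intro i
    calc ‖∑ j, u j • D i j‖ ^ 2 ≤ (∑ j, ‖u‖ * ‖D i j‖) ^ 2 := by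
          gcongr
          refine (norm_sum_le _ _).trans (Finset.sum_le_sum fun j _ => ?_)
          rw [norm_smul]
          gcongr
          exact PiLp.norm_apply_le u j
      _ = ‖u‖ ^ 2 * (∑ j, ‖D i j‖) ^ 2 := by rw [← Finset.mul_sum, mul_pow]
      _ ≤ ‖u‖ ^ 2 * (q * ∑ j, ‖D i j‖ ^ 2) := by
          gcongr
          simpa using sq_sum_le_card_mul_sum_sq (s := Finset.univ) (f := fun j => ‖D i j‖)
  have hterm : ∀ i, ‖z i - y i‖ ^ 2 ≤
      2 * (‖u‖ ^ 2 * (q * ∑ j, ‖D i j‖ ^ 2)) + 2 * ((‖u‖ ^ 2) ^ 2 * δ i ^ 2) := by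
    intro i
    have h1 : ‖z i - y i‖ ≤ ‖∑ j, u j • D i j‖ + δ i * ‖u‖ ^ 2 := by
      calc ‖z i - y i‖ = ‖∑ j, u j • D i j + (z i - y i - ∑ j, u j • D i j)‖ := by
            congr 1; abel
        _ ≤ _ := (norm_add_le _ _).trans (by gcongr; exact hrem i)
    calc ‖z i - y i‖ ^ 2 ≤ (‖∑ j, u j • D i j‖ + δ i * ‖u‖ ^ 2) ^ 2 := by gcongr
      _ ≤ 2 * (‖∑ j, u j • D i j‖ ^ 2 + (δ i * ‖u‖ ^ 2) ^ 2) := add_sq_le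
      _ ≤ 2 * (‖u‖ ^ 2 * (q * ∑ j, ‖D i j‖ ^ 2) + (δ i * ‖u‖ ^ 2) ^ 2) := by
          gcongr; exact hlin i
      _ = _ := by ring
  calc ∑ i, ‖z i - y i‖ ^ 2
      ≤ ∑ i, (2 * (‖u‖ ^ 2 * (q * ∑ j, ‖D i j‖ ^ 2)) + 2 * ((‖u‖ ^ 2) ^ 2 * δ i ^ 2)) :=
        Finset.sum_le_sum fun i _ => hterm i
    _ = 2 * (‖u‖ ^ 2 * (q * ∑ i, ∑ j, ‖D i j‖ ^ 2)) + 2 * ((‖u‖ ^ 2) ^ 2 * ∑ i, δ i ^ 2) := by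
        simp only [Finset.sum_add_distrib, Finset.mul_sum]
    _ ≤ 2 * (R ^ 2 / n * (q * (B * n * d))) + 2 * ((R ^ 2 / n) ^ 2 * (B * n * d)) := by gcongr
    _ = 2 * R ^ 2 * (q * B) * d + 2 * R ^ 4 * B * d * (1 / n) := by field_simp
    _ ≤ 2 * R ^ 2 * (q * B) * d + 2 * R ^ 4 * B * d * 1 := by
        gcongr
        exact (div_le_one hn').2 hn1
    _ = _ := by ring

/-- First-order expansion of the scaled weighted sum at an estimator: the drift lies in the span of
the mean derivatives `G j`. -/
theorem norm_scaledSum_sub_sub_le {B R K : ℝ} (hn : 0 < n) (hB : 1 ≤ B) (hR : 0 ≤ R)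
    (hK : 0 ≤ K)
    {w : Fin n → ℝ} (hw : ∀ i, |w i| ≤ K)
    {y z : Fin n → EuclideanSpace ℝ (Fin d)} {D : Fin n → Fin q → EuclideanSpace ℝ (Fin d)}
    {G : Fin q → EuclideanSpace ℝ (Fin d)}
    {δ : Fin n → ℝ} {u : EuclideanSpace ℝ (Fin q)} (hu : ‖u‖ ≤ R / Real.sqrt n)
    (hrem : ∀ i, ‖z i - y i - ∑ j, u j • D i j‖ ≤ δ i * ‖u‖ ^ 2)
    (hδ : ∑ i, δ i ^ 2 ≤ B * n * d)
    (hG : ∀ j, ‖scaledSum fun i => w i • D i j - G j‖ ^ 2 ≤ B * d) :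
    ‖scaledSum (fun i => w i • z i) - scaledSum (fun i => w i • y i) -
      ∑ j, (Real.sqrt n * u j) • G j‖ ≤
      (q * R * B + K * R ^ 2 * B) * (Real.sqrt d / Real.sqrt n) := by
  have hn' : (0 : ℝ) < n := by exact_mod_cast hn
  have hNn : Real.sqrt n ^ 2 = n := Real.sq_sqrt hn'.le
  have hDd : Real.sqrt d ^ 2 = d := Real.sq_sqrt (by positivity)
  have hN0 : 0 < Real.sqrt n := Real.sqrt_pos.2 hn'
  set N := Real.sqrt n
  set E := Real.sqrt d
  have hE : 0 ≤ E := Real.sqrt_nonneg _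
  -- Since B ≥ 1, a bound B on a square also gives the bound B on its root.
  have hBB : B ≤ B ^ 2 := by nlinarith
  have hG' : ∀ j, ‖scaledSum fun i => w i • D i j - G j‖ ≤ B * E := fun j => by
    refine abs_le_of_sq_le_sq' ?_ (by positivity) |>.2
    refine (hG j).trans ?_
    rw [mul_pow, hDd]
    gcongr
  have hδ1 : ∑ i, |δ i| ≤ n * (B * E) := by
    have h1 : (∑ i, |δ i|) ^ 2 ≤ n * ∑ i, |δ i| ^ 2 := by
      simpa using sq_sum_le_card_mul_sum_sq (s := Finset.univ) (f := fun i => |δ i|)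
    refine abs_le_of_sq_le_sq' (h1.trans ?_) (by positivity) |>.2
    simp only [sq_abs]
    calc n * ∑ i, δ i ^ 2 ≤ n * (B * n * d) := by gcongr
      _ ≤ n * (B ^ 2 * n * d) := by gcongr
      _ = (n * (B * E)) ^ 2 := by rw [← hDd]; ring
  -- Centring the derivative sums at G isolates the drift. What remains is u times centred sums of
  -- size √d, and a remainder of order n^{-1/2} · n√d · ‖u‖²; both are O(√(d/n)).
  have hid : scaledSum (fun i => w i • z i) - scaledSum (fun i => w i • y i) -
      ∑ j, (N * u j) • G j = ∑ j, u j • scaledSum (fun i => w i • D i j - G j) +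
        N⁻¹ • ∑ i, w i • (z i - y i - ∑ j, u j • D i j) := by
    have h1 : ∀ j, u j • scaledSum (fun i => w i • D i j - G j) =
        N⁻¹ • ∑ i, w i • (u j • D i j) - (N * u j) • G j := by
      intro j
      rw [scaledSum, Finset.sum_sub_distrib, smul_sub, smul_sub]
      congr 1
      · rw [smul_comm, Finset.smul_sum]
        congr 1
        exact Finset.sum_congr rfl fun i _ => smul_comm _ _ _
      · simp only [Finset.sum_const, Finset.card_univ, Fintype.card_fin]
        rw [← Nat.cast_smul_eq_nsmul ℝ, smul_smul, smul_smul]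
        congr 1
        change u j * N⁻¹ * n = N * u j
        rw [← hNn]
        field_simp
    simp only [h1, Finset.sum_sub_distrib, ← Finset.smul_sum, smul_sub]
    rw [Finset.sum_comm]
    simp only [scaledSum, Finset.smul_sum]
    simp only [N]
    abel
  rw [hid]
  calc _ ≤ ∑ j, ‖u j • scaledSum (fun i => w i • D i j - G j)‖ +
        ‖N⁻¹ • ∑ i, w i • (z i - y i - ∑ j, u j • D i j)‖ :=
        (norm_add_le _ _).trans (by gcongr; exact norm_sum_le _ _)
    _ ≤ ∑ _j : Fin q, R / N * (B * E) + N⁻¹ * (K * (R ^ 2 / n) * (n * (B * E))) := by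
        gcongr with j
        · rw [norm_smul]
          gcongr
          · exact (PiLp.norm_apply_le u j).trans hu
          · exact hG' j
        · rw [norm_smul, norm_inv, Real.norm_of_nonneg hN0.le]
          gcongr
          calc _ ≤ ∑ i, ‖w i • (z i - y i - ∑ j, u j • D i j)‖ := norm_sum_le _ _
            _ ≤ ∑ i, K * (R ^ 2 / n) * |δ i| := by
                refine Finset.sum_le_sum fun i _ => ?_
                rw [norm_smul, mul_assoc]
                refine mul_le_mul (hw i) ?_ (norm_nonneg _) hK
                refine (hrem i).trans ?_
                have hu2 : ‖u‖ ^ 2 ≤ R ^ 2 / n := by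
                  calc ‖u‖ ^ 2 ≤ (R / N) ^ 2 := by gcongr
                    _ = _ := by rw [div_pow, hNn]
                calc δ i * ‖u‖ ^ 2 ≤ |δ i| * (R ^ 2 / n) := by gcongr; exact le_abs_self _
                  _ = _ := mul_comm _ _
            _ ≤ _ := by rw [← Finset.mul_sum]; gcongr
    _ = _ := by simp; field_simp

end perturb

/-! ### Approximation of the statistics on an event of good control -/

/-- `m` is a shift of `S` by `r` up to a small error, with `D = √d` and `N = √n`. -/
structure ShiftControl {d : ℕ} (B D N : ℝ) (S m r : EuclideanSpace ℝ (Fin d)) : Prop where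
  norm_le : ‖S‖ ≤ B * D
  drift_le : ‖r‖ ≤ B * D
  error_le : ‖m - S - r‖ ≤ B * (D / N)

section close
variable {d : ℕ} {B D N C τ : ℝ} {S m r : EuclideanSpace ℝ (Fin d)}

theorem ShiftControl.norm_shift_le (h : ShiftControl B D N S m r) (hB : 0 ≤ B) (hD : 1 ≤ D)
    (hN : 1 ≤ N) : ‖m‖ ≤ 3 * B * D := by
  have h1 : B * (D / N) ≤ B * D := by
    gcongr
    exact div_le_self (by linarith) hN
  calc ‖m‖ = ‖S + r + (m - S - r)‖ := by congr 1; abel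
    _ ≤ ‖S‖ + ‖r‖ + ‖m - S - r‖ := norm_add₃_le
    _ ≤ _ := by linarith [h.norm_le, h.drift_le, h.error_le]

/-- The drift costs B²C, absorbed by 1 ≤ τD; the error costs 4CB²D²/N, absorbed by D⁴ ≤ τN. Together
they give the factor 5. -/
theorem ShiftControl.quadForm_ge (h : ShiftControl B D N S m r) (hB : 0 ≤ B) (hD : 1 ≤ D)
    (hC : 1 ≤ C) (hN : 1 ≤ N) (hDN : D ^ 4 ≤ τ * N) (hDτ : 1 ≤ τ * D)
    {A : Matrix (Fin d) (Fin d) ℝ} (hA : IsElliptic A C)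
    (hr : |inner ℝ r (matOp A S)| ≤ B * ‖r‖) :
    quadForm A S - 5 * C * B ^ 2 * τ * D ≤ quadForm A m := by
  have h1 := hA.quadForm_shift_ge hC (e := m - S - r) hr
  have hm : S + r + (m - S - r) = m := by abel
  rw [hm] at h1
  have h2 : ‖S + r‖ ≤ 2 * B * D := by
    linarith [norm_add_le S r, h.norm_le, h.drift_le]
  have hN0 : 0 < N := by linarith
  have hτ : 0 ≤ τ := by
    by_contra hneg
    nlinarith
  have h3 : 2 * C * ‖m - S - r‖ * ‖S + r‖ ≤ 4 * C * B ^ 2 * τ * D := by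
    calc 2 * C * ‖m - S - r‖ * ‖S + r‖ ≤ 2 * C * (B * (D / N)) * (2 * B * D) := by
          gcongr; exact h.error_le
      _ = 4 * C * B ^ 2 * (D ^ 2 / N) := by ring
      _ ≤ 4 * C * B ^ 2 * (τ * D) := by
          gcongr
          rw [div_le_iff₀ hN0]
          calc D ^ 2 ≤ D ^ 4 := pow_le_pow_right₀ hD (by norm_num)
            _ ≤ τ * N := hDN
            _ ≤ τ * D * N := by
              rw [mul_assoc]
              gcongr
              nlinarith
      _ = _ := by ring
  have h4 : B ^ 2 * C ≤ C * B ^ 2 * τ * D := by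
    calc B ^ 2 * C = B ^ 2 * C * 1 := by ring
      _ ≤ B ^ 2 * C * (τ * D) := by gcongr
      _ = _ := by ring
  linarith

/-- Minimality gives the upper side and `ShiftControl.quadForm_ge` the lower one. Exchanging the
weighting matrices costs (τ/D) · O(D²) = O(τD), which is why d^{-1/2} is the relevant rate for the
weighting matrix. -/
theorem ShiftControl.abs_gmm_sub_le (h : ShiftControl B D N S m r) (hB : 0 ≤ B) (hD : 1 ≤ D)
    (hC : 1 ≤ C) (hN : 1 ≤ N) (hτ : 0 < τ) (hDN : D ^ 4 ≤ τ * N) (hDτ : 1 ≤ τ * D)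
    {A A' : Matrix (Fin d) (Fin d) ℝ} (hA : IsElliptic A C)
    (hr : |inner ℝ r (matOp A S)| ≤ B * ‖r‖)
    (hA' : matrixOpNorm (A' - A) ≤ ENNReal.ofReal (τ * D⁻¹))
    (hmin : quadForm A' m ≤ quadForm A' S) :
    |quadForm A' m - quadForm A S| ≤ (5 * C * B ^ 2 + 9 * B ^ 2) * τ * D := by
  have hD0 : 0 < D := by linarith
  have h1 := (abs_le.1 (abs_quadForm_sub_le (by positivity) hA' m)).1
  have h2 := (abs_le.1 (abs_quadForm_sub_le (by positivity) hA' S)).2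
  have h3 := h.quadForm_ge hB hD hC hN hDN hDτ hA hr
  have h4 : τ * D⁻¹ * ‖m‖ ^ 2 ≤ 9 * B ^ 2 * τ * D := by
    calc τ * D⁻¹ * ‖m‖ ^ 2 ≤ τ * D⁻¹ * (3 * B * D) ^ 2 := by
          gcongr; exact h.norm_shift_le hB hD hN
      _ = _ := by field_simp; ring
  have h5 : τ * D⁻¹ * ‖S‖ ^ 2 ≤ B ^ 2 * τ * D := by
    calc τ * D⁻¹ * ‖S‖ ^ 2 ≤ τ * D⁻¹ * (B * D) ^ 2 := by
          gcongr; exact h.norm_le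
      _ = _ := by field_simp
  have h6 : 0 ≤ B ^ 2 * τ * D := by positivity
  have h7 : 0 ≤ 5 * C * B ^ 2 * τ * D := by positivity
  exact abs_le.2 ⟨by linarith, by linarith⟩

/-- A sandwich: the criterion for `v₁` is at most that for `v₀`, which is bounded by its vertex
value, and at least its own vertex value, which the shift comparison brings back to `v₀`. The
threshold τ₀ is chosen before n and d. -/
theorem ShiftControl.abs_gelStatistic_sub_lt {s : ℝ → ℝ} {𝒱 : Set ℝ} {K ρ ε : ℝ} (hK : 0 ≤ K)
    (hρ : 0 < ρ)
    (hT : ∀ t : ℝ, |t| ≤ ρ → t ∈ 𝒱 ∧ |s t - s 0 + t + t ^ 2 / 2| ≤ K * |t| ^ 3)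
    (hs : ConcaveOn ℝ 𝒱 s) (hB : 0 ≤ B) (hC : 1 ≤ C) (hε : 0 < ε) :
    ∃ τ₀ : ℝ, 0 < τ₀ ∧ ∀ τ : ℝ, 0 < τ → τ ≤ τ₀ → ∀ (n d : ℕ) (D N : ℝ)
      (Ω : Matrix (Fin d) (Fin d) ℝ) (v₀ v₁ : Fin n → EuclideanSpace ℝ (Fin d))
      (r : EuclideanSpace ℝ (Fin d)), 0 < n → D = Real.sqrt d → N = Real.sqrt n → 1 ≤ D →
      D ^ 4 ≤ τ * N → 1 ≤ τ * D → IsElliptic Ω C → IsElliptic Ω⁻¹ C → IsUnit Ω →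
      MomentControl Ω B v₀ → MomentControl Ω B v₁ →
      ShiftControl B D N (scaledSum v₀) (scaledSum v₁) r →
      |inner ℝ r (matOp Ω⁻¹ (scaledSum v₀))| ≤ B * ‖r‖ →
      gelCriterion s 𝒱 v₁ ≤ gelCriterion s 𝒱 v₀ →
      (gelStatistic s 𝒱 v₁ - (quadForm Ω⁻¹ (scaledSum v₀) : EReal)).abs <
        ENNReal.ofReal (ε * D) := by
  set c : ℝ → ℝ := fun L => K * (C * L ^ 2 + B * L ^ 2) + K * (L ^ 4 * B) + B * L ^ 2 / 2 with hc
  set L₁ := 2 * C * (B + 1) with hL₁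
  -- The radius needed to contain the vertex multiplier of `v₁`: its scaled sum is at most 3BD and
  -- Ω⁻¹ stretches by at most C.
  set L₂ := 3 * B * C with hL₂
  have hL₁0 : 0 < L₁ := by positivity
  have hc0 : ∀ L, 0 ≤ c L := fun L => by positivity
  -- Each condition is a strict inequality, continuous in τ and true at τ = 0.
  have hev : ∀ᶠ τ in 𝓝 (0 : ℝ), τ < 1 ∧ L₁ ^ 4 * B * τ ^ 2 < ρ ^ 4 ∧ L₂ ^ 4 * B * τ ^ 2 < ρ ^ 4 ∧
      τ * c L₁ < L₁ ∧ τ * (2 * c L₁ + 2 * c L₂ + 5 * C * B ^ 2) < ε := by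
    have hlt : ∀ (f : ℝ → ℝ) (b : ℝ), Continuous f → f 0 < b → ∀ᶠ τ in 𝓝 (0 : ℝ), f τ < b :=
      fun f b hf h0 => hf.continuousAt.eventually_lt continuousAt_const h0
    refine (hlt _ _ continuous_id (by simp)).and ((hlt _ _ (by fun_prop) ?_).and
      ((hlt _ _ (by fun_prop) ?_).and ((hlt _ _ (by fun_prop) ?_).and
      (hlt _ _ (by fun_prop) ?_)))) <;> simp <;> positivity
  obtain ⟨η, hη, hball⟩ := Metric.eventually_nhds_iff.1 hev
  refine ⟨η / 2, by positivity, ?_⟩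
  intro τ hτ hτη n d D N Ω v₀ v₁ r hn hDd hNn hD hDN hDτ hΩ hΩi hu hv₀ hv₁ hshift hr hcrit
  obtain ⟨hτ1, hρ1, hρ2, hτL, hτε⟩ := hball (y := τ) (by
    rw [Real.dist_eq, sub_zero, abs_of_pos hτ]; linarith)
  have hn1 : (1 : ℝ) ≤ n := by exact_mod_cast hn
  have hN1 : 1 ≤ N := by rw [hNn]; exact Real.one_le_sqrt.2 hn1
  have hN2 : N ^ 2 = n := by rw [hNn, Real.sq_sqrt (by linarith)]
  have hD2 : D ^ 2 = d := by rw [hDd, Real.sq_sqrt (by positivity)]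
  have hfour : ∀ {v : Fin n → EuclideanSpace ℝ (Fin d)}, MomentControl Ω B v →
      ∑ i, ‖v i‖ ^ 4 ≤ B * N ^ 2 * D ^ 4 := fun hv => by
    rw [hN2, show D ^ 4 = (D ^ 2) ^ 2 by ring, hD2]; exact hv.fourth
  have htwo : ∀ {v : Fin n → EuclideanSpace ℝ (Fin d)}, MomentControl Ω B v → ∀ l,
      |∑ i, inner ℝ l (v i) ^ 2 - n * quadForm Ω l| ≤ B * N * D ^ 2 * ‖l‖ ^ 2 := fun hv l => by
    rw [hNn, hD2]; exact hv.second l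
  have hexp : ∀ {v : Fin n → EuclideanSpace ℝ (Fin d)} (L : ℝ), MomentControl Ω B v →
      L ^ 4 * B * τ ^ 2 < ρ ^ 4 → ∀ l : EuclideanSpace ℝ (Fin d), ‖l‖ ≤ L * (D / N) →
      l ∈ gelMultipliers 𝒱 v ∧ |gelObjective s v l -
        (n * s 0 - N * inner ℝ l (scaledSum v) - n / 2 * quadForm Ω l)| ≤ τ * c L * D :=
    fun L hv hL l hl => gelObjective_expansion hK hρ hT hn hD hNn hτ hτ1.le hB (by linarith) hDN
      hΩ.quadForm_le (hfour hv) (htwo hv) hL.le hl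
  have h0 : (0 : ℝ) ∈ 𝒱 := (hT 0 (by simpa using hρ.le)).1
  have hup : ∀ l ∈ gelMultipliers 𝒱 v₀, gelObjective s v₀ l ≤
      n * s 0 + quadForm Ω⁻¹ (scaledSum v₀) / 2 + τ * c L₁ * D := fun l hl =>
    gelObjective_le hs h0 hn hC hΩ hu hNn hD hB hshift.norm_le hL₁
      (calc τ * c L₁ * D ≤ L₁ * D := by gcongr
        _ ≤ L₁ * D ^ 2 := by gcongr; nlinarith) (mul_nonneg (mul_nonneg hτ.le (hc0 _)) (by linarith))
      (hexp L₁ hv₀ hρ1) hl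
  obtain ⟨l, hl, hlow⟩ := exists_le_gelObjective (C := C) hn hu hΩi hNn (by
    calc C * ‖scaledSum v₁‖ ≤ C * (3 * B * D) := by
          gcongr; exact hshift.norm_shift_le hB hD hN1
      _ = L₂ * D := by rw [hL₂]; ring) (hexp L₂ hv₁ hρ2)
  have hq := hshift.quadForm_ge hB hD hC hN1 hDN hDτ hΩi hr
  have hcD : ∀ L, 0 ≤ τ * c L * D := fun L =>
    mul_nonneg (mul_nonneg hτ.le (hc0 _)) (by linarith)
  have hCD : 0 ≤ 5 * C * B ^ 2 * τ * D := by positivity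
  refine _root_.abs_gelStatistic_sub_lt
    (δ := τ * (2 * c L₁ + 2 * c L₂ + 5 * C * B ^ 2) * D) (by gcongr) ?_ ?_
  · refine hcrit.trans (iSup₂_le fun l hl => EReal.coe_le_coe_iff.2 ((hup l hl).trans ?_))
    have := hcD L₂
    linarith
  · refine le_trans (EReal.coe_le_coe_iff.2 ?_)
      (le_iSup₂ (f := fun l (_ : l ∈ gelMultipliers 𝒱 v₁) => (gelObjective s v₁ l : EReal)) l hl)
    refine le_trans ?_ hlow
    have := hcD L₁
    linarith

end close

/-! ### Deterministic control from finitely many moments -/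

theorem MomentControl.mono {n d : ℕ} {Ω : Matrix (Fin d) (Fin d) ℝ} {B B' : ℝ}
    {v : Fin n → EuclideanSpace ℝ (Fin d)} (h : MomentControl Ω B v) (hB : B ≤ B') :
    MomentControl Ω B' v :=
  ⟨h.fourth.trans (by gcongr), fun l => (h.second l).trans (by gcongr)⟩

/-- The controls needed for the statistics follow from bounds on finitely many moments of the
array. -/
theorem exists_control (q : ℕ) {M R K : ℝ} (hM : 1 ≤ M) (hR : 0 ≤ R) (hK : 0 ≤ K) :
    ∃ B : ℝ, 0 ≤ B ∧ ∀ (n d : ℕ) (Ω A : Matrix (Fin d) (Fin d) ℝ) (w : Fin n → ℝ)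
      (y z : Fin n → EuclideanSpace ℝ (Fin d)) (D : Fin n → Fin q → EuclideanSpace ℝ (Fin d))
      (G : Fin q → EuclideanSpace ℝ (Fin d)) (δ : Fin n → ℝ) (u : EuclideanSpace ℝ (Fin q)),
      0 < n → 1 ≤ d → (∀ i, |w i| ≤ K) → ‖u‖ ≤ R / Real.sqrt n →
      (∀ i, ‖z i - y i - ∑ j, u j • D i j‖ ≤ δ i * ‖u‖ ^ 2) →
      (∑ i, ‖y i‖ ^ 4) / (n * (d : ℝ) ^ 2) ≤ M →
      (∑ i, ∑ j, ‖D i j‖ ^ 2) / (n * d) ≤ M →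
      (∑ i, δ i ^ 2) / (n * d) ≤ M →
      ‖scaledSum fun i => w i • y i‖ ^ 2 / d ≤ M →
      (∑ j, ‖scaledSum fun i => w i • D i j - G j‖ ^ 2) / d ≤ M →
      ‖∑ i, (w i ^ 2 • outerVec (y i) - matVec Ω)‖ ^ 2 / (n * (d : ℝ) ^ 2) ≤ M →
      ‖(Submodule.span ℝ (Set.range G)).starProjection
        (matOp A (scaledSum fun i => w i • y i))‖ ^ 2 ≤ M →
      (∀ j, ‖G j‖ ≤ M * Real.sqrt d) →
      MomentControl Ω B (fun i => w i • y i) ∧ MomentControl Ω B (fun i => w i • z i) ∧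
      ∃ r, ShiftControl B (Real.sqrt d) (Real.sqrt n) (scaledSum fun i => w i • y i)
        (scaledSum fun i => w i • z i) r ∧
        |inner ℝ r (matOp A (scaledSum fun i => w i • y i))| ≤ B * ‖r‖ := by
  have hM0 : 0 ≤ M := by linarith
  set H := 2 * R ^ 2 * (q * M) + 2 * R ^ 4 * M with hHdef
  have hH : 0 ≤ H := by positivity
  set B₁ := K ^ 4 * (8 * (M + H ^ 2)) + M + K ^ 2 * (1 + M + 2 * H) with hB₁
  have hB₁0 : 0 ≤ B₁ := by positivity
  have hqR : 0 ≤ q * R * M := by positivity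
  have hKR : 0 ≤ K * R ^ 2 * M := by positivity
  refine ⟨B₁ + M + q * R * M + K * R ^ 2 * M, by positivity, ?_⟩
  intro n d Ω A w y z D G δ u hn hd hw hu hrem h4 hD hδ hS hG h6 h7 hGn
  have hn' : (0 : ℝ) < n := by exact_mod_cast hn
  have hd' : (0 : ℝ) < d := by exact_mod_cast hd
  have hN0 : 0 < Real.sqrt n := Real.sqrt_pos.2 hn'
  have hMM : M ≤ M ^ 2 := by nlinarith
  rw [div_le_iff₀ (by positivity)] at h4 hD hδ hS hG h6
  rw [← mul_assoc] at h4 hD hδ h6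
  have h2 : ∀ l, |∑ i, inner ℝ l (w i • y i) ^ 2 - n * quadForm Ω l| ≤
      M * Real.sqrt n * d * ‖l‖ ^ 2 := fun l => by
    refine (abs_sum_inner_sq_sub_le Ω w y l).trans ?_
    gcongr
    refine abs_le_of_sq_le_sq' (h6.trans ?_) (by positivity) |>.2
    rw [mul_pow, mul_pow, Real.sq_sqrt hn'.le]
    gcongr
  have hyz := sum_norm_sub_sq_le hn hM0 hu hrem hD hδ
  -- The unperturbed array is the case of zero displacement, so one constant covers both arrays.
  refine ⟨(MomentControl.perturb hn hd hM0 hw h4 h2 (z := y) (H := H)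
    (by simpa using mul_nonneg hH hd'.le)).mono (by linarith),
    (MomentControl.perturb hn hd hM0 hw h4 h2 hyz).mono (by linarith),
    ∑ j, (Real.sqrt n * u j) • G j, ⟨?_, ?_, ?_⟩, ?_⟩
  · refine le_trans (abs_le_of_sq_le_sq' (b := M * Real.sqrt d) (hS.trans ?_) (by positivity)).2 ?_
    · rw [mul_pow, Real.sq_sqrt hd'.le]; gcongr
    · gcongr; linarith
  · calc ‖∑ j, (Real.sqrt n * u j) • G j‖ ≤ ∑ _j : Fin q, R * (M * Real.sqrt d) := by
          refine (norm_sum_le _ _).trans (Finset.sum_le_sum fun j _ => ?_)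
          rw [norm_smul]
          gcongr
          · rw [norm_mul, Real.norm_of_nonneg hN0.le, mul_comm]
            exact (le_div_iff₀ hN0).1 ((PiLp.norm_apply_le u j).trans hu)
          · exact hGn j
      _ = q * R * M * Real.sqrt d := by simp; ring
      _ ≤ _ := by gcongr; linarith
  · refine (norm_scaledSum_sub_sub_le hn hM hR hK hw hu hrem hδ fun j => ?_).trans ?_
    · exact (Finset.single_le_sum (f := fun j => ‖scaledSum fun i => w i • D i j - G j‖ ^ 2)
        (fun j _ => by positivity) (Finset.mem_univ j)).trans hG
    · gcongr; linarith
  · set r := ∑ j, (Real.sqrt n * u j) • G j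
    set V := Submodule.span ℝ (Set.range G)
    have hr : r ∈ V := Submodule.sum_mem _ fun j _ => Submodule.smul_mem _ _
      (Submodule.subset_span ⟨j, rfl⟩)
    set a := matOp A (scaledSum fun i => w i • y i)
    -- The drift lies in V, so only the projection of A S onto V matters; that projection is bounded
    -- although A S is not.
    have e1 : inner ℝ r a = inner ℝ r (V.starProjection a) := by
      rw [← Submodule.inner_starProjection_left_eq_right, Submodule.starProjection_eq_self_iff.2 hr]
    have e2 : ‖V.starProjection a‖ ≤ M :=
      abs_le_of_sq_le_sq' (h7.trans hMM) hM0 |>.2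
    rw [e1]
    calc _ ≤ ‖r‖ * ‖V.starProjection a‖ := abs_real_inner_le_norm _ _
      _ ≤ ‖r‖ * (B₁ + M + q * R * M + K * R ^ 2 * M) := by gcongr; linarith
      _ = _ := mul_comm _ _

/-- Moments of a triangular array `y` with derivative array `D` and Lipschitz array `δ` that are
stochastically bounded at the appropriate scale; `G` is the mean of `D`. -/
structure TightArrays {S : Type*} [MeasurableSpace S] (μ : Measure S)
    (κ : ∀ n : ℕ, Kernel S (Fin n → ℝ)) (d : ℕ → ℕ) (q : ℕ) (K : ℝ)
    (Ω A : ∀ n, Matrix (Fin (d n)) (Fin (d n)) ℝ)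
    (y : ∀ n, S → Fin n → EuclideanSpace ℝ (Fin (d n)))
    (D : ∀ n, S → Fin n → Fin q → EuclideanSpace ℝ (Fin (d n)))
    (δ : ∀ n, S → Fin n → ℝ) (G : ∀ n, Fin q → EuclideanSpace ℝ (Fin (d n))) : Prop where
  weight : ∀ n, ∀ᵐ x ∂μ, ∀ᵐ w ∂(κ n x), ∀ i, |w i| ≤ K
  fourth : BootTight μ κ fun n x _ =>
    ENNReal.ofReal ((∑ i, ‖y n x i‖ ^ 4) / (n * (d n : ℝ) ^ 2))
  deriv : BootTight μ κ fun n x _ =>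
    ENNReal.ofReal ((∑ i, ∑ j, ‖D n x i j‖ ^ 2) / (n * d n))
  lip : BootTight μ κ fun n x _ => ENNReal.ofReal ((∑ i, δ n x i ^ 2) / (n * d n))
  sum : BootTight μ κ fun n x w =>
    ENNReal.ofReal (‖scaledSum fun i => w i • y n x i‖ ^ 2 / d n)
  derivSum : BootTight μ κ fun n x w =>
    ENNReal.ofReal ((∑ j, ‖scaledSum fun i => w i • D n x i j - G n j‖ ^ 2) / d n)
  outer : BootTight μ κ fun n x w => ENNReal.ofReal
    (‖∑ i, (w i ^ 2 • outerVec (y n x i) - matVec (Ω n))‖ ^ 2 / (n * (d n : ℝ) ^ 2))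
  proj : BootTight μ κ fun n x w => ENNReal.ofReal
    (‖(Submodule.span ℝ (Set.range (G n))).starProjection
        (matOp (A n) (scaledSum fun i => w i • y n x i))‖ ^ 2)
  drift : ∃ B : ℝ, ∀ᶠ n in atTop, ∀ j, ‖G n j‖ ≤ B * Real.sqrt (d n)

/-! ### From tight arrays to the stochastic expansions -/

section stat
variable {S : Type*} [MeasurableSpace S] {μ : Measure S} {κ : ∀ n : ℕ, Kernel S (Fin n → ℝ)}
  {d : ℕ → ℕ} {q : ℕ} {K : ℝ} {Ω A : ∀ n, Matrix (Fin (d n)) (Fin (d n)) ℝ}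
  {y : ∀ n, S → Fin n → EuclideanSpace ℝ (Fin (d n))}
  {D : ∀ n, S → Fin n → Fin q → EuclideanSpace ℝ (Fin (d n))}
  {δ : ∀ n, S → Fin n → ℝ} {G : ∀ n, Fin q → EuclideanSpace ℝ (Fin (d n))}

theorem TightArrays.likely_control (h : TightArrays μ κ d q K Ω A y D δ G) (hK : 0 ≤ K)
    (hd : Tendsto d atTop atTop)
    {z : ∀ n, S → (Fin n → ℝ) → Fin n → EuclideanSpace ℝ (Fin (d n))}
    {u : ∀ n, S → (Fin n → ℝ) → EuclideanSpace ℝ (Fin q)}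
    (hu : IsBigOInBootProb μ κ (fun n x w => ‖u n x w‖ₑ) fun n => (Real.sqrt n)⁻¹)
    {ρ : ℝ} (hρ : 0 < ρ)
    (hrem : ∀ n, ∀ᵐ x ∂μ, ∀ w, ‖u n x w‖ < ρ → ∀ i,
      ‖z n x w i - y n x i - ∑ j, u n x w j • D n x i j‖ ≤ δ n x i * ‖u n x w‖ ^ 2)
    {ε : ℝ} (hε : 0 < ε) :
    ∃ B : ℝ, 0 ≤ B ∧ ∀ᶠ n in atTop, BootLikely μ (κ n) ε fun x w =>
      MomentControl (Ω n) B (fun i => w i • y n x i) ∧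
      MomentControl (Ω n) B (fun i => w i • z n x w i) ∧
      ∃ r, ShiftControl B (Real.sqrt (d n)) (Real.sqrt n) (scaledSum fun i => w i • y n x i)
        (scaledSum fun i => w i • z n x w i) r ∧
        |inner ℝ r (matOp (A n) (scaledSum fun i => w i • y n x i))| ≤ B * ‖r‖ := by
  -- The seven quantities are nonnegative, so one bound on their sum bounds each of them on a single
  -- likely event.
  obtain ⟨M, hM, hMn⟩ := (h.fourth.add (h.deriv.add (h.lip.add (h.sum.add (h.derivSum.add
    (h.outer.add h.proj)))))).likely (half_pos hε)
  obtain ⟨R, hR, hRn⟩ := hu.likely (half_pos hε)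
  obtain ⟨Bg, hBg⟩ := h.drift
  obtain ⟨B, hB, hcontrol⟩ := exists_control q (M := max 1 (max M Bg)) (le_max_left _ _) hR.le hK
  refine ⟨B, hB, ?_⟩
  -- Eventually the estimator is within the radius where the Taylor bound is available.
  have hRρ : ∀ᶠ n : ℕ in atTop, R / Real.sqrt n < ρ :=
    ((tendsto_const_nhds.div_atTop (Real.tendsto_sqrt_atTop.comp
      tendsto_natCast_atTop_atTop)).eventually_lt_const hρ)
  filter_upwards [hMn, hRn, hBg, hRρ, eventually_gt_atTop 0, hd.eventually_ge_atTop 1]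
    with n hM' hR' hBg' hρ' hn hdn
  refine (hM'.and (half_pos hε).le (half_pos hε).le hR').mono (add_halves ε).le ?_
  filter_upwards [h.weight n, hrem n] with x hw hx
  filter_upwards [hw] with w hw ⟨hF, hU⟩
  have hu' : ‖u n x w‖ ≤ R / Real.sqrt n := by
    rw [← ofReal_norm, ← div_eq_mul_inv] at hU
    exact (ENNReal.ofReal_le_ofReal_iff (by positivity)).1 hU.le
  have hle : ∀ a : ℝ, ENNReal.ofReal a ≤ ENNReal.ofReal M → a ≤ max 1 (max M Bg) := fun a ha =>
    ((ENNReal.ofReal_le_ofReal_iff hM.le).1 ha).trans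
      ((le_max_left _ _).trans (le_max_right _ _))
  have f1 := le_self_add.trans hF
  have g1 := le_add_self.trans hF
  have f2 := le_self_add.trans g1
  have g2 := le_add_self.trans g1
  have f3 := le_self_add.trans g2
  have g3 := le_add_self.trans g2
  have f4 := le_self_add.trans g3
  have g4 := le_add_self.trans g3
  have f5 := le_self_add.trans g4
  have g5 := le_add_self.trans g4
  have f6 := le_self_add.trans g5
  have f7 := le_add_self.trans g5
  exact hcontrol n (d n) (Ω n) (A n) w (y n x) (z n x w) (D n x) (G n) (δ n x) (u n x w) hn hdn hw
    hu' (hx w (hu'.trans_lt hρ')) (hle _ f1) (hle _ f2) (hle _ f3) (hle _ f4) (hle _ f5)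
    (hle _ f6) (hle _ f7) fun j => (hBg' j).trans (by
      gcongr; exact (le_max_right _ _).trans (le_max_right _ _))

/-- The bound d² ≤ τ√n is the square root of d⁴ ≤ τ²n, and d⁴ ≤ d^p as soon as d ≥ 1. -/
theorem eventually_rates (hd : Tendsto d atTop atTop) {p : ℝ} (hp : 4 ≤ p)
    (hgrowth : Tendsto (fun n : ℕ => (d n : ℝ) ^ p / (n : ℝ)) atTop (𝓝 0)) {τ : ℝ} (hτ : 0 < τ) :
    ∀ᶠ n : ℕ in atTop, 0 < n ∧ 1 ≤ Real.sqrt (d n) ∧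
      Real.sqrt (d n) ^ 4 ≤ τ * Real.sqrt n ∧ 1 ≤ τ * Real.sqrt (d n) := by
  have hsd : Tendsto (fun n => Real.sqrt (d n)) atTop atTop :=
    Real.tendsto_sqrt_atTop.comp (tendsto_natCast_atTop_atTop.comp hd)
  filter_upwards [eventually_gt_atTop 0, hsd.eventually_ge_atTop 1,
    hgrowth.eventually_lt_const (show 0 < τ ^ 2 by positivity), hsd.eventually_ge_atTop τ⁻¹,
    hd.eventually_ge_atTop 1] with n hn h1 h2 h3 hd1
  refine ⟨hn, h1, ?_, ?_⟩
  · have hn' : (0 : ℝ) < n := by exact_mod_cast hn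
    have hd' : (1 : ℝ) ≤ d n := by exact_mod_cast hd1
    rw [div_lt_iff₀ hn'] at h2
    have h4 : (d n : ℝ) ^ 4 ≤ (d n : ℝ) ^ p := by
      rw [← Real.rpow_natCast]
      exact Real.rpow_le_rpow_of_exponent_le hd' (by exact_mod_cast hp)
    refine abs_le_of_sq_le_sq' ?_ (by positivity) |>.2
    rw [mul_pow, Real.sq_sqrt hn'.le]
    calc (Real.sqrt (d n) ^ 4) ^ 2 = (Real.sqrt (d n) ^ 2) ^ 4 := by ring
      _ = (d n : ℝ) ^ 4 := by rw [Real.sq_sqrt (by positivity)]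
      _ ≤ _ := h4.trans h2.le
  · calc (1 : ℝ) = τ * τ⁻¹ := (mul_inv_cancel₀ hτ.ne').symm
      _ ≤ _ := by gcongr

variable {v₀ v₁ : ∀ n, S → (Fin n → ℝ) → Fin n → EuclideanSpace ℝ (Fin (d n))}

theorem isLittleO_gmm {C : ℝ} (hC : 1 ≤ C) (hA : ∀ n, IsElliptic (A n) C)
    (hrates : ∀ τ : ℝ, 0 < τ → ∀ᶠ n : ℕ in atTop, 0 < n ∧ 1 ≤ Real.sqrt (d n) ∧
      Real.sqrt (d n) ^ 4 ≤ τ * Real.sqrt n ∧ 1 ≤ τ * Real.sqrt (d n))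
    (hcontrol : ∀ ε : ℝ, 0 < ε → ∃ B : ℝ, 0 ≤ B ∧ ∀ᶠ n in atTop, BootLikely μ (κ n) ε fun x w =>
      ∃ r, ShiftControl B (Real.sqrt (d n)) (Real.sqrt n) (scaledSum (v₀ n x w))
        (scaledSum (v₁ n x w)) r ∧
        |inner ℝ r (matOp (A n) (scaledSum (v₀ n x w)))| ≤ B * ‖r‖)
    {A' : ∀ n, S → Matrix (Fin (d n)) (Fin (d n)) ℝ}
    (hA' : IsLittleOInProb μ (fun n ω => matrixOpNorm (A' n ω - A n))
      (fun n => (Real.sqrt (d n))⁻¹))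
    (hmin : ∀ n, ∀ᵐ x ∂μ, ∀ᵐ w ∂(κ n x),
      gmmCriterion (A' n x) (v₁ n x w) ≤ gmmCriterion (A' n x) (v₀ n x w)) :
    IsLittleOInBootProb μ κ (fun n x w => ‖gmmStatistic (A' n x) (v₁ n x w)
      - quadForm (A n) (scaledSum (v₀ n x w))‖ₑ) (fun n => Real.sqrt (d n)) := by
  refine IsLittleOInBootProb.of_likely fun ε hε => ?_
  obtain ⟨B, hB, hBn⟩ := hcontrol (ε / 2) (half_pos hε)
  set c := 5 * C * B ^ 2 + 9 * B ^ 2 with hc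
  have hc0 : 0 ≤ c := by positivity
  -- Chosen so that cτ < ε.
  set τ := ε / (c + 1) with hτdef
  have hτ : 0 < τ := by positivity
  filter_upwards [hBn, hA'.likely (κ := κ) (fun n => by positivity) (half_pos hε) hτ, hrates τ hτ]
    with n h1 h2 ⟨hn, hD, hDN, hDτ⟩
  refine (h1.and (half_pos hε).le (half_pos hε).le h2).mono (add_halves ε).le ?_
  filter_upwards [hmin n] with x hx
  filter_upwards [hx] with w hw ⟨⟨r, hshift, hr⟩, hAx⟩
  have hn1 : (1 : ℝ) ≤ n := by exact_mod_cast hn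
  have hq : quadForm (A' n x) (scaledSum (v₁ n x w)) ≤
      quadForm (A' n x) (scaledSum (v₀ n x w)) := by
    rw [← gmmStatistic_eq hn, ← gmmStatistic_eq hn]
    exact mul_le_mul_of_nonneg_left hw (by positivity)
  have h := hshift.abs_gmm_sub_le hB hD hC (Real.one_le_sqrt.2 hn1) hτ hDN hDτ (hA n) hr hAx.le hq
  rw [gmmStatistic_eq hn, ← ofReal_norm, Real.norm_eq_abs]
  have hlt : c * τ * Real.sqrt (d n) < ε * Real.sqrt (d n) := by
    have : c * τ < ε := by
      rw [hτdef, ← mul_div_assoc, div_lt_iff₀ (by positivity)]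
      nlinarith
    gcongr
  exact (ENNReal.ofReal_lt_ofReal_iff ((abs_nonneg _).trans_lt (h.trans_lt hlt))).2
    (h.trans_lt hlt)

theorem isLittleO_gel {s : ℝ → ℝ} {𝒱 : Set ℝ} {L ρ : ℝ} (hL : 0 ≤ L) (hρ : 0 < ρ)
    (hT : ∀ t : ℝ, |t| ≤ ρ → t ∈ 𝒱 ∧ |s t - s 0 + t + t ^ 2 / 2| ≤ L * |t| ^ 3)
    (hs : ConcaveOn ℝ 𝒱 s)
    {C : ℝ} (hC : 1 ≤ C) (hΩ : ∀ n, IsElliptic (Ω n) C)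
    (hΩi : ∀ n, IsElliptic (Ω n)⁻¹ C) (hΩu : ∀ n, IsUnit (Ω n))
    (hrates : ∀ τ : ℝ, 0 < τ → ∀ᶠ n : ℕ in atTop, 0 < n ∧ 1 ≤ Real.sqrt (d n) ∧
      Real.sqrt (d n) ^ 4 ≤ τ * Real.sqrt n ∧ 1 ≤ τ * Real.sqrt (d n))
    (hcontrol : ∀ ε : ℝ, 0 < ε → ∃ B : ℝ, 0 ≤ B ∧ ∀ᶠ n in atTop, BootLikely μ (κ n) ε fun x w =>
      MomentControl (Ω n) B (v₀ n x w) ∧ MomentControl (Ω n) B (v₁ n x w) ∧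
      ∃ r, ShiftControl B (Real.sqrt (d n)) (Real.sqrt n) (scaledSum (v₀ n x w))
        (scaledSum (v₁ n x w)) r ∧
        |inner ℝ r (matOp (Ω n)⁻¹ (scaledSum (v₀ n x w)))| ≤ B * ‖r‖)
    (hmin : ∀ n, ∀ᵐ x ∂μ, ∀ᵐ w ∂(κ n x),
      gelCriterion s 𝒱 (v₁ n x w) ≤ gelCriterion s 𝒱 (v₀ n x w)) :
    IsLittleOInBootProb μ κ (fun n x w => (gelStatistic s 𝒱 (v₁ n x w)
      - (quadForm (Ω n)⁻¹ (scaledSum (v₀ n x w)) : EReal)).abs) (fun n => Real.sqrt (d n)) := by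
  refine IsLittleOInBootProb.of_likely fun ε hε => ?_
  obtain ⟨B, hB, hBn⟩ := hcontrol ε hε
  obtain ⟨τ, hτ, hgel⟩ := ShiftControl.abs_gelStatistic_sub_lt hL hρ hT hs hB hC hε
  filter_upwards [hBn, hrates τ hτ] with n h1 ⟨hn, hD, hDN, hDτ⟩
  refine h1.mono le_rfl ?_
  filter_upwards [hmin n] with x hx
  filter_upwards [hx] with w hw ⟨hv₀, hv₁, r, hshift, hr⟩
  exact hgel τ hτ le_rfl n (d n) _ _ (Ω n) _ _ r hn rfl rfl hD hDN hDτ (hΩ n) (hΩi n) (hΩu n)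
    hv₀ hv₁ hshift hr hw

end stat

theorem ofReal_norm_pow {E : Type*} [SeminormedAddCommGroup E] (v : E) (k : ℕ) :
    ENNReal.ofReal (‖v‖ ^ k) = ‖v‖ₑ ^ k := by
  rw [ENNReal.ofReal_pow (norm_nonneg _), ofReal_norm]

theorem norm_scaledSum_sq {n d : ℕ} (hn : 0 < n) (v : Fin n → EuclideanSpace ℝ (Fin d)) :
    ‖scaledSum v‖ ^ 2 = ‖∑ i, v i‖ ^ 2 / n := by
  have hn' : (0 : ℝ) < n := by exact_mod_cast hn
  rw [scaledSum, norm_smul, mul_pow, norm_inv, Real.norm_of_nonneg (Real.sqrt_nonneg _), inv_pow,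
    Real.sq_sqrt hn'.le, inv_mul_eq_div]

/-! ### Averages and centred sums of i.i.d. observations -/

section iid
variable {S 𝒳 : Type*} [MeasurableSpace S] [MeasurableSpace 𝒳] {μ : Measure S}
  {P : Measure 𝒳} {X : ℕ → S → 𝒳}

theorem lintegral_comp_obs (hXmeas : ∀ i, Measurable (X i)) (hXlaw : ∀ i, μ.map (X i) = P)
    {f : 𝒳 → ℝ≥0∞} (hf : AEMeasurable f P) (i : ℕ) : ∫⁻ x, f (X i x) ∂μ = ∫⁻ x, f x ∂P := by
  rw [← hXlaw i] at hf ⊢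
  exact (lintegral_map' hf (hXmeas i).aemeasurable).symm

theorem aemeasurable_comp_obs (hXmeas : ∀ i, Measurable (X i)) (hXlaw : ∀ i, μ.map (X i) = P)
    {β : Type*} [MeasurableSpace β] {f : 𝒳 → β} (hf : AEMeasurable f P) (i : ℕ) :
    AEMeasurable (fun x => f (X i x)) μ := by
  rw [← hXlaw i] at hf
  exact hf.comp_aemeasurable (hXmeas i).aemeasurable

theorem dataTight_average (hXmeas : ∀ i, Measurable (X i)) (hXlaw : ∀ i, μ.map (X i) = P)
    {φ : ℕ → 𝒳 → ℝ} (hφ : ∀ n, AEMeasurable (φ n) P) (hφ0 : ∀ n x, 0 ≤ φ n x) {a : ℕ → ℝ}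
    {C : ℝ} (ha : ∀ᶠ n in atTop, 0 < a n ∧
      ∫⁻ x, ENNReal.ofReal (φ n x) ∂P ≤ ENNReal.ofReal (C * a n)) :
    DataTight μ fun n x => ENNReal.ofReal ((∑ i : Fin n, φ n (X i x)) / (n * a n)) := by
  refine DataTight.of_lintegral_le (C := C) ?_
  filter_upwards [ha, eventually_gt_atTop 0] with n ⟨han, hint⟩ hn
  have hn' : (0 : ℝ) < n := by exact_mod_cast hn
  have hm : ∀ i : Fin n, AEMeasurable (fun x => φ n (X i x)) μ := fun i =>
    aemeasurable_comp_obs hXmeas hXlaw (hφ n) i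
  have hna : 0 < n * a n := by positivity
  refine ⟨((Finset.aemeasurable_fun_sum _ fun i _ => hm i).div_const _).ennreal_ofReal, ?_⟩
  have h1 : ∀ x, ENNReal.ofReal ((∑ i : Fin n, φ n (X i x)) / (n * a n)) =
      ENNReal.ofReal ((n * a n)⁻¹) * ∑ i : Fin n, ENNReal.ofReal (φ n (X i x)) := fun x => by
    rw [div_eq_inv_mul, ENNReal.ofReal_mul (by positivity),
      ENNReal.ofReal_sum_of_nonneg fun i _ => hφ0 _ _]
  simp only [h1]
  rw [lintegral_const_mul' _ _ ENNReal.ofReal_ne_top,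
    lintegral_finsetSum' _ fun i _ => (hm i).ennreal_ofReal]
  have h2 : ∀ i : Fin n, ∫⁻ x, ENNReal.ofReal (φ n (X i x)) ∂μ ≤ ENNReal.ofReal (C * a n) :=
    fun i => (lintegral_comp_obs hXmeas hXlaw (hφ n).ennreal_ofReal i).le.trans hint
  calc _ ≤ ENNReal.ofReal ((n * a n)⁻¹) * ∑ _i : Fin n, ENNReal.ofReal (C * a n) := by
        gcongr with i; exact h2 i
    _ = ENNReal.ofReal ((n * a n)⁻¹ * (n * (C * a n))) := by
        rw [ENNReal.ofReal_mul (p := (n * a n)⁻¹) (by positivity),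
          ENNReal.ofReal_mul (p := (n : ℝ)) hn'.le,
          ENNReal.ofReal_natCast]
        simp
    _ = ENNReal.ofReal C := by congr 1; field_simp

/-- Centred independent summands are orthogonal, so the squared norm of the sum has mean of order n
a rather than n² a. The dimension of the target may vary with n. -/
theorem dataTight_centred_sum [IsProbabilityMeasure μ] (hXmeas : ∀ i, Measurable (X i)) (hXindep : iIndepFun X μ)
    (hXlaw : ∀ i, μ.map (X i) = P) {ι : ℕ → Type*} [∀ n, Fintype (ι n)]
    {f : ∀ n, 𝒳 → EuclideanSpace ℝ (ι n)} (hf : ∀ n, AEMeasurable (f n) P)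
    {m : ∀ n, EuclideanSpace ℝ (ι n)} (hm : ∀ᶠ n in atTop, ∀ k, ∫ x, f n x k ∂P = m n k)
    {a : ℕ → ℝ} {C : ℝ} (ha : ∀ᶠ n in atTop, 0 < a n ∧
      ∫⁻ x, ‖f n x‖ₑ ^ 2 ∂P ≤ ENNReal.ofReal (C * a n)) :
    DataTight μ fun n x =>
      ENNReal.ofReal (‖∑ i : Fin n, (f n (X i x) - m n)‖ ^ 2 / (n * a n)) := by
  refine DataTight.of_lintegral_le (C := C) ?_
  filter_upwards [ha, hm, eventually_gt_atTop 0] with n ⟨han, hint⟩ hmn hn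
  have hn' : (0 : ℝ) < n := by exact_mod_cast hn
  have hfm : ∀ i : Fin n, AEMeasurable (fun x => f n (X i x)) μ := fun i =>
    aemeasurable_comp_obs hXmeas hXlaw (hf n) i
  have hna : 0 < n * a n := by positivity
  refine ⟨(((Finset.aemeasurable_fun_sum _ fun i _ =>
    (hfm i).sub_const (m n)).norm.pow_const 2).div_const _).ennreal_ofReal, ?_⟩
  have h1 : ∀ x, ENNReal.ofReal (‖∑ i : Fin n, (f n (X i x) - m n)‖ ^ 2 / (n * a n)) =
      ENNReal.ofReal ((n * a n)⁻¹) * ‖∑ i : Fin n, (f n (X i x) - m n)‖ₑ ^ 2 := fun x => by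
    rw [div_eq_inv_mul, ENNReal.ofReal_mul (by positivity), ofReal_norm_pow]
  simp only [h1]
  rw [lintegral_const_mul' _ _ ENNReal.ofReal_ne_top]
  have hind : Pairwise fun i j : Fin n =>
      IndepFun (fun x => f n (X i x)) (fun x => f n (X j x)) μ := fun i j hij =>
    (hXindep.indepFun (fun h => hij (Fin.ext h))).comp₀ (hXmeas i).aemeasurable
      (hXmeas j).aemeasurable (by rw [hXlaw]; exact hf n) (by rw [hXlaw]; exact hf n)
  have hmean : ∀ (i : Fin n) k, ∫ x, f n (X i x) k ∂μ = m n k := fun i k => by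
    have hk : AEMeasurable (fun x => f n x k) (μ.map (X i)) := by
      rw [hXlaw]
      exact (by fun_prop : Measurable fun v : EuclideanSpace ℝ (ι n) => v k).comp_aemeasurable
        (hf n)
    rw [← hmn k, ← hXlaw i, integral_map (hXmeas i).aemeasurable hk.aestronglyMeasurable]
  have h2 : ∀ i : Fin n, ∫⁻ x, ‖f n (X i x)‖ₑ ^ 2 ∂μ ≤ ENNReal.ofReal (C * a n) :=
    fun i => (lintegral_comp_obs hXmeas hXlaw ((hf n).enorm.pow_const 2) i).le.trans hint
  calc _ ≤ ENNReal.ofReal ((n * a n)⁻¹) * ∑ _i : Fin n, ENNReal.ofReal (C * a n) := by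
        gcongr
        exact (lintegral_enorm_sum_sub_integral_sq_le_euclidean hfm hind (fun _ => m n)
          hmean).trans (Finset.sum_le_sum fun i _ => h2 i)
    _ = ENNReal.ofReal ((n * a n)⁻¹ * (n * (C * a n))) := by
        rw [ENNReal.ofReal_mul (p := (n * a n)⁻¹) (by positivity),
          ENNReal.ofReal_mul (p := (n : ℝ)) hn'.le,
          ENNReal.ofReal_natCast]
        simp
    _ = ENNReal.ofReal C := by congr 1; field_simp

end iid

/-! ### Weighted sums conditionally on the data -/

section weights
variable {S : Type*} [MeasurableSpace S] {μ : Measure S} {κ : ∀ n : ℕ, Kernel S (Fin n → ℝ)}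

/-- Given the data, the vectors `c i` are constants and only the weights are random. The cases used
are φ(t) = t with mean 0 and φ(t) = t² with mean 1. -/
theorem lintegral_weighted_sum_sq_le {n : ℕ} {ν : Measure (Fin n → ℝ)} [IsProbabilityMeasure ν]
    (hind : iIndepFun (fun (i : Fin n) (w : Fin n → ℝ) => w i) ν) {φ : ℝ → ℝ} (hφ : Measurable φ)
    {m K : ℝ} (hmean : ∀ i, ∫ w, φ (w i) ∂ν = m) (hbdd : ∀ᵐ w ∂ν, ∀ i, |φ (w i)| ≤ K)
    {ι : Type*} [Fintype ι] (c : Fin n → EuclideanSpace ℝ ι) :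
    ∫⁻ w, ‖∑ i, (φ (w i) - m) • c i‖ₑ ^ 2 ∂ν ≤ ENNReal.ofReal (K ^ 2 * ∑ i, ‖c i‖ ^ 2) := by
  have hm : ∀ i, Measurable fun w : Fin n → ℝ => φ (w i) • c i := fun i =>
    (hφ.comp (measurable_pi_apply i)).smul_const _
  have h := lintegral_enorm_sum_sub_integral_sq_le_euclidean (ν := ν)
    (Y := fun i w => φ (w i) • c i) (fun i => (hm i).aemeasurable)
    (fun i j hij => (hind.indepFun hij).comp (φ := fun t => φ t • c i) (ψ := fun t => φ t • c j)
      (hφ.smul_const _) (hφ.smul_const _)) (fun i => m • c i) (fun i k => by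
        simp only [PiLp.smul_apply, smul_eq_mul]
        rw [integral_mul_const, hmean])
  simp only [← sub_smul] at h
  refine h.trans ?_
  rw [Finset.mul_sum, ENNReal.ofReal_sum_of_nonneg fun i _ => by positivity]
  refine Finset.sum_le_sum fun i _ => ?_
  calc ∫⁻ w, ‖φ (w i) • c i‖ₑ ^ 2 ∂ν ≤ ∫⁻ _w, ENNReal.ofReal (K ^ 2 * ‖c i‖ ^ 2) ∂ν := by
        refine lintegral_mono_ae ?_
        filter_upwards [hbdd] with w hw
        rw [← ofReal_norm_pow, norm_smul, mul_pow]
        gcongr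
        exact hw i
    _ = _ := by simp

/-- Conditionally centred weighted sums are bounded in conditional probability. -/
theorem bootTight_weighted_sum [∀ n, IsMarkovKernel (κ n)]
    (hind : ∀ n, ∀ᵐ x ∂μ, iIndepFun (fun (i : Fin n) (w : Fin n → ℝ) => w i) (κ n x))
    {φ : ℝ → ℝ} (hφ : Measurable φ) {m K : ℝ}
    (hmean : ∀ n, ∀ᵐ x ∂μ, ∀ i, ∫ w, φ (w i) ∂(κ n x) = m)
    (hbdd : ∀ n, ∀ᵐ x ∂μ, ∀ᵐ w ∂(κ n x), ∀ i, |φ (w i)| ≤ K)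
    {ι : ℕ → Type*} [∀ n, Fintype (ι n)] {c : ∀ n, S → Fin n → EuclideanSpace ℝ (ι n)}
    {a : ℕ → ℝ} (ha : ∀ n, 0 ≤ a n)
    (hc : DataTight μ fun n x => ENNReal.ofReal ((∑ i, ‖c n x i‖ ^ 2) / (n * a n))) :
    BootTight μ κ fun n x w =>
      ENNReal.ofReal (‖∑ i, (φ (w i) - m) • c n x i‖ ^ 2 / (n * a n)) := by
  refine BootTight.of_lintegral_le (hc.const_mul (sq_nonneg K)) (Eventually.of_forall fun n => ?_)
  filter_upwards [hind n, hmean n, hbdd n] with x h1 h2 h3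
  have hna : 0 ≤ n * a n := mul_nonneg (by positivity) (ha n)
  constructor
  · have hm : Measurable fun w : Fin n → ℝ => ∑ i, (φ (w i) - m) • c n x i :=
      Finset.measurable_fun_sum _ fun i _ =>
        ((hφ.comp (measurable_pi_apply i)).sub_const m).smul_const _
    exact ((hm.norm.pow_const 2).div_const _).ennreal_ofReal.aemeasurable
  · have h4 : ∀ w : Fin n → ℝ, ENNReal.ofReal (‖∑ i, (φ (w i) - m) • c n x i‖ ^ 2 / (n * a n)) =
        ENNReal.ofReal ((n * a n)⁻¹) * ‖∑ i, (φ (w i) - m) • c n x i‖ₑ ^ 2 := fun w => by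
      rw [div_eq_inv_mul, ENNReal.ofReal_mul (by positivity), ofReal_norm_pow]
    simp only [h4]
    rw [lintegral_const_mul' _ _ ENNReal.ofReal_ne_top]
    refine (mul_le_mul_right (lintegral_weighted_sum_sq_le h1 hφ h2 h3 (c n x)) _).trans ?_
    rw [← ENNReal.ofReal_mul (by positivity), ← ENNReal.ofReal_mul (by positivity)]
    refine (congrArg ENNReal.ofReal ?_).le
    ring

end weights

/-! ### Moments of one observation -/

section moments
variable {𝒳 : Type*} [MeasurableSpace 𝒳] {P : Measure 𝒳}

/-- A bound for a moment of order `p ≥ 1` at scale `a` bounds the first moment at scale `a`. -/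
theorem lintegral_le_of_rpow_le [IsProbabilityMeasure P] {a p C : ℝ} (ha : 0 < a) (hp : 1 ≤ p) (hC : 0 ≤ C)
    {f F : 𝒳 → ℝ≥0∞} (hfF : ∀ x, f x ^ p ≤ F x)
    (hF : ∫⁻ x, F x ∂P ≤ ENNReal.ofReal (C * a ^ p)) :
    ∫⁻ x, f x ∂P ≤ ENNReal.ofReal ((1 + C) * a) := by
  have hap : 0 < a ^ (1 - p) := Real.rpow_pos_of_pos ha _
  -- Pointwise t ≤ a + a^{1−p} t^p: either t ≤ a, or t^{1−p} ≤ a^{1−p} because the exponent is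
  -- nonpositive.
  have hpt : ∀ x, f x ≤ ENNReal.ofReal a + ENNReal.ofReal (a ^ (1 - p)) * F x := by
    intro x
    refine le_trans ?_ (add_le_add_right (mul_le_mul_right (hfF x) _) _)
    rcases eq_or_ne (f x) ⊤ with hx | hx
    · rw [hx, ENNReal.top_rpow_of_pos (by linarith), ENNReal.mul_top (by simpa using hap)]
      simp
    · obtain ⟨t, ht0, ht⟩ : ∃ t : ℝ, 0 ≤ t ∧ f x = ENNReal.ofReal t :=
        ⟨(f x).toReal, ENNReal.toReal_nonneg, (ENNReal.ofReal_toReal hx).symm⟩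
      rw [ht, ENNReal.ofReal_rpow_of_nonneg ht0 (by linarith), ← ENNReal.ofReal_mul hap.le,
        ← ENNReal.ofReal_add ha.le (by positivity)]
      apply ENNReal.ofReal_le_ofReal
      rcases le_or_gt t a with h | h
      · have : 0 ≤ a ^ (1 - p) * t ^ p := by positivity
        linarith
      · have h1 : t ^ (1 - p) ≤ a ^ (1 - p) :=
          Real.rpow_le_rpow_of_nonpos ha h.le (by linarith)
        have h2 : t = t ^ (1 - p) * t ^ p := by
          rw [← Real.rpow_add (ha.trans h)]; simp
        calc t = t ^ (1 - p) * t ^ p := h2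
          _ ≤ a ^ (1 - p) * t ^ p := by gcongr
          _ ≤ _ := by linarith
  calc ∫⁻ x, f x ∂P ≤ ∫⁻ x, (ENNReal.ofReal a + ENNReal.ofReal (a ^ (1 - p)) * F x) ∂P :=
        lintegral_mono hpt
    _ = ENNReal.ofReal a + ENNReal.ofReal (a ^ (1 - p)) * ∫⁻ x, F x ∂P := by
        rw [lintegral_add_left measurable_const, lintegral_const_mul' _ _ ENNReal.ofReal_ne_top]
        simp
    _ ≤ ENNReal.ofReal a + ENNReal.ofReal (a ^ (1 - p)) * ENNReal.ofReal (C * a ^ p) := by gcongr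
    _ = ENNReal.ofReal (a + a ^ (1 - p) * (C * a ^ p)) := by
        rw [ENNReal.ofReal_add ha.le (by positivity), ENNReal.ofReal_mul hap.le]
    _ = _ := by
        congr 1
        have : a ^ (1 - p) * a ^ p = a := by rw [← Real.rpow_add ha]; simp
        calc _ = a + C * (a ^ (1 - p) * a ^ p) := by ring
          _ = _ := by rw [this]; ring

/-- The directional derivative is an almost everywhere limit of the difference quotients k (g(θ +
e/k) − g(θ)), each measurable because θ is fixed; the term k = 0 is harmless. -/
theorem aemeasurable_fderiv_apply {E F : Type*} [NormedAddCommGroup E] [NormedSpace ℝ E]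
    [NormedAddCommGroup F] [NormedSpace ℝ F] [MeasurableSpace F] [BorelSpace F]
    [SecondCountableTopology F] {g : 𝒳 → E → F} (hg : ∀ θ, Measurable fun x => g x θ)
    (hsm : ∀ᵐ x ∂P, ContDiff ℝ 1 (g x)) (θ e : E) :
    AEMeasurable (fun x => fderiv ℝ (g x) θ e) P := by
  refine aemeasurable_of_tendsto_metrizable_ae'
    (f := fun k x => (k : ℝ) • (g x (θ + (k : ℝ)⁻¹ • e) - g x θ))
    (fun k => (((hg _).sub (hg _)).const_smul (k : ℝ)).aemeasurable) ?_
  filter_upwards [hsm] with x hx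
  exact ((hx.differentiable one_ne_zero) θ).hasFDerivAt.lim e (by
    simpa using tendsto_natCast_atTop_atTop)

/-- The mean value inequality on the closed ball of radius ‖θ − θ₀‖, where the derivative differs
from its value at θ₀ by at most L‖θ − θ₀‖. -/
theorem norm_sub_sub_fderiv_le {q : ℕ} {F : Type*} [NormedAddCommGroup F] [NormedSpace ℝ F]
    {f : EuclideanSpace ℝ (Fin q) → F} (hf : ContDiff ℝ 1 f) {θ₀ θ : EuclideanSpace ℝ (Fin q)}
    {ρ L : ℝ} (hL : 0 ≤ L) (hlip : ∀ θ ∈ Metric.ball θ₀ ρ, ‖fderiv ℝ f θ - fderiv ℝ f θ₀‖ ≤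
      L * ‖θ - θ₀‖) (hθ : ‖θ - θ₀‖ < ρ) :
    ‖f θ - f θ₀ - ∑ j, (θ - θ₀) j • fderiv ℝ f θ₀ (EuclideanSpace.single j 1)‖ ≤
      L * ‖θ - θ₀‖ ^ 2 := by
  have hsum : ∑ j, (θ - θ₀) j • fderiv ℝ f θ₀ (EuclideanSpace.single j 1) =
      fderiv ℝ f θ₀ (θ - θ₀) := by
    conv_rhs => rw [← (EuclideanSpace.basisFun (Fin q) ℝ).sum_repr (θ - θ₀)]
    simp [map_sum]
  rw [hsum, sq, ← mul_assoc]
  have hsub : ∀ x ∈ Metric.closedBall θ₀ ‖θ - θ₀‖, ‖x - θ₀‖ ≤ ‖θ - θ₀‖ := fun x hx => by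
    rwa [Metric.mem_closedBall, dist_eq_norm] at hx
  refine (convex_closedBall θ₀ ‖θ - θ₀‖).norm_image_sub_le_of_norm_fderiv_le' (𝕜 := ℝ)
    (fun x _ => hf.differentiable one_ne_zero x) (fun x hx => ?_)
    (by simp) (by simp [dist_eq_norm])
  refine (hlip x ?_).trans (by gcongr; exact hsub x hx)
  rw [Metric.mem_ball, dist_eq_norm]
  exact (hsub x hx).trans_lt hθ

end moments

/-- Moment bounds for one observation: the moment vector `y`, its derivatives `D`, and the Lipschitz
constant `δ` of the derivative. -/
structure ObsMoments {𝒳 : Type*} [MeasurableSpace 𝒳] (P : Measure 𝒳) (d : ℕ → ℕ) (q : ℕ) (C : ℝ)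
    (y : ∀ n, 𝒳 → EuclideanSpace ℝ (Fin (d n)))
    (D : ∀ n, 𝒳 → Fin q → EuclideanSpace ℝ (Fin (d n))) (δ : ∀ _ : ℕ, 𝒳 → ℝ) : Prop where
  y_meas : ∀ n, AEMeasurable (y n) P
  D_meas : ∀ n j, AEMeasurable (fun x => D n x j) P
  δ_meas : ∀ n, AEMeasurable (δ n) P
  four : ∀ᶠ n in atTop, ∫⁻ x, ‖y n x‖ₑ ^ 4 ∂P ≤ ENNReal.ofReal (C * (d n : ℝ) ^ 2)
  two : ∀ᶠ n in atTop, ∫⁻ x, ‖y n x‖ₑ ^ 2 ∂P ≤ ENNReal.ofReal (C * d n)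
  deriv : ∀ᶠ n in atTop, ∀ j, ∫⁻ x, ‖D n x j‖ₑ ^ 2 ∂P ≤ ENNReal.ofReal (C * d n)
  lip : ∀ᶠ n in atTop, ∫⁻ x, ‖δ n x‖ₑ ^ 2 ∂P ≤ ENNReal.ofReal (C * d n)

/-! ### Outer products and projections of one observation -/

theorem integrable_of_lintegral_sq_lt_top {𝒳 E : Type*} [MeasurableSpace 𝒳] {P : Measure 𝒳}
    [IsFiniteMeasure P] [NormedAddCommGroup E] {f : 𝒳 → E} (hf : AEStronglyMeasurable f P)
    (h : ∫⁻ x, ‖f x‖ₑ ^ 2 ∂P < ∞) : Integrable f P := by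
  have : MemLp f 2 P := by
    refine ⟨hf, ?_⟩
    rw [eLpNorm_lt_top_iff_lintegral_rpow_enorm_lt_top two_ne_zero ENNReal.ofNat_ne_top]
    simpa using h
  exact this.integrable one_le_two

theorem EuclideanSpace.integral_apply {𝒳 ι : Type*} [Fintype ι] [MeasurableSpace 𝒳]
    {P : Measure 𝒳} {f : 𝒳 → EuclideanSpace ℝ ι} (hf : Integrable f P) (k : ι) :
    (∫ x, f x ∂P) k = ∫ x, f x k ∂P :=
  ((EuclideanSpace.proj (𝕜 := ℝ) k).integral_comp_comm hf).symm

theorem measurable_outerVec {d : ℕ} :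
    Measurable (outerVec : EuclideanSpace ℝ (Fin d) → EuclideanSpace ℝ (Fin d × Fin d)) := by
  have : Continuous (outerVec : EuclideanSpace ℝ (Fin d) → EuclideanSpace ℝ (Fin d × Fin d)) := by
    unfold outerVec
    fun_prop
  exact this.measurable

theorem enorm_outerVec_sq {d : ℕ} (v : EuclideanSpace ℝ (Fin d)) :
    ‖outerVec v‖ₑ ^ 2 = ‖v‖ₑ ^ 4 := by
  rw [← ofReal_norm_pow, ← ofReal_norm_pow, norm_outerVec]
  congr 1
  ring

theorem norm_starProjection_sq {V : Type*} [NormedAddCommGroup V] [InnerProductSpace ℝ V]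
    [FiniteDimensional ℝ V] (W : Submodule ℝ V) (v : V) :
    ‖W.starProjection v‖ ^ 2 = ∑ i, inner ℝ ((stdOrthonormalBasis ℝ W i : W) : V) v ^ 2 := by
  rw [Submodule.starProjection_apply, Submodule.norm_coe,
    ← (stdOrthonormalBasis ℝ W).sum_sq_norm_inner_right]
  refine Finset.sum_congr rfl fun i _ => ?_
  rw [Real.norm_eq_abs, sq_abs, Submodule.inner_orthogonalProjectionOnto_eq_of_mem_left]

theorem integral_inner_sq {𝒳 : Type*} [MeasurableSpace 𝒳] {P : Measure 𝒳} {d : ℕ}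
    {y : 𝒳 → EuclideanSpace ℝ (Fin d)} (hint : Integrable (fun x => outerVec (y x)) P)
    (b : EuclideanSpace ℝ (Fin d)) :
    ∫ x, inner ℝ b (y x) ^ 2 ∂P = quadForm (secondMomentMatrix P y) b := by
  have h : ∫ x, outerVec (y x) ∂P = matVec (secondMomentMatrix P y) := by
    ext k
    rw [EuclideanSpace.integral_apply hint]
    rfl
  rw [← inner_outerVec_matVec, ← h, ← integral_inner hint]
  simp only [inner_outerVec]

/-- The projection of `A y` to a subspace of dimension at most `q` has bounded second moment. -/
theorem lintegral_starProjection_sq_le {𝒳 : Type*} [MeasurableSpace 𝒳] {P : Measure 𝒳} {d q : ℕ}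
    {y : 𝒳 → EuclideanSpace ℝ (Fin d)} (hy : AEMeasurable y P)
    (hint : Integrable (fun x => outerVec (y x)) P) {C : ℝ} (hC : 1 ≤ C)
    (hΩ : IsElliptic (secondMomentMatrix P y) C)
    {A : Matrix (Fin d) (Fin d) ℝ} (hA : IsElliptic A C)
    (V : Submodule ℝ (EuclideanSpace ℝ (Fin d))) (hV : Module.finrank ℝ V ≤ q) :
    ∫⁻ x, ‖V.starProjection (matOp A (y x))‖ₑ ^ 2 ∂P ≤ ENNReal.ofReal (q * C ^ 3) := by
  set e := stdOrthonormalBasis ℝ V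
  have hpt : ∀ x, ‖V.starProjection (matOp A (y x))‖ₑ ^ 2 =
      ∑ i, ENNReal.ofReal (inner ℝ (matOp A (e i : EuclideanSpace ℝ (Fin d))) (y x) ^ 2) := by
    intro x
    rw [← ofReal_norm_pow, norm_starProjection_sq,
      ENNReal.ofReal_sum_of_nonneg fun i _ => sq_nonneg _]
    refine Finset.sum_congr rfl fun i _ => ?_
    rw [hA.symm, real_inner_comm]
  simp only [hpt]
  have hmeas : ∀ b : EuclideanSpace ℝ (Fin d), AEMeasurable (fun x => inner ℝ b (y x) ^ 2) P :=
    fun b => ((by fun_prop : Measurable fun v : EuclideanSpace ℝ (Fin d) =>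
      inner ℝ b v ^ 2)).comp_aemeasurable hy
  -- One direction contributes the form Ω at A e_i, at most C · C²; the number of directions is at
  -- most q, independently of d.
  have hone : ∀ i, ∫⁻ x, ENNReal.ofReal
      (inner ℝ (matOp A (e i : EuclideanSpace ℝ (Fin d))) (y x) ^ 2) ∂P ≤
      ENNReal.ofReal (C ^ 3) := by
    intro i
    set b := matOp A (e i : EuclideanSpace ℝ (Fin d))
    have hb : ‖b‖ ≤ C := by
      refine (hA.upper _).trans (le_of_eq ?_)
      rw [Submodule.norm_coe, e.orthonormal.1 i, mul_one]
    have hbint : Integrable (fun x => inner ℝ b (y x) ^ 2) P := by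
      simp only [← inner_outerVec]
      exact hint.const_inner _
    rw [← ofReal_integral_eq_lintegral_ofReal hbint (Eventually.of_forall fun x => sq_nonneg _),
      integral_inner_sq hint]
    apply ENNReal.ofReal_le_ofReal
    calc _ ≤ C * ‖b‖ ^ 2 := hΩ.quadForm_le b
      _ ≤ C * C ^ 2 := by gcongr
      _ = C ^ 3 := by ring
  rw [lintegral_finsetSum' _ fun i _ => (hmeas _).ennreal_ofReal]
  calc _ ≤ ∑ _i : Fin (Module.finrank ℝ V), ENNReal.ofReal (C ^ 3) :=
        Finset.sum_le_sum fun i _ => hone i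
    _ = ENNReal.ofReal (Module.finrank ℝ V * C ^ 3) := by
        rw [ENNReal.ofReal_mul (by positivity), ENNReal.ofReal_natCast]; simp
    _ ≤ _ := by
        apply ENNReal.ofReal_le_ofReal
        gcongr

theorem norm_integral_le_sqrt {𝒳 : Type*} [MeasurableSpace 𝒳] {P : Measure 𝒳}
    [IsProbabilityMeasure P] {E : Type*} [NormedAddCommGroup E] [NormedSpace ℝ E] {f : 𝒳 → E}
    {C a : ℝ} (hC : 0 ≤ C) (ha : 0 < a) (h : ∫⁻ x, ‖f x‖ₑ ^ 2 ∂P ≤ ENNReal.ofReal (C * a)) :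
    ‖∫ x, f x ∂P‖ ≤ (1 + C) * Real.sqrt a := by
  have hs : 0 < Real.sqrt a := Real.sqrt_pos.2 ha
  have h1 := lintegral_le_of_rpow_le (P := P) hs one_le_two hC (f := fun x => ‖f x‖ₑ)
    (F := fun x => ‖f x‖ₑ ^ 2) (fun x => by simp) (by
      refine h.trans (le_of_eq ?_)
      rw [Real.rpow_two, Real.sq_sqrt ha.le])
  have h2 := (enorm_integral_le_lintegral_enorm f).trans h1
  rw [← ofReal_norm] at h2
  exact (ENNReal.ofReal_le_ofReal_iff (by positivity)).1 h2

/-! ### Tightness of the arrays built from the observations -/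

section arrays
variable {S 𝒳 : Type*} [MeasurableSpace S] [MeasurableSpace 𝒳] {μ : Measure S}
  {P : Measure 𝒳} {X : ℕ → S → 𝒳} {d : ℕ → ℕ} {q : ℕ} {C : ℝ}
  {y : ∀ n, 𝒳 → EuclideanSpace ℝ (Fin (d n))}
  {D : ∀ n, 𝒳 → Fin q → EuclideanSpace ℝ (Fin (d n))} {δ : ∀ _ : ℕ, 𝒳 → ℝ}

theorem eventually_cast_pos (hd : Tendsto d atTop atTop) : ∀ᶠ n in atTop, (0 : ℝ) < d n := by
  filter_upwards [hd.eventually_ge_atTop 1] with n hn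
  exact_mod_cast hn

theorem ObsMoments.dataTight_four (h : ObsMoments P d q C y D δ)
    (hd : Tendsto d atTop atTop) (hXmeas : ∀ i, Measurable (X i))
    (hXlaw : ∀ i, μ.map (X i) = P) :
    DataTight μ fun n x =>
      ENNReal.ofReal ((∑ i : Fin n, ‖y n (X i x)‖ ^ 4) / (n * (d n : ℝ) ^ 2)) := by
  refine dataTight_average (C := C) hXmeas hXlaw (φ := fun n x => ‖y n x‖ ^ 4)
    (fun n => (h.y_meas n).norm.pow_const 4) (fun n x => by positivity) ?_
  filter_upwards [h.four, eventually_cast_pos hd] with n hn hdn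
  simpa only [ofReal_norm_pow] using And.intro (pow_pos hdn 2) hn

theorem ObsMoments.dataTight_two (h : ObsMoments P d q C y D δ)
    (hd : Tendsto d atTop atTop) (hXmeas : ∀ i, Measurable (X i))
    (hXlaw : ∀ i, μ.map (X i) = P) :
    DataTight μ fun n x => ENNReal.ofReal ((∑ i : Fin n, ‖y n (X i x)‖ ^ 2) / (n * d n)) := by
  refine dataTight_average (C := C) hXmeas hXlaw (φ := fun n x => ‖y n x‖ ^ 2)
    (fun n => (h.y_meas n).norm.pow_const 2) (fun n x => by positivity) ?_
  filter_upwards [h.two, eventually_cast_pos hd] with n hn hdn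
  simpa only [ofReal_norm_pow] using And.intro hdn hn

theorem ObsMoments.dataTight_deriv (h : ObsMoments P d q C y D δ)
    (hd : Tendsto d atTop atTop) (hXmeas : ∀ i, Measurable (X i))
    (hXlaw : ∀ i, μ.map (X i) = P) (j : Fin q) :
    DataTight μ fun n x => ENNReal.ofReal ((∑ i : Fin n, ‖D n (X i x) j‖ ^ 2) / (n * d n)) := by
  refine dataTight_average (C := C) hXmeas hXlaw (φ := fun n x => ‖D n x j‖ ^ 2)
    (fun n => (h.D_meas n j).norm.pow_const 2) (fun n x => by positivity) ?_
  filter_upwards [h.deriv, eventually_cast_pos hd] with n hn hdn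
  simpa only [ofReal_norm_pow] using And.intro hdn (hn j)

theorem ObsMoments.dataTight_lip (h : ObsMoments P d q C y D δ)
    (hd : Tendsto d atTop atTop) (hXmeas : ∀ i, Measurable (X i))
    (hXlaw : ∀ i, μ.map (X i) = P) :
    DataTight μ fun n x => ENNReal.ofReal ((∑ i : Fin n, δ n (X i x) ^ 2) / (n * d n)) := by
  refine dataTight_average (C := C) hXmeas hXlaw (φ := fun n x => δ n x ^ 2)
    (fun n => (h.δ_meas n).pow_const 2) (fun n x => by positivity) ?_
  filter_upwards [h.lip, eventually_cast_pos hd] with n hn hdn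
  refine ⟨hdn, le_trans (lintegral_congr fun x => ?_).le hn⟩
  rw [← ofReal_norm_pow, Real.norm_eq_abs, sq_abs]

theorem BootTight.sum_ofReal {κ : ∀ n : ℕ, Kernel S (Fin n → ℝ)} {ι : Type*} [Fintype ι]
    {f : ι → ∀ n : ℕ, S → (Fin n → ℝ) → ℝ} (hf0 : ∀ j n x w, 0 ≤ f j n x w)
    (hf : ∀ j, BootTight μ κ fun n x w => ENNReal.ofReal (f j n x w)) :
    BootTight μ κ fun n x w => ENNReal.ofReal (∑ j, f j n x w) := by
  refine (BootTight.sum Finset.univ fun j _ => hf j).mono (Eventually.of_forall fun n =>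
    Eventually.of_forall fun x => Eventually.of_forall fun w => ?_)
  rw [ENNReal.ofReal_sum_of_nonneg fun j _ => hf0 j n x w]

theorem ObsMoments.bootTight_deriv (h : ObsMoments P d q C y D δ)
    (hd : Tendsto d atTop atTop) (hXmeas : ∀ i, Measurable (X i))
    (hXlaw : ∀ i, μ.map (X i) = P) {κ : ∀ n : ℕ, Kernel S (Fin n → ℝ)} :
    BootTight μ κ fun n x _ =>
      ENNReal.ofReal ((∑ i : Fin n, ∑ j, ‖D n (X i x) j‖ ^ 2) / (n * d n)) := by
  have := BootTight.sum_ofReal (κ := κ) (fun j n x w => by positivity)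
    fun j => (h.dataTight_deriv hd hXmeas hXlaw j).boot (κ := κ)
  refine this.mono (Eventually.of_forall fun n =>
    Eventually.of_forall fun x => Eventually.of_forall fun w => ?_)
  rw [Finset.sum_comm, Finset.sum_div]

theorem BootTight.of_dataTight_dirac {f : ∀ n : ℕ, S → (Fin n → ℝ) → ℝ≥0∞}
    (h : DataTight μ fun n x => f n x 1) :
    BootTight μ (fun n => Kernel.const S (Measure.dirac (1 : Fin n → ℝ))) f := by
  refine h.boot.mono (Eventually.of_forall fun n => Eventually.of_forall fun x => ?_)
  rw [Kernel.const_apply, ae_dirac_eq]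
  exact le_refl (f n x 1)

theorem outerVec_integrable [IsProbabilityMeasure P] {d : ℕ} {y : 𝒳 → EuclideanSpace ℝ (Fin d)}
    (hy : AEMeasurable y P) {B : ℝ} (h4 : ∫⁻ x, ‖y x‖ₑ ^ 4 ∂P ≤ ENNReal.ofReal B) :
    Integrable (fun x => outerVec (y x)) P := by
  refine integrable_of_lintegral_sq_lt_top
    (measurable_outerVec.comp_aemeasurable hy).aestronglyMeasurable ?_
  simp only [enorm_outerVec_sq]
  exact h4.trans_lt ENNReal.ofReal_lt_top

theorem ObsMoments.dataTight_outer [IsProbabilityMeasure μ] [IsProbabilityMeasure P]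
    (h : ObsMoments P d q C y D δ)
    (hd : Tendsto d atTop atTop) (hXmeas : ∀ i, Measurable (X i)) (hXindep : iIndepFun X μ)
    (hXlaw : ∀ i, μ.map (X i) = P) :
    DataTight μ fun n x => ENNReal.ofReal
      (‖∑ i : Fin n, (outerVec (y n (X i x)) - matVec (secondMomentMatrix P (y n)))‖ ^ 2 /
        (n * (d n : ℝ) ^ 2)) := by
  refine dataTight_centred_sum (C := C) hXmeas hXindep hXlaw (f := fun n x => outerVec (y n x))
    (fun n => measurable_outerVec.comp_aemeasurable (h.y_meas n))
    (Eventually.of_forall fun n k => rfl) ?_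
  filter_upwards [h.four, eventually_cast_pos hd] with n hn hdn
  simpa only [enorm_outerVec_sq] using And.intro (pow_pos hdn 2) hn

/-- The unweighted arrays. -/
theorem ObsMoments.tightArrays [IsProbabilityMeasure μ] [IsProbabilityMeasure P]
    (h : ObsMoments P d q C y D δ) (hC : 1 ≤ C)
    (hd : Tendsto d atTop atTop) (hXmeas : ∀ i, Measurable (X i)) (hXindep : iIndepFun X μ)
    (hXlaw : ∀ i, μ.map (X i) = P) (hmean : ∀ n, ∫ x, y n x ∂P = 0)
    (hΩ : ∀ n, IsElliptic (secondMomentMatrix P (y n)) C)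
    {A : ∀ n, Matrix (Fin (d n)) (Fin (d n)) ℝ} (hA : ∀ n, IsElliptic (A n) C) :
    TightArrays μ (fun n => Kernel.const S (Measure.dirac (1 : Fin n → ℝ))) d q 1
      (fun n => secondMomentMatrix P (y n)) A (fun n x i => y n (X i x))
      (fun n x i => D n (X i x)) (fun n x i => δ n (X i x)) (fun n j => ∫ x, D n x j ∂P) := by
  have hC0 : 0 ≤ C := by linarith
  have hyint : ∀ᶠ n in atTop, Integrable (y n) P := by
    filter_upwards [h.two] with n hn
    exact integrable_of_lintegral_sq_lt_top (h.y_meas n).aestronglyMeasurable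
      (hn.trans_lt ENNReal.ofReal_lt_top)
  constructor
  · refine fun n => Eventually.of_forall fun x => ?_
    rw [Kernel.const_apply, ae_dirac_eq]
    exact fun i => by simp
  · exact (h.dataTight_four hd hXmeas hXlaw).boot
  · exact h.bootTight_deriv hd hXmeas hXlaw
  · exact (h.dataTight_lip hd hXmeas hXlaw).boot
  · refine BootTight.of_dataTight_dirac ?_
    have := dataTight_centred_sum hXmeas hXindep hXlaw (f := y) h.y_meas (m := fun _ => 0)
      (by
        filter_upwards [hyint] with n hn k
        rw [← EuclideanSpace.integral_apply hn, hmean])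
      (a := fun n => d n) (by
        filter_upwards [h.two, eventually_cast_pos hd] with n hn hdn using ⟨hdn, hn⟩)
    refine this.mono ?_
    filter_upwards [eventually_gt_atTop 0] with n hn
    refine Eventually.of_forall fun x => le_of_eq ?_
    rw [norm_scaledSum_sq hn, div_div]
    simp
  · simp only [Finset.sum_div]
    refine BootTight.sum_ofReal (fun j n x w => by positivity)
      fun j => BootTight.of_dataTight_dirac ?_
    have := dataTight_centred_sum hXmeas hXindep hXlaw (f := fun n x => D n x j)
      (fun n => h.D_meas n j) (m := fun n => ∫ x, D n x j ∂P)
      (by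
        filter_upwards [h.deriv] with n hn k
        exact (EuclideanSpace.integral_apply (integrable_of_lintegral_sq_lt_top
          (h.D_meas n j).aestronglyMeasurable ((hn j).trans_lt ENNReal.ofReal_lt_top)) k).symm)
      (a := fun n => d n) (by
        filter_upwards [h.deriv, eventually_cast_pos hd] with n hn hdn using ⟨hdn, hn j⟩)
    refine this.mono ?_
    filter_upwards [eventually_gt_atTop 0] with n hn
    refine Eventually.of_forall fun x => le_of_eq ?_
    rw [norm_scaledSum_sq hn, div_div]
    simp
  · refine BootTight.of_dataTight_dirac ?_
    simpa using h.dataTight_outer hd hXmeas hXindep hXlaw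
  · refine BootTight.of_dataTight_dirac ?_
    set V : ∀ n, Submodule ℝ (EuclideanSpace ℝ (Fin (d n))) := fun n =>
      Submodule.span ℝ (Set.range fun j : Fin q => ∫ x, D n x j ∂P)
    -- The drift space is spanned by q vectors, so the projected sum is normalised by 1 instead of
    -- d.
    have hVr : ∀ n, Module.finrank ℝ (V n) ≤ q := fun n =>
      (finrank_range_le_card _).trans (by simp)
    have hlm : ∀ n, Continuous fun v => (V n).starProjection (matOp (A n) v) := fun n => by
      fun_prop
    have := dataTight_centred_sum hXmeas hXindep hXlaw
      (f := fun n x => (V n).starProjection (matOp (A n) (y n x)))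
      (fun n => (hlm n).measurable.comp_aemeasurable (h.y_meas n)) (m := fun _ => 0)
      (by
        filter_upwards [hyint] with n hn k
        have h1 : Integrable (fun x => ((V n).starProjection ∘L matOp (A n)) (y n x)) P :=
          ContinuousLinearMap.integrable_comp _ hn
        have h2 := ContinuousLinearMap.integral_comp_comm ((V n).starProjection ∘L matOp (A n)) hn
        rw [hmean, map_zero] at h2
        have h3 := EuclideanSpace.integral_apply h1 k
        rw [h2] at h3
        exact h3.symm)
      (C := q * C ^ 3)
      (a := fun _ => 1) (by
        filter_upwards [h.four] with n hn
        refine ⟨one_pos, ?_⟩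
        rw [mul_one]
        exact lintegral_starProjection_sq_le (h.y_meas n) (outerVec_integrable (h.y_meas n) hn) hC
          (hΩ n) (hA n) (V n) (hVr n))
    refine this.mono ?_
    filter_upwards [eventually_gt_atTop 0] with n hn
    refine Eventually.of_forall fun x => le_of_eq ?_
    have hn' : (0 : ℝ) < n := by exact_mod_cast hn
    congr 1
    simp only [scaledSum, map_smul, map_sum, norm_smul, Pi.one_apply, one_smul, sub_zero, mul_one]
    rw [mul_pow, norm_inv, Real.norm_of_nonneg (Real.sqrt_nonneg _), inv_pow, Real.sq_sqrt hn'.le,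
      inv_mul_eq_div]
  · refine ⟨1 + C, ?_⟩
    filter_upwards [h.deriv, eventually_cast_pos hd] with n hn hdn j
    exact norm_integral_le_sqrt hC0 hdn (hn j)

/-- The arrays weighted by bootstrap weights. -/
theorem ObsMoments.tightArrays_boot [IsProbabilityMeasure μ] [IsProbabilityMeasure P]
    (h : ObsMoments P d q C y D δ)
    (hd : Tendsto d atTop atTop) (hXmeas : ∀ i, Measurable (X i)) (hXindep : iIndepFun X μ)
    (hXlaw : ∀ i, μ.map (X i) = P)
    {κ : ∀ n : ℕ, Kernel S (Fin n → ℝ)} [∀ n, IsMarkovKernel (κ n)]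
    (hκ_indep : ∀ n, ∀ᵐ ω ∂μ, iIndepFun (fun (i : Fin n) (w : Fin n → ℝ) => w i) (κ n ω))
    (hκ_mean : ∀ n, ∀ᵐ ω ∂μ, ∀ i, ∫ w, w i ∂(κ n ω) = 0)
    (hκ_var : ∀ n, ∀ᵐ ω ∂μ, ∀ i, ∫ w, (w i) ^ 2 ∂(κ n ω) = 1)
    {K : ℝ} (hκ_bdd : ∀ n, ∀ᵐ ω ∂μ, ∀ᵐ w ∂(κ n ω), ∀ i, |w i| ≤ K)
    (A : ∀ n, Matrix (Fin (d n)) (Fin (d n)) ℝ) :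
    TightArrays μ κ d q K
      (fun n => secondMomentMatrix P (y n)) A (fun n x i => y n (X i x))
      (fun n x i => D n (X i x)) (fun n x i => δ n (X i x)) (fun n _ => 0) := by
  have hscaled : ∀ {c : ∀ n, S → Fin n → EuclideanSpace ℝ (Fin (d n))},
      (DataTight μ fun n x => ENNReal.ofReal ((∑ i, ‖c n x i‖ ^ 2) / (n * d n))) →
      BootTight μ κ fun n x w => ENNReal.ofReal (‖scaledSum fun i => w i • c n x i‖ ^ 2 / d n) := by
    intro c hc
    have := bootTight_weighted_sum hκ_indep (φ := id) measurable_id (m := 0) hκ_mean hκ_bdd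
      (a := fun n => d n) (fun _ => by positivity) hc
    refine this.mono ?_
    filter_upwards [eventually_gt_atTop 0] with n hn
    refine Eventually.of_forall fun x => Eventually.of_forall fun w => le_of_eq ?_
    rw [norm_scaledSum_sq hn, div_div]
    simp
  constructor
  · exact hκ_bdd
  · exact (h.dataTight_four hd hXmeas hXlaw).boot
  · exact h.bootTight_deriv hd hXmeas hXlaw
  · exact (h.dataTight_lip hd hXmeas hXlaw).boot
  · exact hscaled (h.dataTight_two hd hXmeas hXlaw)
  · simp only [sub_zero, Finset.sum_div]
    exact BootTight.sum_ofReal (fun j n x w => by positivity)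
      fun j => hscaled (h.dataTight_deriv hd hXmeas hXlaw j)
  · have h1 := bootTight_weighted_sum hκ_indep (φ := fun t => t ^ 2) (by fun_prop) (m := 1)
      (K := K ^ 2) hκ_var (fun n => by
        filter_upwards [hκ_bdd n] with x hx
        filter_upwards [hx] with w hw i
        rw [abs_pow]
        exact pow_le_pow_left₀ (abs_nonneg _) (hw i) 2)
      (a := fun n => (d n : ℝ) ^ 2) (fun _ => by positivity)
      (c := fun n x i => outerVec (y n (X i x))) (by
        simp only [norm_outerVec, ← pow_mul]
        exact h.dataTight_four hd hXmeas hXlaw)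
    have h2 := (h.dataTight_outer hd hXmeas hXindep hXlaw).boot (κ := κ)
    -- The deviation splits into (w² − 1) y yᵀ, conditionally centred because the weights have
    -- variance one, and y yᵀ − Ω, centred under the data law. The doubling comes from ‖a + b‖² ≤
    -- 2‖a‖² + 2‖b‖².
    refine ((h1.add h1).add (h2.add h2)).mono (Eventually.of_forall fun n =>
      Eventually.of_forall fun x => Eventually.of_forall fun w => ?_)
    rw [← ENNReal.ofReal_add (by positivity) (by positivity),
      ← ENNReal.ofReal_add (by positivity) (by positivity),
      ← ENNReal.ofReal_add (by positivity) (by positivity)]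
    apply ENNReal.ofReal_le_ofReal
    rw [← add_div, ← add_div, ← add_div]
    gcongr
    have h3 : ∑ i, (w i ^ 2 • outerVec (y n (X i x)) - matVec (secondMomentMatrix P (y n))) =
        ∑ i, (w i ^ 2 - 1) • outerVec (y n (X i x)) +
        ∑ i : Fin n, (outerVec (y n (X i x)) - matVec (secondMomentMatrix P (y n))) := by
      rw [← Finset.sum_add_distrib]
      refine Finset.sum_congr rfl fun i _ => ?_
      rw [sub_smul, one_smul]
      abel
    rw [h3]
    refine (pow_le_pow_left₀ (norm_nonneg _) (norm_add_le _ _) 2).trans (add_sq_le.trans ?_)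
    linarith
  -- Mean-zero weights leave no drift: G = 0, so the drift space is trivial and the projection
  -- vanishes.
  · refine ((DataTight.const 0).boot (κ := κ)).mono (Eventually.of_forall fun n =>
      Eventually.of_forall fun x => Eventually.of_forall fun w => ?_)
    have : Submodule.span ℝ (Set.range fun _ : Fin q => (0 : EuclideanSpace ℝ (Fin (d n)))) = ⊥ :=
      Submodule.span_eq_bot.2 (by rintro _ ⟨_, rfl⟩; rfl)
    rw [this]
    simp
  · exact ⟨0, Eventually.of_forall fun n j => by simp⟩

end arrays

/-! ### From the assumptions to the expansions -/

theorem secondMomentMatrix_isHermitian {𝒳 : Type*} [MeasurableSpace 𝒳] (P : Measure 𝒳) {d : ℕ}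
    (h : 𝒳 → EuclideanSpace ℝ (Fin d)) : (secondMomentMatrix P h).IsHermitian := by
  ext i j
  simp [secondMomentMatrix, mul_comm]

theorem bootMomentArray_one {𝒳 E : Type*} {d : ℕ} (g : 𝒳 → E → EuclideanSpace ℝ (Fin d)) {n : ℕ}
    (x : Fin n → 𝒳) (θ : E) : bootMomentArray g x 1 θ = momentArray g x θ := by
  funext i
  simp [bootMomentArray, momentArray]

/-- The moment conditions at `θ₀` and the regularity of the moment functions near `θ₀` give moment
bounds for one observation at `θ₀`. -/
theorem obsMoments_of_regularity {𝒳 : Type*} [MeasurableSpace 𝒳] (P : Measure 𝒳)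
    [IsProbabilityMeasure P] (d : ℕ → ℕ) (hd : Tendsto d atTop atTop)
    (q : ℕ) (θ₀ : EuclideanSpace ℝ (Fin q))
    (g : ∀ n : ℕ, 𝒳 → EuclideanSpace ℝ (Fin q) → EuclideanSpace ℝ (Fin (d n)))
    (hgmeas : ∀ n θ, Measurable fun x => g n x θ)
    (𝒩 : Set (EuclideanSpace ℝ (Fin q))) (h𝒩 : IsOpen 𝒩) (hθ₀𝒩 : θ₀ ∈ 𝒩)
    (γ : ℝ) (hγ : 0 < γ)
    (hg_moment : ∃ C : ℝ, ∀ n,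
      ∫⁻ x, ⨆ θ ∈ 𝒩, ‖g n x θ‖ₑ ^ (2 * (2 + γ)) ∂P ≤ ENNReal.ofReal (C * (d n : ℝ) ^ (2 + γ)))
    (hg_smooth : ∀ n, ∀ᵐ x ∂P, ContDiff ℝ 1 (g n x))
    (hg_grad : ∃ β : ℝ, 1 ≤ β ∧ ∃ C : ℝ, ∀ n,
      ∫⁻ x, ⨆ θ ∈ 𝒩, ‖fderiv ℝ (g n x) θ‖ₑ ^ (2 * β) ∂P ≤ ENNReal.ofReal (C * (d n : ℝ) ^ β))
    (hg_lip : ∃ C : ℝ, ∃ δ : ℕ → 𝒳 → ℝ, (∀ n, Measurable (δ n)) ∧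
      (∀ n, ∀ᵐ x ∂P, ∀ θ ∈ 𝒩,
        ‖fderiv ℝ (g n x) θ - fderiv ℝ (g n x) θ₀‖ ≤ C * δ n x * ‖θ - θ₀‖) ∧
      ∀ n, ∫⁻ x, ‖δ n x‖ₑ ^ 2 ∂P ≤ ENNReal.ofReal (C * d n)) :
    ∃ (C ρ : ℝ) (δ : ℕ → 𝒳 → ℝ), 0 < ρ ∧
      (∀ C' ≥ C, ObsMoments P d q C' (fun n x => g n x θ₀)
        (fun n x j => fderiv ℝ (g n x) θ₀ (EuclideanSpace.single j 1)) δ) ∧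
      ∀ n, ∀ᵐ x ∂P, ∀ θ, ‖θ - θ₀‖ < ρ →
        ‖g n x θ - g n x θ₀ -
          ∑ j, (θ - θ₀) j • fderiv ℝ (g n x) θ₀ (EuclideanSpace.single j 1)‖ ≤
          δ n x * ‖θ - θ₀‖ ^ 2 := by
  obtain ⟨C₁, hC₁⟩ := hg_moment
  obtain ⟨β, hβ, C₂, hC₂⟩ := hg_grad
  obtain ⟨C₃, δ, hδm, hδl, hδ⟩ := hg_lip
  obtain ⟨ρ, hρ, hball⟩ := Metric.isOpen_iff.1 h𝒩 θ₀ hθ₀𝒩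
  have hcast : ∀ {a b c : ℝ} {I : ℝ≥0∞}, I ≤ ENNReal.ofReal (a * b) → 0 ≤ b → a ≤ c →
      I ≤ ENNReal.ofReal (c * b) := fun hI hb hac =>
    hI.trans (ENNReal.ofReal_le_ofReal (mul_le_mul_of_nonneg_right hac hb))
  have hfour : ∀ᶠ n in atTop, ∫⁻ x, ‖g n x θ₀‖ₑ ^ 4 ∂P ≤
      ENNReal.ofReal ((1 + |C₁|) * (d n : ℝ) ^ 2) := by
    filter_upwards [eventually_cast_pos hd] with n hn
    -- The fourth power of the norm at scale d², raised to p = (2 + γ)/2, matches the assumed moment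
    -- of order 2(2 + γ) at scale d^{2+γ}.
    refine lintegral_le_of_rpow_le (p := (2 + γ) / 2) (by positivity) (by linarith)
      (abs_nonneg _) (F := fun x => ⨆ θ ∈ 𝒩, ‖g n x θ‖ₑ ^ (2 * (2 + γ)))
      (fun x => ?_) (hcast ?_ (by positivity) (le_abs_self C₁))
    · refine le_trans (le_of_eq ?_)
        (le_iSup₂ (f := fun θ (_ : θ ∈ 𝒩) => ‖g n x θ‖ₑ ^ (2 * (2 + γ))) θ₀ hθ₀𝒩)
      rw [← ENNReal.rpow_natCast, ← ENNReal.rpow_mul]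
      congr 1
      push_cast
      ring
    · refine (hC₁ n).trans (le_of_eq ?_)
      rw [← Real.rpow_natCast, ← Real.rpow_mul hn.le]
      congr 3
      push_cast
      ring
  have htwo : ∀ᶠ n in atTop, ∫⁻ x, ‖g n x θ₀‖ₑ ^ 2 ∂P ≤
      ENNReal.ofReal ((1 + (1 + |C₁|)) * d n) := by
    filter_upwards [hfour, eventually_cast_pos hd] with n hn hdn
    refine lintegral_le_of_rpow_le (p := 2) hdn one_le_two (by positivity)
      (F := fun x => ‖g n x θ₀‖ₑ ^ 4) (fun x => ?_) (by rw [Real.rpow_two]; exact hn)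
    rw [ENNReal.rpow_two, ← pow_mul]
  have hderiv : ∀ᶠ n in atTop, ∀ j : Fin q,
      ∫⁻ x, ‖fderiv ℝ (g n x) θ₀ (EuclideanSpace.single j 1)‖ₑ ^ 2 ∂P ≤
      ENNReal.ofReal ((1 + |C₂|) * d n) := by
    filter_upwards [eventually_cast_pos hd] with n hn j
    refine lintegral_le_of_rpow_le (p := β) hn hβ (abs_nonneg _)
      (F := fun x => ⨆ θ ∈ 𝒩, ‖fderiv ℝ (g n x) θ‖ₑ ^ (2 * β)) (fun x => ?_)
      (hcast (hC₂ n) (by positivity) (le_abs_self C₂))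
    refine le_trans ?_
      (le_iSup₂ (f := fun θ (_ : θ ∈ 𝒩) => ‖fderiv ℝ (g n x) θ‖ₑ ^ (2 * β)) θ₀ hθ₀𝒩)
    rw [← ENNReal.rpow_two, ← ENNReal.rpow_mul]
    gcongr
    rw [← ofReal_norm, ← ofReal_norm]
    apply ENNReal.ofReal_le_ofReal
    simpa using (fderiv ℝ (g n x) θ₀).le_opNorm (EuclideanSpace.single j 1)
  -- The constant is absorbed into the Lipschitz variable: squaring gives |C₃|² and the moment bound
  -- one more factor. Absolute values provide the sign needed for the Taylor bound.
  have hlip : ∀ n, ∫⁻ x, ‖|C₃| * |δ n x|‖ₑ ^ 2 ∂P ≤ ENNReal.ofReal (|C₃| ^ 3 * d n) := by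
    intro n
    simp only [enorm_mul, mul_pow]
    rw [lintegral_const_mul' _ _ (by simp), ← ofReal_norm_pow]
    have : ∀ x, ‖|δ n x|‖ₑ = ‖δ n x‖ₑ := fun x => by
      rw [← Real.norm_eq_abs, enorm_norm]
    simp only [this]
    refine (mul_le_mul_right (hcast (hδ n) (by positivity) (le_abs_self C₃)) _).trans ?_
    rw [← ENNReal.ofReal_mul (by positivity)]
    refine (congrArg ENNReal.ofReal ?_).le
    rw [Real.norm_eq_abs, abs_abs]
    ring
  refine ⟨max (1 + (1 + |C₁|)) (max (1 + |C₂|) (|C₃| ^ 3)), ρ, fun n x => |C₃| * |δ n x|, hρ,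
    fun C' hC' => ?_, fun n => ?_⟩
  · have h1 : 1 + (1 + |C₁|) ≤ C' := (le_max_left _ _).trans hC'
    have h2 : 1 + |C₂| ≤ C' := ((le_max_left _ _).trans (le_max_right _ _)).trans hC'
    have h3 : |C₃| ^ 3 ≤ C' := ((le_max_right _ _).trans (le_max_right _ _)).trans hC'
    refine ⟨fun n => (hgmeas n θ₀).aemeasurable,
      fun n j => aemeasurable_fderiv_apply (hgmeas n) (hg_smooth n) _ _,
      fun n => ((hδm n).abs.const_mul _).aemeasurable, ?_, ?_, ?_, ?_⟩
    · filter_upwards [hfour] with n hn using hcast hn (by positivity) (by linarith)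
    · filter_upwards [htwo] with n hn using hcast hn (by positivity) h1
    · filter_upwards [hderiv] with n hn j using hcast (hn j) (by positivity) h2
    · exact Eventually.of_forall fun n => hcast (hlip n) (by positivity) h3
  · filter_upwards [hg_smooth n, hδl n] with x hx hxl θ hθ
    refine norm_sub_sub_fderiv_le hx (by positivity) (fun θ' hθ' => ?_) hθ
    refine (hxl θ' (hball hθ')).trans ?_
    refine mul_le_mul_of_nonneg_right ?_ (norm_nonneg _)
    rw [← abs_mul]
    exact le_abs_self _

theorem mainTheorem6
    -- probability space of the data, and an i.i.d. sequence of observations with law `P`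
    {S : Type*} [MeasurableSpace S] (μ : Measure S) [IsProbabilityMeasure μ]
    {𝒳 : Type*} [MeasurableSpace 𝒳] (P : Measure 𝒳)
    (X : ℕ → S → 𝒳) (hXmeas : ∀ i, Measurable (X i)) (hXindep : iIndepFun X μ)
    (hXlaw : ∀ i, μ.map (X i) = P)
    -- the number of moment conditions, which diverges
    (d : ℕ → ℕ) (hd : Tendsto d atTop atTop)
    -- parameter space, true parameter and moment functions
    (q : ℕ) (Θ : Set (EuclideanSpace ℝ (Fin q))) (hΘ : IsCompact Θ)
    (θ₀ : EuclideanSpace ℝ (Fin q)) (hθ₀ : θ₀ ∈ interior Θ)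
    (g : ∀ n : ℕ, 𝒳 → EuclideanSpace ℝ (Fin q) → EuclideanSpace ℝ (Fin (d n)))
    (hgmeas : ∀ n θ, Measurable fun x => g n x θ)
    (hmoment : ∀ n, ∫ x, g n x θ₀ ∂P = 0)
    -- eigenvalues of the second moment matrix
    (hΩ : ∃ C : ℝ, 1 ≤ C ∧ ∀ n,
      spectrum ℝ (secondMomentMatrix P fun x => g n x θ₀) ⊆ Set.Icc C⁻¹ C)
    -- regularity of the moment functions near the true parameter
    (𝒩 : Set (EuclideanSpace ℝ (Fin q))) (h𝒩 : IsOpen 𝒩) (hθ₀𝒩 : θ₀ ∈ 𝒩)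
    (γ : ℝ) (hγ : 0 < γ)
    (hg_moment : ∃ C : ℝ, ∀ n,
      ∫⁻ x, ⨆ θ ∈ 𝒩, ‖g n x θ‖ₑ ^ (2 * (2 + γ)) ∂P ≤ ENNReal.ofReal (C * (d n : ℝ) ^ (2 + γ)))
    (hg_smooth : ∀ n, ∀ᵐ x ∂P, ContDiff ℝ 1 (g n x))
    (hg_grad : ∃ β : ℝ, 1 ≤ β ∧ ∃ C : ℝ, ∀ n,
      ∫⁻ x, ⨆ θ ∈ 𝒩, ‖fderiv ℝ (g n x) θ‖ₑ ^ (2 * β) ∂P ≤ ENNReal.ofReal (C * (d n : ℝ) ^ β))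
    (hg_lip : ∃ C : ℝ, ∃ δ : ℕ → 𝒳 → ℝ, (∀ n, Measurable (δ n)) ∧
      (∀ n, ∀ᵐ x ∂P, ∀ θ ∈ 𝒩,
        ‖fderiv ℝ (g n x) θ - fderiv ℝ (g n x) θ₀‖ ≤ C * δ n x * ‖θ - θ₀‖) ∧
      ∀ n, ∫⁻ x, ‖δ n x‖ₑ ^ 2 ∂P ≤ ENNReal.ofReal (C * d n))
    -- weighting matrices
    (W : ∀ n : ℕ, Matrix (Fin (d n)) (Fin (d n)) ℝ) (hW : ∀ n, (W n).PosDef)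
    (hWspec : ∃ C : ℝ, 1 ≤ C ∧ ∀ n, spectrum ℝ (W n) ⊆ Set.Icc C⁻¹ C)
    (What : ∀ n : ℕ, S → Matrix (Fin (d n)) (Fin (d n)) ℝ)
    (hWhat : ∀ n, ∀ᵐ ω ∂μ, (What n ω).PosDef)
    (hWhat_conv : IsLittleOInProb μ (fun n ω => matrixOpNorm (What n ω - W n))
      (fun n => (Real.sqrt (d n))⁻¹))
    -- the function defining the GEL criterion
    (𝒱 : Set ℝ) (h𝒱 : 𝒱 ∈ 𝓝 (0 : ℝ)) (s : ℝ → ℝ) (hs_concave : ConcaveOn ℝ 𝒱 s)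
    (hs_smooth : ContDiffOn ℝ 2 s 𝒱)
    (hs_lip : ∃ K : NNReal, ∃ U ∈ 𝓝 (0 : ℝ), LipschitzOnWith K (deriv (deriv s)) U)
    (hs_one : deriv s 0 = -1) (hs_two : deriv (deriv s) 0 = -1)
    -- bootstrap weights: `κ n ω` is their conditional law given the data
    (κ : ∀ n : ℕ, Kernel S (Fin n → ℝ)) [∀ n, IsMarkovKernel (κ n)]
    (hκ_indep : ∀ n, ∀ᵐ ω ∂μ, iIndepFun (fun (i : Fin n) (w : Fin n → ℝ) => w i) (κ n ω))
    (hκ_mean : ∀ n, ∀ᵐ ω ∂μ, ∀ i, ∫ w, w i ∂(κ n ω) = 0)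
    (hκ_var : ∀ n, ∀ᵐ ω ∂μ, ∀ i, ∫ w, (w i) ^ 2 ∂(κ n ω) = 1)
    (hκ_bdd : ∃ K : ℝ, ∀ n, ∀ᵐ ω ∂μ, ∀ᵐ w ∂(κ n ω), ∀ i, |w i| ≤ K)
    -- the estimators and their bootstrap versions
    (θGMM θGEL : ℕ → S → EuclideanSpace ℝ (Fin q))
    (hθGMM : ∀ n, ∀ᵐ ω ∂μ, IsArgminOn
      (fun θ => gmmCriterion (What n ω) (momentArray (g n) (firstObs X n ω) θ)) Θ (θGMM n ω))
    (hθGEL : ∀ n, ∀ᵐ ω ∂μ, IsArgminOn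
      (fun θ => gelCriterion s 𝒱 (momentArray (g n) (firstObs X n ω) θ)) Θ (θGEL n ω))
    (θGMMb θGELb : ∀ n : ℕ, S → (Fin n → ℝ) → EuclideanSpace ℝ (Fin q))
    (hθGMMb : ∀ n, ∀ᵐ ω ∂μ, ∀ᵐ w ∂(κ n ω), IsArgminOn
      (fun θ => gmmCriterion (What n ω) (bootMomentArray (g n) (firstObs X n ω) w θ)) Θ
      (θGMMb n ω w))
    (hθGELb : ∀ n, ∀ᵐ ω ∂μ, ∀ᵐ w ∂(κ n ω), IsArgminOn
      (fun θ => gelCriterion s 𝒱 (bootMomentArray (g n) (firstObs X n ω) w θ)) Θ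
      (θGELb n ω w))
    -- existence and rate of the maximizing multiplier of the bootstrap GEL criterion
    (lamb : ∀ n : ℕ, S → (Fin n → ℝ) → EuclideanSpace ℝ (Fin (d n)))
    (hlamb : BootEventually μ κ fun n ω w => IsArgmaxOn
      (gelObjective s (bootMomentArray (g n) (firstObs X n ω) w (θGELb n ω w)))
      (gelMultipliers 𝒱 (bootMomentArray (g n) (firstObs X n ω) w (θGELb n ω w)))
      (lamb n ω w))
    (hlamb_rate : IsBigOInBootProb μ κ (fun n ω w => ‖lamb n ω w‖ₑ)
      (fun n => Real.sqrt ((d n : ℝ) / n)))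
    -- rates of the estimators
    (hrateGMM : IsBigOInProb μ (fun n ω => ‖θGMM n ω - θ₀‖ₑ) (fun n => (Real.sqrt n)⁻¹))
    (hrateGEL : IsBigOInProb μ (fun n ω => ‖θGEL n ω - θ₀‖ₑ) (fun n => (Real.sqrt n)⁻¹))
    (hrateGMMb : IsBigOInBootProb μ κ (fun n ω w => ‖θGMMb n ω w - θ₀‖ₑ)
      (fun n => (Real.sqrt n)⁻¹))
    (hrateGELb : IsBigOInBootProb μ κ (fun n ω w => ‖θGELb n ω w - θ₀‖ₑ)
      (fun n => (Real.sqrt n)⁻¹))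
    -- growth of the number of moment conditions
    (hgrowth : Tendsto (fun n : ℕ => (d n : ℝ) ^ (max (2 + 4 / γ) 4) / (n : ℝ)) atTop (𝓝 0)) :
    IsLittleOInProb μ
      (fun n ω =>
        ‖gmmStatistic (What n ω) (momentArray (g n) (firstObs X n ω) (θGMM n ω))
          - quadForm (W n) (scaledSum (momentArray (g n) (firstObs X n ω) θ₀))‖ₑ)
      (fun n => Real.sqrt (d n)) ∧
    IsLittleOInProb μ
      (fun n ω =>
        (gelStatistic s 𝒱 (momentArray (g n) (firstObs X n ω) (θGEL n ω))
          - (quadForm (secondMomentMatrix P fun x => g n x θ₀)⁻¹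
              (scaledSum (momentArray (g n) (firstObs X n ω) θ₀)) : EReal)).abs)
      (fun n => Real.sqrt (d n)) ∧
    IsLittleOInBootProb μ κ
      (fun n ω w =>
        ‖gmmStatistic (What n ω) (bootMomentArray (g n) (firstObs X n ω) w (θGMMb n ω w))
          - quadForm (W n) (scaledSum (bootMomentArray (g n) (firstObs X n ω) w θ₀))‖ₑ)
      (fun n => Real.sqrt (d n)) ∧
    IsLittleOInBootProb μ κ
      (fun n ω w =>
        (gelStatistic s 𝒱 (bootMomentArray (g n) (firstObs X n ω) w (θGELb n ω w))
          - (quadForm (secondMomentMatrix P fun x => g n x θ₀)⁻¹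
              (scaledSum (bootMomentArray (g n) (firstObs X n ω) w θ₀)) : EReal)).abs)
      (fun n => Real.sqrt (d n)) := by
  have hP : IsProbabilityMeasure P := by
    rw [← hXlaw 0]
    exact Measure.isProbabilityMeasure_map (hXmeas 0).aemeasurable
  obtain ⟨C₁, ρ, δ, hρ, hobs, hrem⟩ := obsMoments_of_regularity P d hd q θ₀ g hgmeas 𝒩 h𝒩 hθ₀𝒩
    γ hγ hg_moment hg_smooth hg_grad hg_lip
  obtain ⟨C₂, hC₂, hΩC⟩ := hΩ
  obtain ⟨C₃, hC₃, hWC⟩ := hWspec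
  obtain ⟨K, hK⟩ := hκ_bdd
  -- One constant for the moments and for both families of eigenvalues; enlarging it only widens
  -- [C⁻¹, C].
  set C := max C₁ (max C₂ C₃) with hCdef
  have hC₂C : C₂ ≤ C := (le_max_left _ _).trans (le_max_right _ _)
  have hC₃C : C₃ ≤ C := (le_max_right _ _).trans (le_max_right _ _)
  have hC : 1 ≤ C := hC₂.trans hC₂C
  have hIcc : ∀ {c : ℝ}, 1 ≤ c → c ≤ C → Set.Icc c⁻¹ c ⊆ Set.Icc C⁻¹ C := fun h1 h2 =>
    Set.Icc_subset_Icc (inv_anti₀ (by linarith) h2) h2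
  have hΩs : ∀ n, spectrum ℝ (secondMomentMatrix P fun x => g n x θ₀) ⊆ Set.Icc C⁻¹ C :=
    fun n => (hΩC n).trans (hIcc hC₂ hC₂C)
  have hΩh : ∀ n, (secondMomentMatrix P fun x => g n x θ₀).IsHermitian := fun n =>
    secondMomentMatrix_isHermitian P _
  have hΩe := fun n => IsElliptic.of_spectrum hC (hΩh n) (hΩs n)
  have hΩi := fun n => IsElliptic.inv_of_spectrum hC (hΩh n) (hΩs n)
  have hΩu := fun n => isUnit_of_spectrum hC (hΩs n)
  have hWe : ∀ n, IsElliptic (W n) C := fun n =>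
    IsElliptic.of_spectrum hC (hW n).isHermitian ((hWC n).trans (hIcc hC₃ hC₃C))
  obtain ⟨L, ρs, hL, hρs, hT⟩ := exists_taylor_bound h𝒱 hs_smooth hs_lip hs_one hs_two
  have hO := hobs C (le_max_left _ _)
  have hθ₀Θ : θ₀ ∈ Θ := interior_subset hθ₀
  have hrates := fun (τ : ℝ) (hτ : 0 < τ) => eventually_rates hd (le_max_right _ _) hgrowth hτ
  have hrem' : ∀ (θ : ∀ n, S → (Fin n → ℝ) → EuclideanSpace ℝ (Fin q)) (n : ℕ), ∀ᵐ x ∂μ,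
      ∀ w, ‖θ n x w - θ₀‖ < ρ → ∀ i : Fin n,
      ‖g n (X i x) (θ n x w) - g n (X i x) θ₀ - ∑ j, (θ n x w - θ₀) j •
        fderiv ℝ (g n (X i x)) θ₀ (EuclideanSpace.single j 1)‖ ≤
      δ n (X i x) * ‖θ n x w - θ₀‖ ^ 2 := by
    intro θ n
    -- The exceptional set does not depend on θ', so data- and weight-dependent estimators may be
    -- substituted.
    have : ∀ᵐ x ∂μ, ∀ i : Fin n, ∀ θ', ‖θ' - θ₀‖ < ρ →
        ‖g n (X i x) θ' - g n (X i x) θ₀ - ∑ j, (θ' - θ₀) j •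
          fderiv ℝ (g n (X i x)) θ₀ (EuclideanSpace.single j 1)‖ ≤
        δ n (X i x) * ‖θ' - θ₀‖ ^ 2 :=
      ae_all_iff.2 fun i => ae_of_ae_map (hXmeas i).aemeasurable (by rw [hXlaw]; exact hrem n)
    filter_upwards [this] with x hx w hw i using hx i _ hw
  have hK' : ∀ n, ∀ᵐ ω ∂μ, ∀ᵐ w ∂(κ n ω), ∀ i, |w i| ≤ max K 0 := fun n => by
    filter_upwards [hK n] with ω hω
    filter_upwards [hω] with w hw i using (hw i).trans (le_max_left _ _)
  have hdir := fun (A : ∀ n, Matrix (Fin (d n)) (Fin (d n)) ℝ) (hA : ∀ n, IsElliptic (A n) C) =>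
    hO.tightArrays hC hd hXmeas hXindep hXlaw hmoment hΩe hA
  have hboot := fun (A : ∀ n, Matrix (Fin (d n)) (Fin (d n)) ℝ) =>
    hO.tightArrays_boot hd hXmeas hXindep hXlaw hκ_indep hκ_mean hκ_var hK' A
  have hdae : ∀ (n : ℕ) {p : S → (Fin n → ℝ) → Prop}, (∀ᵐ x ∂μ, p x 1) →
      ∀ᵐ x ∂μ, ∀ᵐ w ∂(Kernel.const S (Measure.dirac (1 : Fin n → ℝ)) x), p x w := by
    intro n p hp
    filter_upwards [hp] with x hx
    rw [Kernel.const_apply, ae_dirac_eq]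
    exact hx
  refine ⟨?_, ?_, ?_, ?_⟩
  -- For the original statistics the kernel is the point mass at the weight vector 1, at which the
  -- weighted arrays reduce to the unweighted ones.
  · have := isLittleO_gmm (v₀ := fun n x w => bootMomentArray (g n) (firstObs X n x) w θ₀)
      (v₁ := fun n x w => bootMomentArray (g n) (firstObs X n x) w (θGMM n x))
      hC hWe hrates (fun ε hε => by
        obtain ⟨B, hB, hBn⟩ := (hdir W hWe).likely_control zero_le_one hd
          (z := fun n x w i => g n (X i x) (θGMM n x)) (u := fun n x w => θGMM n x - θ₀)
          hrateGMM.boot hρ (hrem' fun n x _ => θGMM n x) hε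
        refine ⟨B, hB, ?_⟩
        filter_upwards [hBn] with n hn
        exact hn.mono le_rfl (Eventually.of_forall fun x => Eventually.of_forall fun w h => h.2.2))
      hWhat_conv (fun n => hdae n (by
        filter_upwards [hθGMM n] with x hx
        simp only [bootMomentArray_one]
        exact hx.2 hθ₀Θ))
    simpa only [bootMomentArray_one] using
      isLittleOInProb_of_boot_dirac (fun n => Real.sqrt_nonneg _) this
  · have := isLittleO_gel (v₀ := fun n x w => bootMomentArray (g n) (firstObs X n x) w θ₀)
      (v₁ := fun n x w => bootMomentArray (g n) (firstObs X n x) w (θGEL n x))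
      hL hρs hT hs_concave hC hΩe hΩi hΩu hrates (fun ε hε =>
        (hdir _ hΩi).likely_control zero_le_one hd
          (z := fun n x w i => g n (X i x) (θGEL n x)) (u := fun n x w => θGEL n x - θ₀)
          hrateGEL.boot hρ (hrem' fun n x _ => θGEL n x) hε)
      (fun n => hdae n (by
        filter_upwards [hθGEL n] with x hx
        simp only [bootMomentArray_one]
        exact hx.2 hθ₀Θ))
    simpa only [bootMomentArray_one] using
      isLittleOInProb_of_boot_dirac (fun n => Real.sqrt_nonneg _) this
  · refine isLittleO_gmm hC hWe hrates (fun ε hε => ?_) hWhat_conv (fun n => ?_)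
    · obtain ⟨B, hB, hBn⟩ := (hboot W).likely_control (le_max_right _ _) hd
        (z := fun n x w i => g n (X i x) (θGMMb n x w)) (u := fun n x w => θGMMb n x w - θ₀)
        hrateGMMb hρ (hrem' θGMMb) hε
      refine ⟨B, hB, ?_⟩
      filter_upwards [hBn] with n hn
      exact hn.mono le_rfl (Eventually.of_forall fun x => Eventually.of_forall fun w h => h.2.2)
    · filter_upwards [hθGMMb n] with x hx
      -- Minimality enters only through the competitor θ₀.
      filter_upwards [hx] with w hw using hw.2 hθ₀Θ
  · refine isLittleO_gel hL hρs hT hs_concave hC hΩe hΩi hΩu hrates (fun ε hε =>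
      (hboot _).likely_control (le_max_right _ _) hd
        (z := fun n x w i => g n (X i x) (θGELb n x w)) (u := fun n x w => θGELb n x w - θ₀)
        hrateGELb hρ (hrem' θGELb) hε) (fun n => ?_)
    filter_upwards [hθGELb n] with x hx
    filter_upwards [hx] with w hw using hw.2 hθ₀Θ
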